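/- Let $(W,S)$ be an even Coxeter system with $S$ finite (that is, for $s\ne s'$ in $S$, $m_{ss'}$ is even or $\infty$). For $T\subseteq S$ let $W_T$ be the subgroup generated by $T$; call $T$ spherical if $W_T$ is finite, and let $L$ be the nerve, i.e. the simplicial complex of nonempty spherical subsets. The Davis complex $\Sigma=\Sigma(W,S)$ is the geometric realization of the poset of cosets $wW_T$ ($w\in W$, $T$ spherical), and $K\subseteq\Sigma$ is the realization of the subposet $\{W_T\}$. The closed Coxeter cell of type $T$ with vertex set $wW_T$ is the realization of the poset of spherical cosets contained in $wW_T$; the vertices of this cellulation are the elements of $W$. Fix $t\in S$ and put $U=\{s\in S: m_{st}<\infty\}$. Let $\Omega(S,t)$ be the union of the closed cells whose type contains $t$, and $\partial\Omega(S,t)$ the union of the cells of $\Omega(S,t)$ whose type does not contain $t$. Let $\Omega$ be the path component of $\Omega(S,t)$ containing the vertex $e$ (its vertex set is $W_U$), $\partial\Omega=\Omega\cap\partial\Omega(S,t)$ and $K(U)=K\cap\Omega$. For a path component $B$ of $\partial\Omega$, the boundary collar $D_B$ is the union of the translates $wK(U)$ over the vertices $w$ of $B$, and its inner boundary $\partial_{in}(D_B)$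 is the full subcomplex of $D_B$ on the $0$-simplices $wW_T$ with $t\in T$. For $T\subseteq S$ let $g_{UT}:W_U\to W_T$ be the homomorphism with $g_{UT}(s)=s$ for $s\in U\cap T$ and $g_{UT}(s)=e$ for $s\in U-T$. The color of a vertex $w\in W_U$ is $c(w)=(g_{UT}(w)W_{T-t})_T\in\prod_T W_T/W_{T-t}$, the product being over all spherical $T\ni t$; all vertices of a component $B$ of $\partial\Omega$ have the same color, the color of $B$. The color $c(w)$ is even if $g_{U\{t\}}(w)=e$ and odd if $g_{U\{t\}}(w)=t$. The collar $F_c$ is the union of the boundary collars $D_B$ over the components $B$ of color $c$; it is even or odd as $c$ is, and $\partial_{in}(F_c)$ is the union of the corresponding $\partial_{in}(D_B)$. Let $F_o$ be an odd collar, and let $\mathcal F_{E'}$ be the union of all even collars and of an arbitrary (possibly empty) family of odd collars not including $F_o$. Then: 1. $F_o\cap\mathcal F_{E'}=\partial_{in}(F_o)$, and the sets $\partial_{in}(D_B)$, for $B$ of color $o$, are pairwise disjoint. 2. If $L$ is a flag complex, then $F_o\cap\mathcal F_{E'}$ is homeomorphic to a topological disjoint union of copies of the Davis complex $\Sigma(W_{U-t},U-t)$,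 indexed by the components $B$ of $\partial\Omega$ of color $o$, the copy with index $B$ corresponding to $\partial_{in}(D_B)$. 3. If $L$ is a flag triangulation of $\mathbb S^{n-1}$ ($n\ge 1$), then $F_o\cap\mathcal F_{E'}$ and each of the disjoint pieces $\partial_{in}(D_B)$ are topological $(n-1)$-manifolds. -/

import Mathlib

open scoped Pointwise

noncomputable section

namespace DavisRuin

/-! ### Simplicial complexes, posets and their geometric realizations -/

/-- The geometric realization of an abstract simplicial complex, in barycentric coordinates. As a
space it carries the topology of pointwise convergence of the coordinates. For a locally finite
complex this is the usual (weak) topology; all complexes used below (the nerve of a finitely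
generated Coxeter system, the order complex of its poset of spherical cosets) are locally finite. -/
def realization {V : Type*} (K : PreAbstractSimplicialComplex V) : Set (V → ℝ) :=
  {x | (∀ v, 0 ≤ x v) ∧
    ∃ σ ∈ K.faces, Function.support x = (σ : Set V) ∧ ∑ v ∈ σ, x v = 1}

open Classical in
/-- A flag complex: every nonempty finite set of pairwise adjacent vertices spans a simplex. -/
def IsFlag {V : Type*} (K : PreAbstractSimplicialComplex V) : Prop :=
  ∀ σ : Finset V, σ.Nonempty → (∀ i ∈ σ, ∀ j ∈ σ, ({i, j} : Finset V) ∈ K.faces) → σ ∈ K.faces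

/-- The simplicial complex of nonempty finite chains of a poset. -/
def orderComplex (P : Type*) [PartialOrder P] : PreAbstractSimplicialComplex P where
  faces := {σ | σ.Nonempty ∧ IsChain (· ≤ ·) (σ : Set P)}
  isRelLowerSet_faces := fun _ hσ =>
    ⟨hσ.1, fun _ hτσ hτ => ⟨hτ, hσ.2.mono (Finset.coe_subset.2 hτσ)⟩⟩

/-- A topological manifold (without boundary) of dimension `m`. -/
def IsTopManifold (m : ℕ) (X : Type*) [TopologicalSpace X] : Prop :=
  T2Space X ∧ SecondCountableTopology X ∧ Nonempty (ChartedSpace (EuclideanSpace ℝ (Fin m)) X)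

/-! ### The Davis complex of a group with a family of generators -/

section Davis

variable {B G : Type*} [Group G] (s : B → G)

/-- The special subgroup `W_T` generated by the generators in `T`. -/
def parabolic (T : Set B) : Subgroup G := Subgroup.closure (s '' T)

/-- `T` is spherical if `W_T` is finite. -/
def IsSpherical (T : Set B) : Prop := (parabolic s T : Set G).Finite

/-- The nerve: the simplicial complex of nonempty (finite) spherical sets of generators. -/
def nerve : PreAbstractSimplicialComplex B where
  faces := {σ | σ.Nonempty ∧ IsSpherical s (σ : Set B)}
  isRelLowerSet_faces := fun _ hσ =>
    ⟨hσ.1, fun _ hτσ hτ => ⟨hτ, hσ.2.subset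
      (Subgroup.closure_mono (Set.image_mono (Finset.coe_subset.2 hτσ)))⟩⟩

/-- The poset of spherical cosets `g W_T` (`T` spherical), ordered by inclusion. -/
abbrev SphericalCoset : Type _ :=
  {C : Set G // ∃ (g : G) (T : Set B), IsSpherical s T ∧ C = g • (parabolic s T : Set G)}

/-- Left multiplication on spherical cosets. -/
def leftMul (g : G) (C : SphericalCoset s) : SphericalCoset s :=
  ⟨g • (C : Set G), by
    obtain ⟨h, T, hT, hC⟩ := C.2
    exact ⟨g * h, T, hT, by rw [hC, smul_smul]⟩⟩

/-- The Davis complex: the geometric realization of the poset of spherical cosets. -/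
def davisComplex : Set (SphericalCoset s → ℝ) := realization (orderComplex (SphericalCoset s))

/-- The point of the Davis complex given by the coset `g W_∅ = {g}`: these are the vertices of the
cellulation by Coxeter cells. -/
def vertex (g : G) : SphericalCoset s → ℝ :=
  Set.indicator {C | (C : Set G) = {g}} 1

/-- The closed Coxeter cell of type `T` with vertex set `g W_T`: the realization of the subposet
of all spherical cosets contained in `g W_T`. -/
def closedCell (g : G) (T : Set B) : Set (SphericalCoset s → ℝ) :=
  {x ∈ davisComplex s | ∀ C, x C ≠ 0 → (C : Set G) ⊆ g • (parabolic s T : Set G)}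

/-- `Ω(V, T)`: the union of the closed cells of type `T'`, where `T ⊆ T' ⊆ V` is spherical. -/
def ruin (V T : Set B) : Set (SphericalCoset s → ℝ) :=
  {x | ∃ (g : G) (T' : Set B), IsSpherical s T' ∧ T' ⊆ V ∧ T ⊆ T' ∧ x ∈ closedCell s g T'}

/-- `∂Ω(V, T)`: the union of the closed cells of `Ω(V, T)` whose type does not contain `T`. -/
def ruinBoundary (V T : Set B) : Set (SphericalCoset s → ℝ) :=
  {x | ∃ (g : G) (T' : Set B), IsSpherical s T' ∧ T' ⊆ V ∧ ¬ T ⊆ T' ∧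
    closedCell s g T' ⊆ ruin s V T ∧ x ∈ closedCell s g T'}

/-- The fundamental chamber `K`: the realization of the subposet of the spherical subgroups
`W_T`. -/
def chamber : Set (SphericalCoset s → ℝ) :=
  {x ∈ davisComplex s | ∀ C, x C ≠ 0 → ∃ T, IsSpherical s T ∧ (C : Set G) = parabolic s T}

/-- The translate `g A` of a subset `A` of the Davis complex; the action of `g` is
`(g x)(C) = x (g⁻¹ C)`, so that `y ∈ g A` if and only if `C ↦ y (g C)` lies in `A`. -/
def translate (g : G) (A : Set (SphericalCoset s → ℝ)) : Set (SphericalCoset s → ℝ) :=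
  {y | (fun C => y (leftMul s g C)) ∈ A}

end Davis

/-! ### One-letter ruins and boundary collars -/

section Collars

variable {B W : Type*} [Group W] {M : CoxeterMatrix B} (cs : CoxeterSystem M W) (t : B)

/-- The set `U` of all generators `i` with `m_{it} < ∞` (in a `CoxeterMatrix`, the entry `0`
stands for `∞`). -/
def starSet (M : CoxeterMatrix B) (t : B) : Set B := {i | M i t ≠ 0}

/-- The generating family `U - t` of the special subgroup `W_{U-t}`. -/
def linkGenerator (i : ↥(starSet M t \ {t})) : parabolic cs.simple (starSet M t \ {t}) :=
  ⟨cs.simple i, Subgroup.subset_closure (Set.mem_image_of_mem _ i.2)⟩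

/-- `Ω`: the path component of the one-letter ruin `Ω(S, t)` that contains the vertex `e`. -/
def omega : Set (SphericalCoset cs.simple → ℝ) :=
  pathComponentIn (ruin cs.simple Set.univ {t}) (vertex cs.simple 1)

/-- `∂Ω = Ω ∩ ∂Ω(S, t)`. -/
def omegaBoundary : Set (SphericalCoset cs.simple → ℝ) :=
  omega cs t ∩ ruinBoundary cs.simple Set.univ {t}

/-- The path components of `∂Ω`. -/
def IsBoundaryComponent (Z : Set (SphericalCoset cs.simple → ℝ)) : Prop :=
  ∃ x ∈ omegaBoundary cs t, Z = pathComponentIn (omegaBoundary cs t) x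

/-- `K(U) = K ∩ Ω`. -/
def chamberU : Set (SphericalCoset cs.simple → ℝ) := chamber cs.simple ∩ omega cs t

/-- The boundary collar of a component `Z` of `∂Ω`: the union of the translates `w K(U)`, where `w`
is a vertex of `Z`. -/
def boundaryCollar (Z : Set (SphericalCoset cs.simple → ℝ)) :
    Set (SphericalCoset cs.simple → ℝ) :=
  {x | ∃ w : W, vertex cs.simple w ∈ Z ∧ x ∈ translate cs.simple w (chamberU cs t)}

/-- The inner boundary of a boundary collar (the end of the product `Z × [0, 1]` opposite to `Z`):
its full subcomplex on the `0`-simplices `g W_T` with `t ∈ T`. -/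
def innerBoundary (Z : Set (SphericalCoset cs.simple → ℝ)) :
    Set (SphericalCoset cs.simple → ℝ) :=
  {x ∈ boundaryCollar cs t Z | ∀ C, x C ≠ 0 → ∃ (g : W) (T : Set B),
    IsSpherical cs.simple T ∧ t ∈ T ∧ (C : Set W) = g • (parabolic cs.simple T : Set W)}

end Collars

/-! ### Colors -/

section Colors

variable {B W : Type*} [Group W] {M : CoxeterMatrix B} (cs : CoxeterSystem M W)

/-- Even Coxeter systems: `m_{ij}` is even or infinite for `i ≠ j` (`∞` is encoded by the even
number `0`). -/
def IsEvenMatrix (M : CoxeterMatrix B) : Prop := ∀ i j, i ≠ j → Even (M i j)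

open Classical in
/-- The map on generators that fixes the elements of `T` and kills all others. -/
def retractGen (T : Set B) (i : B) : parabolic cs.simple T :=
  if h : i ∈ T then ⟨cs.simple i, Subgroup.subset_closure (Set.mem_image_of_mem _ h)⟩ else 1

theorem isLiftable_retractGen (hM : IsEvenMatrix M) (T : Set B) :
    M.IsLiftable (retractGen cs T) := by
  intro i j
  have hsq : ∀ k, retractGen cs T k * retractGen cs T k = 1 := by
    intro k
    unfold retractGen
    split_ifs
    · exact Subtype.ext (cs.simple_mul_simple_self k)
    · exact one_mul 1
  by_cases hij : i = j
  · subst hij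
    rw [hsq, one_pow]
  by_cases hi : i ∈ T
  · by_cases hj : j ∈ T
    · apply Subtype.ext
      simp [retractGen, hi, hj]
    · obtain ⟨k, hk⟩ := hM i j hij
      have h1 : retractGen cs T j = 1 := by simp [retractGen, hj]
      rw [h1, mul_one, hk, ← two_mul, pow_mul, pow_two, hsq, one_pow]
  · obtain ⟨k, hk⟩ := hM i j hij
    have h1 : retractGen cs T i = 1 := by simp [retractGen, hi]
    rw [h1, one_mul, hk, ← two_mul, pow_mul, pow_two, hsq, one_pow]

/-- The homomorphism `g_{VT} : W_V → W_T` with `s ↦ s` for `s ∈ V ∩ T` and `s ↦ e` for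
`s ∈ V - T`. -/
def retractHom (hM : IsEvenMatrix M) (V T : Set B) :
    parabolic cs.simple V →* parabolic cs.simple T :=
  (cs.lift ⟨retractGen cs T, isLiftable_retractGen cs hM T⟩).comp
    (parabolic cs.simple V).subtype

variable (t : B)

/-- The set of colors: the product of `W_T / W_{T-t}` over all spherical `T` containing `t`. -/
abbrev Color : Type _ :=
  ∀ T : {T : Set B // IsSpherical cs.simple T ∧ t ∈ T},
    parabolic cs.simple (T : Set B) ⧸
      (parabolic cs.simple ((T : Set B) \ {t})).subgroupOf (parabolic cs.simple (T : Set B))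

variable (hM : IsEvenMatrix M)

/-- The color `c(w) = w · ē` of a vertex `w ∈ W_U`: the diagonal action of `w` through the maps
`g_{UT}` on the tuple `ē` of trivial cosets. -/
def color (w : parabolic cs.simple (starSet M t)) : Color cs t := fun T =>
  retractHom cs hM (starSet M t) T w •
    (QuotientGroup.mk 1 : parabolic cs.simple (T : Set B) ⧸
      (parabolic cs.simple ((T : Set B) \ {t})).subgroupOf (parabolic cs.simple (T : Set B)))

/-- A color is even if it is the color of a vertex `w` with `g_{U,{t}}(w) = e`. -/
def IsEvenColor (a : Color cs t) : Prop :=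
  ∃ w : parabolic cs.simple (starSet M t), color cs t hM w = a ∧
    (retractHom cs hM (starSet M t) {t} w : W) = 1

/-- A color is odd if it is the color of a vertex `w` with `g_{U,{t}}(w) = t`. -/
def IsOddColor (a : Color cs t) : Prop :=
  ∃ w : parabolic cs.simple (starSet M t), color cs t hM w = a ∧
    (retractHom cs hM (starSet M t) {t} w : W) = cs.simple t

/-- The components of `∂Ω` of color `a` (all vertices of a component have the same color). -/
def ComponentOfColor (a : Color cs t) : Set (Set (SphericalCoset cs.simple → ℝ)) :=
  {Z | IsBoundaryComponent cs t Z ∧ ∃ w : parabolic cs.simple (starSet M t),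
    vertex cs.simple (w : W) ∈ Z ∧ color cs t hM w = a}

/-- The `a`-collar `F_a`: the union of the boundary collars of the components of color `a`. -/
def collar (a : Color cs t) : Set (SphericalCoset cs.simple → ℝ) :=
  ⋃ Z ∈ ComponentOfColor cs t hM a, boundaryCollar cs t Z

/-- The inner boundary of the `a`-collar: the union of the inner boundaries of its boundary
collars. -/
def collarInnerBoundary (a : Color cs t) : Set (SphericalCoset cs.simple → ℝ) :=
  ⋃ Z ∈ ComponentOfColor cs t hM a, innerBoundary cs t Z

/-- The union of all even collars and of the collars with color in `O`. -/
def evenCollarsUnion (O : Set (Color cs t)) : Set (SphericalCoset cs.simple → ℝ) :=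
  (⋃ a ∈ {a | IsEvenColor cs t hM a}, collar cs t hM a) ∪ ⋃ a ∈ O, collar cs t hM a

end Colors

end DavisRuin

end

/-! A point of the Davis complex is a positive weight on a chain of spherical cosets, its carrier.
By `mem_boundaryCollar` and `mem_innerBoundary`, it lies in a boundary collar `D_B` iff some vertex
`w` of `B` lies in every coset of the carrier and every type stays spherical after adding `t`; it
lies in the inner boundary iff moreover `t` belongs to every type. The vertices of a component of
`∂Ω` form one coset of `W_{U-t}`.

Intersection: suppose that a point lies in collars of two colors, through vertices `w` and `w'`. If
some type `T` in its carrier missed `t`, then `w⁻¹ w'` would lie in `W_T ⊆ W_{U-t}` and the colors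
would agree. Conversely, if `t` is in all types, then `wt` lies in the same cosets as `w`, and its
color has the opposite parity. Disjointness: two vertices of one color in a coset of type `T ∋ t`
differ by an element of `W_{T-t}`, by the `T`-component of the color, so they lie in one component.
See `mem_innerBoundary_of_mem_collars`, `component_eq_of_mem_coset`,
`collar_inter_evenCollarsUnion`.

Flag case: evenness puts every spherical `T ∋ t` inside `U`, and flagness makes `T ↦ T ∪ {t}` a
bijection from the spherical subsets of `U - t` to the spherical sets containing `t`. With `W_{T ∪
t} ∩ W_{U-t} = W_T`, the map `u W_T ↦ g u W_{T ∪ t}` identifies the coset poset of `W_{U-t}` with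
that of one inner boundary. The pieces are open, so the union is topologically disjoint.

Manifolds: near a cell of type `T₀` the Davis complex is an open part of the model space of vectors
that are nonnegative off `T₀` and for which `T₀` together with the support is spherical. The chart
unfolds the finite group `W_{T₀}` by its dual geometric representation, whose chamber is a strict
fundamental domain; Tits' sign theorem `dualRep_inv_nonneg` is behind this and behind the facts on
special subgroups. For `W_{U-t}`, homogeneous coordinates with `t`-coordinate `1` identify the model
space with an open subset of the nerve `L`, hence of the sphere. Only open stars in `L` are used, so
links in `L` need not be spheres. -/

open scoped Pointwise

namespace DavisRuin

/-! ### The dual geometric representation -/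

section Tits

variable {B W : Type*} [Group W] {M : CoxeterMatrix B} (cs : CoxeterSystem M W)

/-- The vector of Cartan numbers `-2 cos (π / m_{ij})`, `j ∈ B`. -/
noncomputable def cartanVec (M : CoxeterMatrix B) (i : B) : B → ℝ :=
  -- An infinite label is coded by `0`, and `π / 0 = 0` then gives the usual Cartan number `-2`.
  fun j => -2 * Real.cos (Real.pi / M i j)

theorem cartanVec_self (M : CoxeterMatrix B) (i : B) : cartanVec M i i = 2 := by
  simp [cartanVec]

theorem cartanVec_comm (M : CoxeterMatrix B) (i j : B) : cartanVec M i j = cartanVec M j i := by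
  simp [cartanVec, M.symmetric i j]

theorem proj_cartanVec_self (M : CoxeterMatrix B) (i : B) :
    (LinearMap.proj i : (B → ℝ) →ₗ[ℝ] ℝ) (cartanVec M i) = 2 := cartanVec_self M i

/-- The simple reflections of the dual geometric representation. -/
noncomputable def dualReflection (M : CoxeterMatrix B) (i : B) : (B → ℝ) ≃ₗ[ℝ] (B → ℝ) :=
  Module.reflection (proj_cartanVec_self M i)

theorem dualReflection_apply (M : CoxeterMatrix B) (i : B) (v : B → ℝ) :
    dualReflection M i v = v - v i • cartanVec M i := by
  simp [dualReflection, Module.reflection_apply]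

theorem isLiftable_dualReflection (M : CoxeterMatrix B) : M.IsLiftable (dualReflection M) := by
  intro i j
  by_cases hij : i = j
  · subst hij
    rw [M.diagonal, pow_one]
    ext1 v
    exact Module.involutive_reflection _ v
  obtain h0 | h0 := eq_or_ne (M i j) 0
  · rw [h0, pow_zero]
  have h1 : M i j ≠ 1 := M.off_diagonal i j hij
  ext1 v
  change _ = v
  -- This case is separate because the sine of the rotation angle `2π / m`, cancelled below,
  -- vanishes for `m = 2`.
  by_cases h2 : M i j = 2
  · have hc : cartanVec M i j = 0 := by simp [cartanVec, h2]
    have hc' : cartanVec M j i = 0 := by rw [cartanVec_comm, hc]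
    rw [h2, pow_two]
    simp only [LinearEquiv.mul_apply, dualReflection_apply]
    funext k
    simp [hc, hc', cartanVec_self]
    ring
  have h3 : 3 ≤ M i j := by omega
  have hm : (0 : ℝ) < M i j := by exact_mod_cast (by omega : 0 < M i j)
  set φ : ℝ := 2 * (Real.pi / M i j) with hφ
  have ht : 2 * Real.cos φ = (LinearMap.proj i : (B → ℝ) →ₗ[ℝ] ℝ) (cartanVec M j) *
      (LinearMap.proj j : (B → ℝ) →ₗ[ℝ] ℝ) (cartanVec M i) - 2 := by
    rw [hφ, Real.cos_two_mul]
    simp [cartanVec, M.symmetric j i]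
    ring
  have hs : Real.sin φ ≠ 0 := by
    apply ne_of_gt
    apply Real.sin_pos_of_pos_of_lt_pi
    · have := Real.pi_pos
      positivity
    · rw [hφ, ← mul_div_assoc, div_lt_iff₀ hm]
      have : (3 : ℝ) ≤ M i j := by exact_mod_cast h3
      nlinarith [Real.pi_pos]
  -- `S_k(2 cos φ) sin φ = sin ((k+1)φ)`, and `(k+1)φ + (l+1)φ = mφ = 2π`, so the two sines cancel.
  have hS : ∀ k l : ℤ, (k + l + 2 : ℤ) = M i j →
      (Polynomial.Chebyshev.S ℝ k).eval (2 * Real.cos φ) +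
        (Polynomial.Chebyshev.S ℝ l).eval (2 * Real.cos φ) = 0 := by
    intro k l hkl
    apply mul_right_cancel₀ hs
    rw [add_mul, Polynomial.Chebyshev.S_two_mul_real_cos, Polynomial.Chebyshev.S_two_mul_real_cos,
      zero_mul]
    have : ((l : ℝ) + 1) * φ = 2 * Real.pi - ((k : ℝ) + 1) * φ := by
      have h4 : ((k : ℝ) + l + 2) = M i j := by exact_mod_cast hkl
      have h5 : (M i j : ℝ) * φ = 2 * Real.pi := by
        rw [hφ]
        field_simp
      rw [← h5, ← h4]
      ring
    rw [this, Real.sin_two_pi_sub]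
    ring
  have key := Module.reflection_mul_reflection_pow_apply (proj_cartanVec_self M i)
    (proj_cartanVec_self M j) (M i j) v (2 * Real.cos φ) ht
  change ((dualReflection M i * dualReflection M j) ^ M i j) v = _ at key
  rw [key]
  have hz : ∀ k l : ℤ, (k + l + 2 : ℤ) = M i j → k = l →
      (Polynomial.Chebyshev.S ℝ k).eval (2 * Real.cos φ) = 0 := by
    intro k l hkl e
    subst e
    have := hS k k hkl
    linarith
  -- For even `m` the relevant Chebyshev values are paired with themselves and vanish; for odd `m`
  -- neighbouring ones cancel.
  rcases Nat.even_or_odd' (M i j) with ⟨p, hp | hp⟩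
  · rw [hz (((M i j : ℕ) - 2 : ℤ) / 2) (((M i j : ℕ) - 2 : ℤ) / 2) (by omega) rfl,
      hz (((M i j : ℕ) - 1 : ℤ) / 2) (((M i j : ℕ) - 1 : ℤ) / 2) (by omega) rfl]
    simp
  · rw [hS (((M i j : ℕ) - 1 : ℤ) / 2) (((M i j : ℕ) - 3 : ℤ) / 2) (by omega),
      hS (((M i j : ℕ) : ℤ) / 2) (((M i j : ℕ) - 2 : ℤ) / 2) (by omega)]
    simp

/-- The dual geometric representation of a Coxeter group, on the functions on the generators. -/
noncomputable def dualRep : W →* ((B → ℝ) ≃ₗ[ℝ] (B → ℝ)) :=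
  cs.lift ⟨dualReflection M, isLiftable_dualReflection M⟩

theorem dualRep_simple (i : B) (v : B → ℝ) :
    dualRep cs (cs.simple i) v = v - v i • cartanVec M i := by
  rw [dualRep, CoxeterSystem.lift_apply_simple, dualReflection_apply]

theorem dualRep_simple_self (i : B) (v : B → ℝ) : dualRep cs (cs.simple i) v i = - v i := by
  simp [dualRep_simple, cartanVec_self]
  ring

theorem dualRep_mul (g h : W) (v : B → ℝ) :
    dualRep cs (g * h) v = dualRep cs g (dualRep cs h v) := by
  rw [map_mul, LinearEquiv.mul_apply]

theorem dualRep_inv_apply_eq {g : W} {v v' : B → ℝ} (h : dualRep cs g v = v') :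
    dualRep cs g⁻¹ v' = v := by
  rw [← h, ← dualRep_mul, inv_mul_cancel, map_one]
  rfl

/-! ### Roots of rank two and the sign of a root on the chamber. -/

/-- The coefficients of the roots in a dihedral root system. -/
noncomputable def dihedralCoeff (m : ℕ) (q : ℝ) : ℝ :=
  -- The value `q` is the limit of the quotient as the angle tends to `0`, so the recursion below
  -- also covers the infinite dihedral group.
  if m = 0 then q else Real.sin (q * (Real.pi / m)) / Real.sin (Real.pi / m)

theorem dihedralCoeff_zero (m : ℕ) : dihedralCoeff m 0 = 0 := by
  simp [dihedralCoeff]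

theorem sin_pi_div_pos {m : ℕ} (h : 2 ≤ m) : 0 < Real.sin (Real.pi / m) := by
  have h2 : (2 : ℝ) ≤ m := by exact_mod_cast h
  apply Real.sin_pos_of_pos_of_lt_pi
  · have := Real.pi_pos
    positivity
  · rw [div_lt_iff₀ (by linarith)]
    nlinarith [Real.pi_pos]

theorem dihedralCoeff_one {m : ℕ} (h : m ≠ 1) : dihedralCoeff m 1 = 1 := by
  unfold dihedralCoeff
  split_ifs with h0
  · rfl
  · rw [one_mul, div_self (sin_pi_div_pos (by omega)).ne']

theorem dihedralCoeff_neg_one {m : ℕ} (h : m ≠ 1) : dihedralCoeff m (-1) = -1 := by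
  unfold dihedralCoeff
  split_ifs with h0
  · rfl
  · rw [neg_one_mul, Real.sin_neg, neg_div, div_self (sin_pi_div_pos (by omega)).ne']

theorem dihedralCoeff_add_one (m : ℕ) (q : ℝ) :
    dihedralCoeff m (q + 1) =
      2 * Real.cos (Real.pi / m) * dihedralCoeff m q - dihedralCoeff m (q - 1) := by
  unfold dihedralCoeff
  split_ifs with h0
  · subst h0
    simp
    ring
  · rw [add_mul, sub_mul, one_mul, Real.sin_add, Real.sin_sub]
    ring

theorem dihedralCoeff_nonneg {m : ℕ} (h : m ≠ 1) {q : ℕ} (hq : m = 0 ∨ q ≤ m) :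
    0 ≤ dihedralCoeff m q := by
  unfold dihedralCoeff
  split_ifs with h0
  · positivity
  · have hqm : (q : ℝ) ≤ m := by exact_mod_cast hq.resolve_left h0
    have hm : (0 : ℝ) < m := by exact_mod_cast Nat.pos_of_ne_zero h0
    apply div_nonneg _ (sin_pi_div_pos (by omega)).le
    have := Real.pi_pos
    apply Real.sin_nonneg_of_nonneg_of_le_pi (by positivity)
    rw [← mul_div_assoc, div_le_iff₀ hm]
    nlinarith

/-- The dihedral coefficients obey the same three-term recursion as the coordinates under
alternating reflections. Here `a` and `b` are `z i` and `z j`, in an order that depends on the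
parity of `q`; the existential hides this. -/
theorem dualRep_alternatingWord {i j : B} (hij : i ≠ j) (q : ℕ) (z : B → ℝ)
    (hi : 0 ≤ z i) (hj : 0 ≤ z j) : ∃ a b : ℝ, 0 ≤ a ∧ 0 ≤ b ∧
    dualRep cs (cs.wordProd (CoxeterSystem.alternatingWord i j q))⁻¹ z i =
      dihedralCoeff (M i j) (q + 1) * a + dihedralCoeff (M i j) q * b ∧
    dualRep cs (cs.wordProd (CoxeterSystem.alternatingWord i j q))⁻¹ z j =
      -(dihedralCoeff (M i j) q * a + dihedralCoeff (M i j) (q - 1) * b) := by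
  induction q generalizing i j with
  | zero =>
    refine ⟨z i, z j, hi, hj, ?_, ?_⟩ <;>
    simp [CoxeterSystem.alternatingWord, dihedralCoeff_zero, dihedralCoeff_one (M.off_diagonal i j hij),
      dihedralCoeff_neg_one (M.off_diagonal i j hij)]
  | succ q ih =>
    obtain ⟨a, b, ha, hb, h1, h2⟩ := ih hij.symm hj hi
    rw [M.symmetric j i] at h1 h2
    have e : cartanVec M j i = -2 * Real.cos (Real.pi / M i j) := by
      rw [cartanVec, M.symmetric]
    refine ⟨a, b, ha, hb, ?_, ?_⟩
    · rw [CoxeterSystem.alternatingWord_succ, cs.wordProd_concat, mul_inv_rev, cs.inv_simple,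
        dualRep_mul, dualRep_simple, Pi.sub_apply, Pi.smul_apply, h1, h2, e]
      push_cast
      rw [dihedralCoeff_add_one (M i j) (q + 1), dihedralCoeff_add_one (M i j) q,
        add_sub_cancel_right, smul_eq_mul]
      ring
    · rw [CoxeterSystem.alternatingWord_succ, cs.wordProd_concat, mul_inv_rev, cs.inv_simple,
        dualRep_mul, dualRep_simple_self, h1]
      push_cast
      rw [add_sub_cancel_right]

/-- The fundamental theorem on the geometric representation: if `ℓ (w s_i) > ℓ (w)`, then the
root `w α_i` is nonnegative on the fundamental chamber. -/
theorem dualRep_inv_nonneg (w : W) (i : B) (h : ¬ cs.IsRightDescent w i) (v : B → ℝ)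
    (hv : ∀ k, 0 ≤ v k) : 0 ≤ dualRep cs w⁻¹ v i := by
  induction hn : cs.length w using Nat.strong_induction_on generalizing w i with
  | _ n ih =>
  by_cases hw : w = 1
  · subst hw
    simpa using hv i
  obtain ⟨j, hj⟩ := cs.exists_rightDescent_of_ne_one hw
  have hij : i ≠ j := by
    rintro rfl
    exact h hj
  classical
  -- Split off from `w` the longest alternating suffix in `i, j` that ends in `j` and is
  -- length-additive; `u` is what remains.
  let p : ℕ → Prop := fun q => ∃ u : W, w = u * cs.wordProd (CoxeterSystem.alternatingWord i j q) ∧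
    cs.length w = cs.length u + q
  have hp1 : p 1 := by
    refine ⟨w * cs.simple j, by simp [CoxeterSystem.alternatingWord], ?_⟩
    exact ((cs.isRightDescent_iff).1 hj).symm
  have hbd : ∀ q, p q → q ≤ cs.length w := by
    rintro q ⟨u, -, hu⟩
    omega
  have hpq := Nat.findGreatest_spec (hbd 1 hp1) hp1
  have hmax : ∀ r, p r → r ≤ Nat.findGreatest p (cs.length w) := fun r hr =>
    Nat.le_findGreatest (hbd r hr) hr
  set q := Nat.findGreatest p (cs.length w) with hq
  have hq1 : 1 ≤ q := hmax 1 hp1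
  clear_value q
  obtain ⟨u, hu, hlu⟩ := hpq
  have hlen : ∀ (x : W) (ω : List B), w = x * cs.wordProd ω → cs.length w ≤ cs.length x + ω.length := by
    rintro x ω rfl
    exact (cs.length_mul_le _ _).trans (Nat.add_le_add_left (cs.length_wordProd_le _) _)
  -- For `q = m` the braid relation would let the suffix end in `i`, making `i` a descent of `w`;
  -- for `q > m` the suffix would not be reduced.
  have hqm : M i j = 0 ∨ q + 1 ≤ M i j := by
    by_contra! hc
    obtain ⟨h0, hlt⟩ := hc
    apply h
    obtain rfl | hlt' := (Nat.lt_succ_iff.1 hlt).eq_or_lt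
    · have hb := cs.wordProd_braidWord_eq i j
      obtain ⟨k, hk⟩ := Nat.exists_eq_succ_of_ne_zero h0
      unfold CoxeterSystem.braidWord at hb
      rw [hb, M.symmetric j i, hk, CoxeterSystem.alternatingWord_succ, cs.wordProd_concat,
        ← mul_assoc] at hu
      have h1 : w * cs.simple i = u * cs.wordProd (CoxeterSystem.alternatingWord i j k) := by
        rw [hu, cs.simple_mul_simple_cancel_right]
      have h2 := (cs.length_mul_le u _).trans (Nat.add_le_add_left
        (cs.length_wordProd_le (CoxeterSystem.alternatingWord i j k)) _)
      rw [← h1, CoxeterSystem.length_alternatingWord] at h2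
      unfold CoxeterSystem.IsRightDescent
      omega
    · exfalso
      refine cs.not_isReduced_alternatingWord i j h0 hlt' ?_
      unfold CoxeterSystem.IsReduced
      apply le_antisymm (cs.length_wordProd_le _)
      have := cs.length_mul_le u (cs.wordProd (CoxeterSystem.alternatingWord i j q))
      rw [← hu] at this
      rw [CoxeterSystem.length_alternatingWord]
      omega
  -- A descent of `u` at one of the two letters would lengthen the suffix beyond the maximum; at the
  -- other it would cancel the first letter of the suffix and make `w` too short.
  have hasc : ∀ k, k = i ∨ k = j → ¬ cs.IsRightDescent u k := by
    intro k hk hd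
    have hd' := (cs.isRightDescent_iff).1 hd
    have hk' : (k = if Even q then j else i) ∨ k = if Even (q - 1) then j else i := by
      rcases Nat.even_or_odd q with he | ho
      · have : ¬ Even (q - 1) := by
          rw [Nat.not_even_iff_odd]
          exact Nat.Even.sub_odd hq1 he odd_one
        simp only [he, this, if_true, if_false]
        tauto
      · have : Even (q - 1) := Nat.Odd.sub_odd ho odd_one
        simp only [Nat.not_even_iff_odd.2 ho, this, if_true, if_false]
        tauto
    rcases hk' with hk' | hk'
    · have : p (q + 1) := by
        refine ⟨u * cs.simple k, ?_, by omega⟩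
        rw [CoxeterSystem.alternatingWord_succ', ← hk', cs.wordProd_cons, mul_assoc,
          cs.simple_mul_simple_cancel_left, ← hu]
      have := hmax _ this
      omega
    · obtain ⟨r, rfl⟩ := Nat.exists_eq_add_of_le' hq1
      rw [Nat.add_sub_cancel] at hk'
      have := hlen (u * cs.simple k) (CoxeterSystem.alternatingWord i j r) (by
        rw [hu, CoxeterSystem.alternatingWord_succ', ← hk', cs.wordProd_cons, mul_assoc])
      rw [CoxeterSystem.length_alternatingWord] at this
      omega
  have hlt : cs.length u < n := by omega
  obtain ⟨a, b, ha, hb, h1, -⟩ := dualRep_alternatingWord cs hij q (dualRep cs u⁻¹ v)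
    (ih _ hlt u i (hasc i (Or.inl rfl)) rfl) (ih _ hlt u j (hasc j (Or.inr rfl)) rfl)
  rw [hu, mul_inv_rev, dualRep_mul, h1]
  have hM1 := M.off_diagonal i j hij
  have c1 : 0 ≤ dihedralCoeff (M i j) ((q : ℝ) + 1) := by
    have := dihedralCoeff_nonneg hM1 (q := q + 1) hqm
    push_cast at this
    exact this
  have c2 : 0 ≤ dihedralCoeff (M i j) (q : ℝ) :=
    dihedralCoeff_nonneg hM1 (q := q) (by omega)
  positivity

theorem dualRep_inv_nonpos (w : W) (i : B) (h : cs.IsRightDescent w i) (v : B → ℝ)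
    (hv : ∀ k, 0 ≤ v k) : dualRep cs w⁻¹ v i ≤ 0 := by
  have h1 := dualRep_inv_nonneg cs (w * cs.simple i) i
    (cs.isRightDescent_iff_not_isRightDescent_mul.1 h) v hv
  rw [mul_inv_rev, cs.inv_simple, dualRep_mul, dualRep_simple_self] at h1
  linarith

/-! ### Special subgroups -/

theorem simple_mem_parabolic {T : Set B} {i : B} (hi : i ∈ T) :
    cs.simple i ∈ parabolic cs.simple T :=
  Subgroup.subset_closure (Set.mem_image_of_mem _ hi)

theorem parabolic_mono {G : Type*} [Group G] (s : B → G) {T T' : Set B} (h : T ⊆ T') :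
    parabolic s T ≤ parabolic s T' :=
  Subgroup.closure_mono (Set.image_mono h)

theorem parabolic_induction {T : Set B} {p : ∀ w, w ∈ parabolic cs.simple T → Prop}
    (one : p 1 (one_mem _))
    (mul : ∀ i (hi : i ∈ T) w (hw : w ∈ parabolic cs.simple T), p w hw →
      p (cs.simple i * w) (mul_mem (simple_mem_parabolic cs hi) hw))
    {w : W} (hw : w ∈ parabolic cs.simple T) : p w hw := by
  induction hw using Subgroup.closure_induction_left with
  | one => exact one
  | mul_left x hx y hy h =>
    obtain ⟨i, hi, rfl⟩ := hx
    exact mul i hi y hy h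
  | inv_mul_cancel x hx y hy h =>
    obtain ⟨i, hi, rfl⟩ := hx
    have := mul i hi y hy h
    simpa only [cs.inv_simple]

/-- On the coordinates in `T`, the action of `W_T` depends only on these coordinates. -/
theorem dualRep_congr {T : Set B} {w : W} (hw : w ∈ parabolic cs.simple T) {v v' : B → ℝ}
    (h : ∀ i ∈ T, v i = v' i) : ∀ i ∈ T, dualRep cs w v i = dualRep cs w v' i := by
  induction hw using parabolic_induction with
  | one => simpa using h
  | mul j hj x _ hx =>
    intro i hi
    simp only [dualRep_mul, dualRep_simple, Pi.sub_apply, Pi.smul_apply, hx i hi, hx j hj]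

theorem dualRep_eq_self {T : Set B} {w : W} (hw : w ∈ parabolic cs.simple T) {v : B → ℝ}
    (h : ∀ i ∈ T, v i = 0) : dualRep cs w v = v := by
  induction hw using parabolic_induction with
  | one => simp
  | mul j hj x _ hx => rw [dualRep_mul, hx, dualRep_simple, h j hj, zero_smul, sub_zero]

/-- For `i ∉ T` the unit vector at `i` vanishes on `T`, so `W_T` fixes it; its `i`-th coordinate
stays `1`, against the sign forced by a descent. -/
theorem mem_of_isRightDescent {T : Set B} {w : W} (hw : w ∈ parabolic cs.simple T) {i : B}
    (h : cs.IsRightDescent w i) : i ∈ T := by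
  classical
  by_contra hi
  have h1 := dualRep_inv_nonpos cs w i h (Pi.single i 1) (fun k => by
    by_cases hk : k = i
    · subst hk; simp
    · simp [hk])
  rw [dualRep_eq_self cs (inv_mem hw)] at h1
  · simp at h1
    linarith
  · intro j hj
    rw [Pi.single_eq_of_ne]
    rintro rfl
    exact hi hj

theorem simple_mem_parabolic_iff {T : Set B} {i : B} :
    cs.simple i ∈ parabolic cs.simple T ↔ i ∈ T := by
  refine ⟨fun h => mem_of_isRightDescent cs h ?_, simple_mem_parabolic cs⟩
  simp [CoxeterSystem.IsRightDescent]

/-- The fundamental chamber of `W_T` is a strict fundamental domain, and stabilizers are generated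
by the simple reflections that they contain. -/
theorem eq_and_mem_of_dualRep_eq {T : Set B} {w : W} (hw : w ∈ parabolic cs.simple T)
    {a a' : B → ℝ} (ha : ∀ i ∈ T, 0 ≤ a i) (ha' : ∀ i ∈ T, 0 ≤ a' i)
    (h : ∀ i ∈ T, dualRep cs w a i = a' i) :
    (∀ i ∈ T, a i = a' i) ∧ w ∈ parabolic cs.simple {i ∈ T | a i = 0} := by
  induction hn : cs.length w using Nat.strong_induction_on generalizing w with
  | _ n ih =>
  by_cases hw1 : w = 1
  · subst hw1
    exact ⟨by simpa using h, one_mem _⟩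
  obtain ⟨j, hj⟩ := cs.exists_rightDescent_of_ne_one hw1
  have hjT := mem_of_isRightDescent cs hw hj
  classical
  -- The descent makes `(w⁻¹ a')_j` nonpositive, with `a'` extended by `0` off `T`, and this number
  -- is `a j`. So the `j`-th reflection fixes `a`, and the induction continues with a shorter
  -- element.
  have h0 : a j = 0 := by
    apply le_antisymm _ (ha j hjT)
    have h1 := dualRep_inv_nonpos cs w j hj (fun i => if i ∈ T then a' i else 0) (fun k => by
      split_ifs with hk
      · exact ha' k hk
      · exact le_rfl)
    rw [dualRep_congr cs (inv_mem hw) (v' := dualRep cs w a)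
      (fun i hi => by rw [if_pos hi, h i hi]) j hjT, dualRep_inv_apply_eq cs rfl] at h1
    exact h1
  have h1 : dualRep cs (w * cs.simple j) a = dualRep cs w a := by
    rw [dualRep_mul, dualRep_simple, h0, zero_smul, sub_zero]
  have hl := cs.isRightDescent_iff.1 hj
  obtain ⟨e1, e2⟩ := ih (cs.length (w * cs.simple j)) (by omega)
    (mul_mem hw (simple_mem_parabolic cs hjT)) (by rwa [h1]) rfl
  refine ⟨e1, ?_⟩
  have := mul_mem e2 (simple_mem_parabolic cs (T := {i ∈ T | a i = 0}) (i := j) ⟨hjT, h0⟩)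
  rwa [cs.simple_mul_simple_cancel_right] at this

theorem parabolic_univ : parabolic cs.simple Set.univ = ⊤ := by
  rw [parabolic, Set.image_univ, cs.subgroup_closure_range_simple]

theorem mem_parabolic_of_dualRep_eq {a : B → ℝ} (ha : ∀ i, 0 ≤ a i) {w : W}
    (h : dualRep cs w a = a) : w ∈ parabolic cs.simple {i | a i = 0} := by
  simpa using (eq_and_mem_of_dualRep_eq cs (T := Set.univ) (w := w) (by simp [parabolic_univ])
    (fun i _ => ha i) (fun i _ => ha i) (fun i _ => by rw [h])).2

/-- The sum of the indicators of the complements of `T` and `T'` is fixed by both subgroups and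
vanishes exactly on `T ∩ T'`; its stabilizer is generated by the simple reflections at its zeros. -/
theorem parabolic_inf (T T' : Set B) :
    parabolic cs.simple T ⊓ parabolic cs.simple T' = parabolic cs.simple (T ∩ T') := by
  classical
  apply le_antisymm
  · rintro w ⟨h, h'⟩
    let a : Set B → B → ℝ := fun S i => if i ∈ S then 0 else 1
    have ha : ∀ S i, 0 ≤ a S i := fun S i => by
      simp only [a]
      split_ifs <;> norm_num
    have h1 : dualRep cs w (a T + a T') = a T + a T' := by
      rw [map_add, dualRep_eq_self cs h, dualRep_eq_self cs h']
      · intro i hi; simp [a, hi]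
      · intro i hi; simp [a, hi]
    have h2 := mem_parabolic_of_dualRep_eq cs
      (fun i => add_nonneg (ha T i) (ha T' i)) h1
    refine parabolic_mono cs.simple ?_ h2
    intro i hi
    have hi : a T i + a T' i = 0 := hi
    have e1 : a T i = 0 := by linarith [ha T i, ha T' i]
    have e2 : a T' i = 0 := by linarith [ha T i, ha T' i]
    constructor
    · by_contra hc; simp [a, hc] at e1
    · by_contra hc; simp [a, hc] at e2
  · exact le_inf (parabolic_mono _ Set.inter_subset_left) (parabolic_mono _ Set.inter_subset_right)

theorem parabolic_le_iff {T T' : Set B} :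
    parabolic cs.simple T ≤ parabolic cs.simple T' ↔ T ⊆ T' :=
  ⟨fun h _ hi => (simple_mem_parabolic_iff cs).1 (h (simple_mem_parabolic cs hi)),
    parabolic_mono cs.simple⟩

/-- If `W_T` is finite, its fundamental chamber meets every orbit. -/
theorem exists_dualRep_inv_nonneg {T : Set B} (hT : IsSpherical cs.simple T) (v : B → ℝ) :
    ∃ w ∈ parabolic cs.simple T, ∀ i ∈ T, 0 ≤ dualRep cs w⁻¹ v i := by
  classical
  have hfin : T.Finite := by
    refine Set.Finite.of_finite_image (f := cs.simple) (hT.subset ?_) ?_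
    · rintro _ ⟨i, hi, rfl⟩
      exact simple_mem_parabolic cs hi
    · intro i hi j hj hij
      have : cs.simple i ∈ parabolic cs.simple ({j} : Set B) := by
        rw [hij]; exact simple_mem_parabolic cs (Set.mem_singleton j)
      simpa using (simple_mem_parabolic_iff cs).1 this
  have : Finite (parabolic cs.simple T) := hT
  have := Fintype.ofFinite (parabolic cs.simple T)
  -- A form averaged over the finite group, hence invariant. The vector `1` lies in the open
  -- chamber, and the point of the orbit of `v` that maximizes the product with `1` is the one in
  -- the chamber.
  let Q : (B → ℝ) → (B → ℝ) → ℝ := fun x y =>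
    ∑ g : parabolic cs.simple T, ∑ j ∈ hfin.toFinset, dualRep cs g x j * dualRep cs g y j
  have hQ : ∀ h ∈ parabolic cs.simple T, ∀ x y, Q (dualRep cs h x) (dualRep cs h y) = Q x y := by
    intro h hh x y
    simp only [Q, ← dualRep_mul]
    exact Fintype.sum_equiv (Equiv.mulRight (⟨h, hh⟩ : parabolic cs.simple T)) _ _
      (fun g => by simp)
  have hsub : ∀ x y z, Q (x - y) z = Q x z - Q y z := by
    intro x y z
    simp only [Q, map_sub, Pi.sub_apply, sub_mul, Finset.sum_sub_distrib]
  have hsub' : ∀ x y z, Q z (x - y) = Q z x - Q z y := by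
    intro x y z
    simp only [Q, map_sub, Pi.sub_apply, mul_sub, Finset.sum_sub_distrib]
  have hsmul : ∀ (c : ℝ) x z, Q (c • x) z = c * Q x z := by
    intro c x z
    simp only [Q, map_smul, Pi.smul_apply, smul_eq_mul, mul_assoc, Finset.mul_sum]
  obtain ⟨w, hw⟩ := Finite.exists_max (fun w : parabolic cs.simple T =>
    Q (dualRep cs (w : W)⁻¹ v) 1)
  refine ⟨w, w.2, fun i hi => ?_⟩
  have hmi := simple_mem_parabolic cs hi
  set v' := dualRep cs (w : W)⁻¹ v with hv'
  have h1 : Q (dualRep cs (cs.simple i) v') 1 ≤ Q v' 1 := by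
    have := hw (w * ⟨cs.simple i, hmi⟩)
    rwa [Subgroup.coe_mul, mul_inv_rev, cs.inv_simple, dualRep_mul] at this
  rw [dualRep_simple, hsub, hsmul] at h1
  have hneg : dualRep cs (cs.simple i) (cartanVec M i) = (-1 : ℝ) • cartanVec M i := by
    rw [dualRep_simple, cartanVec_self]
    module
  have hone : dualRep cs (cs.simple i) 1 = 1 - cartanVec M i := by
    rw [dualRep_simple]
    simp
  -- Invariance gives `2 Q(c, 1) = Q(c, c) > 0` for the Cartan vector `c`, so reflecting in a
  -- negative coordinate would increase the product with `1`.
  have h2 := hQ _ hmi (cartanVec M i) 1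
  rw [hneg, hone, hsmul, hsub'] at h2
  have h3 : 0 < Q (cartanVec M i) (cartanVec M i) := by
    refine Finset.sum_pos' (fun g _ => Finset.sum_nonneg fun j _ => mul_self_nonneg _)
      ⟨1, Finset.mem_univ _, ?_⟩
    refine Finset.sum_pos' (fun j _ => mul_self_nonneg _) ⟨i, hfin.mem_toFinset.2 hi, ?_⟩
    simp [cartanVec_self]
  have h4 : 0 < Q (cartanVec M i) 1 := by linarith
  by_contra! hlt
  nlinarith [mul_neg_of_neg_of_pos hlt h4]

end Tits

/-! ### Weighted chains of sets and their layer-cake functions -/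

section Layer

variable {B : Type*}

/-- The measure of the set of levels in `(0, 1]` at which the superlevel set of `f` is `T`. -/
noncomputable def levelWeight (f : B → ℝ) (T : Set B) : ℝ :=
  MeasureTheory.volume.real {c : ℝ | c ∈ Set.Ioc 0 1 ∧ {i | c ≤ f i} = T}

theorem levelWeight_nonneg (f : B → ℝ) (T : Set B) : 0 ≤ levelWeight f T :=
  MeasureTheory.measureReal_nonneg

theorem exists_level_of_levelWeight_ne_zero {f : B → ℝ} {T : Set B} (h : levelWeight f T ≠ 0) :
    ∃ c : ℝ, 0 < c ∧ c ≤ 1 ∧ {i | c ≤ f i} = T := by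
  by_contra! hc
  apply h
  have : {c : ℝ | c ∈ Set.Ioc 0 1 ∧ {i | c ≤ f i} = T} = ∅ := by
    ext c
    simp only [Set.mem_empty_iff_false, iff_false]
    rintro ⟨⟨h1, h2⟩, h3⟩
    exact hc c h1 h2 h3
  rw [levelWeight, this, MeasureTheory.measureReal_empty]

theorem levelWeight_chain {f : B → ℝ} {T T' : Set B} (h : levelWeight f T ≠ 0)
    (h' : levelWeight f T' ≠ 0) : T ⊆ T' ∨ T' ⊆ T := by
  obtain ⟨c, -, -, rfl⟩ := exists_level_of_levelWeight_ne_zero h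
  obtain ⟨d, -, -, rfl⟩ := exists_level_of_levelWeight_ne_zero h'
  rcases le_total c d with hcd | hcd
  · exact Or.inr fun i hi => hcd.trans hi
  · exact Or.inl fun i hi => hcd.trans hi

variable [Finite B]

theorem measurableSet_level (f : B → ℝ) (T : Set B) :
    MeasurableSet {c : ℝ | c ∈ Set.Ioc 0 1 ∧ {i | c ≤ f i} = T} := by
  have : {c : ℝ | c ∈ Set.Ioc 0 1 ∧ {i | c ≤ f i} = T} =
      Set.Ioc 0 1 ∩ ⋂ i, {c : ℝ | c ≤ f i ↔ i ∈ T} := by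
    ext c
    simp [Set.ext_iff]
  rw [this]
  refine measurableSet_Ioc.inter (MeasurableSet.iInter fun i => ?_)
  by_cases hi : i ∈ T
  · have : {c : ℝ | c ≤ f i ↔ i ∈ T} = Set.Iic (f i) := by ext c; simp [hi]
    rw [this]
    exact measurableSet_Iic
  · have : {c : ℝ | c ≤ f i ↔ i ∈ T} = Set.Ioi (f i) := by ext c; simp [hi]
    rw [this]
    exact measurableSet_Ioi

-- Each level has one superlevel set, so the sets of levels for different `T` are disjoint and their
-- measures add.
open Classical in
theorem sum_levelWeight_filter (f : B → ℝ) [Fintype (Set B)] (p : Set B → Prop) :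
    ∑ T with p T, levelWeight f T =
      MeasureTheory.volume.real {c : ℝ | c ∈ Set.Ioc 0 1 ∧ p {i | c ≤ f i}} := by
  unfold levelWeight
  rw [← MeasureTheory.measureReal_biUnion_finset (h := fun T _ =>
    ((MeasureTheory.measure_mono fun c hc => hc.1).trans_lt measure_Ioc_lt_top).ne)]
  · congr 1
    ext c
    simp
  · intro T _ T' _ hne
    refine Set.disjoint_left.2 ?_
    rintro c ⟨-, h⟩ ⟨-, h'⟩
    exact hne (h.symm.trans h')
  · exact fun T _ => measurableSet_level f T

theorem sum_levelWeight (f : B → ℝ) [Fintype (Set B)] : ∑ T, levelWeight f T = 1 := by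
  classical
  have := sum_levelWeight_filter f (fun _ => True)
  simpa [-Set.mem_Ioc] using this

open Classical in
theorem sum_levelWeight_mem (f : B → ℝ) [Fintype (Set B)] (i : B) (h0 : 0 ≤ f i) (h1 : f i ≤ 1) :
    ∑ T with i ∈ T, levelWeight f T = f i := by
  rw [sum_levelWeight_filter f (fun T => i ∈ T)]
  have : {c : ℝ | c ∈ Set.Ioc 0 1 ∧ i ∈ {i | c ≤ f i}} = Set.Ioc 0 (f i) := by
    ext c
    constructor
    · rintro ⟨⟨h2, h3⟩, h4⟩
      exact ⟨h2, h4⟩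
    · rintro ⟨h2, h3⟩
      exact ⟨⟨h2, h3.trans h1⟩, h3⟩
  rw [this]
  simp [h0]

/-- A positive weight on a chain of sets is determined by the function `f` with
`f i = ∑_{T ∋ i} x_T`. -/
theorem weight_eq_levelWeight {P : Type*} (σ : Finset P) (tp : P → Set B) (x : P → ℝ)
    (hx : ∀ C ∈ σ, 0 < x C) (hsum : ∑ C ∈ σ, x C = 1)
    (hchain : ∀ C ∈ σ, ∀ C' ∈ σ, tp C ⊆ tp C' ∨ tp C' ⊆ tp C)
    (hinj : ∀ C ∈ σ, ∀ C' ∈ σ, tp C = tp C' → C = C') (f : B → ℝ)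
    (hf : ∀ i, f i = ∑ C ∈ σ, x C * Set.indicator (tp C) 1 i) :
    (∀ C ∈ σ, x C = levelWeight f (tp C)) ∧
      ∀ T, levelWeight f T ≠ 0 → ∃ C ∈ σ, tp C = T := by
  classical
  have := Fintype.ofFinite (Set B)
  have hle : ∀ C ∈ σ, x C ≤ levelWeight f (tp C) := by
    intro C hC
    -- The sums over supersets are the values of `f` along the chain: the superlevel set is `tp C`
    -- on the interval `(X - x C, X]`, of length `x C`.
    set X := ∑ D ∈ σ with tp C ⊆ tp D, x D with hX
    have hX1 : X ≤ 1 := by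
      rw [← hsum]
      exact Finset.sum_le_sum_of_subset_of_nonneg (Finset.filter_subset _ _)
        fun D hD _ => (hx D hD).le
    have hXC : X - x C = ∑ D ∈ σ with tp C ⊂ tp D, x D := by
      rw [hX, ← Finset.sum_erase_add _ _
        (Finset.mem_filter.2 ⟨hC, subset_rfl⟩ : C ∈ {D ∈ σ | tp C ⊆ tp D}), add_sub_cancel_right]
      apply Finset.sum_congr _ fun _ _ => rfl
      ext D
      simp only [Finset.mem_erase, Finset.mem_filter, ssubset_iff_subset_ne]
      constructor
      · rintro ⟨h1, h2, h3⟩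
        exact ⟨h2, h3, fun e => h1 (hinj C hC D h2 e).symm⟩
      · rintro ⟨h2, h3, h4⟩
        exact ⟨fun e => h4 (by rw [e]), h2, h3⟩
    have hX0 : 0 ≤ X - x C := by
      rw [hXC]
      exact Finset.sum_nonneg fun D hD => (hx D (Finset.mem_filter.1 hD).1).le
    have hsub : Set.Ioc (X - x C) X ⊆ {c : ℝ | c ∈ Set.Ioc 0 1 ∧ {i | c ≤ f i} = tp C} := by
      rintro c ⟨h1, h2⟩
      refine ⟨⟨hX0.trans_lt h1, h2.trans hX1⟩, ?_⟩
      ext i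
      change c ≤ f i ↔ _
      rw [hf]
      constructor
      · intro hci
        by_contra hi
        have : ∑ D ∈ σ, x D * Set.indicator (tp D) 1 i ≤ X - x C := by
          rw [hXC, Finset.sum_filter]
          apply Finset.sum_le_sum
          intro D hD
          by_cases hiD : i ∈ tp D
          · have : tp C ⊂ tp D := by
              refine ⟨(hchain C hC D hD).resolve_right fun h => hi (h hiD), fun h => hi (h hiD)⟩
            simp [hiD, this]
          · simp only [hiD, not_false_eq_true, Set.indicator_of_notMem, mul_zero]
            split_ifs
            · exact (hx D hD).le
            · exact le_rfl
        linarith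
      · intro hi
        refine h2.trans ?_
        rw [hX, Finset.sum_filter]
        apply Finset.sum_le_sum
        intro D hD
        split_ifs with h
        · simp [h hi]
        · exact mul_nonneg (hx D hD).le (Set.indicator_nonneg (by simp) _)
    have := MeasureTheory.measureReal_mono (μ := MeasureTheory.volume) hsub
      ((MeasureTheory.measure_mono fun c hc => hc.1).trans_lt measure_Ioc_lt_top).ne
    rw [Real.volume_real_Ioc_of_le (by linarith [hx C hC])] at this
    rw [levelWeight]
    linarith
  have himg : ∑ T ∈ σ.image tp, levelWeight f T = ∑ C ∈ σ, levelWeight f (tp C) :=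
    Finset.sum_image fun C hC D hD h => hinj C hC D hD h
  have htot : ∑ T ∈ σ.image tp, levelWeight f T ≤ 1 := by
    rw [← sum_levelWeight f]
    exact Finset.sum_le_sum_of_subset_of_nonneg (Finset.subset_univ _)
      fun _ _ _ => levelWeight_nonneg _ _
  -- Both totals are `1`, so the termwise inequalities are equalities and no measure is left for
  -- other sets.
  have heq : ∑ C ∈ σ, x C = ∑ C ∈ σ, levelWeight f (tp C) :=
    le_antisymm (Finset.sum_le_sum hle) (by rw [hsum, ← himg]; exact htot)
  refine ⟨(Finset.sum_eq_sum_iff_of_le hle).1 heq, fun T hT => ?_⟩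
  by_contra! hc
  have hTn : T ∉ σ.image tp := by
    rw [Finset.mem_image]
    rintro ⟨C, hC, h⟩
    exact hc C hC h
  have h1 : ∑ S ∈ insert T (σ.image tp), levelWeight f S ≤ 1 := by
    rw [← sum_levelWeight f]
    exact Finset.sum_le_sum_of_subset_of_nonneg (Finset.subset_univ _)
      fun _ _ _ => levelWeight_nonneg _ _
  rw [Finset.sum_insert hTn, himg, ← heq, hsum] at h1
  have := (levelWeight_nonneg f T).lt_of_ne' hT
  linarith

end Layer

/-! ### Points of realizations of order complexes -/

section Realization

variable {P : Type*} [PartialOrder P]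

/-- Any finite set containing the support suffices, so the exact support need not be named. -/
theorem mem_realization_orderComplex_of {x : P → ℝ} (h0 : ∀ C, 0 ≤ x C) (σ : Finset P)
    (hσ : ∀ C, x C ≠ 0 → C ∈ σ) (hsum : ∑ C ∈ σ, x C = 1)
    (hchain : ∀ C C', x C ≠ 0 → x C' ≠ 0 → C ≤ C' ∨ C' ≤ C) :
    x ∈ realization (orderComplex P) := by
  classical
  have hsum' : ∑ C ∈ σ with x C ≠ 0, x C = 1 := by rw [Finset.sum_filter_ne_zero, hsum]
  refine ⟨h0, {C ∈ σ | x C ≠ 0}, ⟨?_, ?_⟩, ?_, hsum'⟩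
  · rw [Finset.nonempty_iff_ne_empty]
    intro h
    rw [h] at hsum'
    simp at hsum'
  · intro C hC C' hC' _
    simp only [Finset.coe_filter] at hC hC'
    exact hchain C C' hC.2 hC'.2
  · ext C
    simp only [Function.mem_support, Finset.coe_filter]
    exact ⟨fun h => ⟨hσ C h, h⟩, fun h => h.2⟩

theorem realization_chain {x : P → ℝ} (hx : x ∈ realization (orderComplex P))
    {C C' : P} (h : x C ≠ 0) (h' : x C' ≠ 0) : C ≤ C' ∨ C' ≤ C := by
  obtain ⟨-, σ, ⟨-, hσ⟩, hs, -⟩ := hx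
  exact hσ.total (by rw [← hs]; exact h) (by rw [← hs]; exact h')

theorem realization_sum {x : P → ℝ} (hx : x ∈ realization (orderComplex P))
    {τ : Finset P} (hτ : ∀ C, x C ≠ 0 → C ∈ τ) : ∑ C ∈ τ, x C = 1 := by
  obtain ⟨-, σ, -, hs, h1⟩ := hx
  rw [← h1]
  symm
  apply Finset.sum_subset
  · intro C hC
    apply hτ
    rw [← Function.mem_support, hs]
    exact hC
  · intro C _ hC
    by_contra h
    have : C ∈ Function.support x := h
    rw [hs] at this
    exact hC this

theorem exists_minimal_coset {x : P → ℝ} (hx : x ∈ realization (orderComplex P))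
    : ∃ C, x C ≠ 0 ∧ ∀ C', x C' ≠ 0 → C ≤ C' := by
  obtain ⟨-, σ, ⟨hne, hσ⟩, hs, -⟩ := hx
  have hm : ∀ C, x C ≠ 0 ↔ C ∈ σ := fun C => by
    rw [← Function.mem_support, hs, Finset.mem_coe]
  obtain ⟨C, hC⟩ := σ.exists_minimal hne
  refine ⟨C, (hm C).2 hC.1, fun C' h => ?_⟩
  rcases hσ.total hC.1 ((hm C').1 h) with h1 | h1
  · exact h1
  · exact hC.2 ((hm C').1 h) h1

theorem exists_maximal_coset {x : P → ℝ} (hx : x ∈ realization (orderComplex P))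
    : ∃ C, x C ≠ 0 ∧ ∀ C', x C' ≠ 0 → C' ≤ C := by
  obtain ⟨-, σ, ⟨hne, hσ⟩, hs, -⟩ := hx
  have hm : ∀ C, x C ≠ 0 ↔ C ∈ σ := fun C => by
    rw [← Function.mem_support, hs, Finset.mem_coe]
  obtain ⟨C, hC⟩ := σ.exists_maximal hne
  refine ⟨C, (hm C).2 hC.1, fun C' h => ?_⟩
  rcases hσ.total hC.1 ((hm C').1 h) with h1 | h1
  · exact hC.2 ((hm C').1 h) h1
  · exact h1

end Realization

/-! ### Spherical cosets -/

section Cosets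

variable {B G : Type*} [Group G] (s : B → G)

theorem mem_smul_parabolic {g h : G} {T : Set B} :
    h ∈ g • (parabolic s T : Set G) ↔ g⁻¹ * h ∈ parabolic s T := by
  rw [Set.mem_smul_set_iff_inv_smul_mem]
  rfl

theorem self_mem_smul_parabolic (g : G) (T : Set B) : g ∈ g • (parabolic s T : Set G) := by
  simp [mem_smul_parabolic, one_mem]

theorem smul_parabolic_eq {g h : G} {T : Set B} (hh : h ∈ g • (parabolic s T : Set G)) :
    g • (parabolic s T : Set G) = h • (parabolic s T : Set G) := by
  rw [mem_smul_parabolic] at hh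
  ext k
  rw [mem_smul_parabolic, mem_smul_parabolic]
  constructor
  · intro hk
    have := mul_mem (inv_mem hh) hk
    simpa [mul_assoc] using this
  · intro hk
    have := mul_mem hh hk
    simpa [mul_assoc] using this

theorem smul_parabolic_subset {g h : G} {T T' : Set B} (hh : h ∈ g • (parabolic s T' : Set G))
    (hT : T ⊆ T') : h • (parabolic s T : Set G) ⊆ g • (parabolic s T' : Set G) := by
  rw [smul_parabolic_eq s hh]
  exact Set.smul_set_mono (parabolic_mono s hT)

theorem SphericalCoset.exists_eq {s : B → G} (C : SphericalCoset s) :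
    ∃ (g : G) (T : Set B), IsSpherical s T ∧ (C : Set G) = g • (parabolic s T : Set G) := C.2

/-- A coset is a coset of every representative. -/
theorem SphericalCoset.exists_eq_of_mem {s : B → G} (C : SphericalCoset s) {g : G}
    (hg : g ∈ (C : Set G)) :
    ∃ T : Set B, IsSpherical s T ∧ (C : Set G) = g • (parabolic s T : Set G) := by
  obtain ⟨h, T, hT, hC⟩ := C.2
  exact ⟨T, hT, by rw [hC] at hg ⊢; exact smul_parabolic_eq s hg⟩

theorem SphericalCoset.nonempty {s : B → G} (C : SphericalCoset s) : (C : Set G).Nonempty := by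
  obtain ⟨h, T, -, hC⟩ := C.2
  exact ⟨h, by rw [hC]; exact self_mem_smul_parabolic s h T⟩

theorem IsSpherical.mono {s : B → G} {T T' : Set B} (hT : IsSpherical s T') (h : T ⊆ T') :
    IsSpherical s T :=
  Set.Finite.subset hT (parabolic_mono s h)

/-- The spherical coset `g W_T`. -/
def cosetOf {T : Set B} (hT : IsSpherical s T) (g : G) : SphericalCoset s :=
  ⟨g • (parabolic s T : Set G), g, T, hT, rfl⟩

/-- The type of a coset: `T` for the coset `g W_T` in a Coxeter group. -/
def cosetType (C : Set G) : Set B := {i | ∀ g ∈ C, g * s i ∈ C}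

end Cosets

/-! ### In a Coxeter group a coset is determined by one element and its type. -/

section CoxeterCosets

variable {B W : Type*} [Group W] {M : CoxeterMatrix B} (cs : CoxeterSystem M W)

theorem smul_parabolic_subset_iff {g h : W} {T T' : Set B} :
    h • (parabolic cs.simple T : Set W) ⊆ g • (parabolic cs.simple T' : Set W) ↔
      h ∈ g • (parabolic cs.simple T' : Set W) ∧ T ⊆ T' := by
  refine ⟨fun hs => ?_, fun hs => smul_parabolic_subset _ hs.1 hs.2⟩
  have h1 := hs (self_mem_smul_parabolic cs.simple h T)
  refine ⟨h1, ?_⟩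
  rw [smul_parabolic_eq cs.simple h1, Set.smul_set_subset_smul_set_iff] at hs
  exact (parabolic_le_iff cs).1 hs

theorem cosetType_smul (g : W) (T : Set B) :
    cosetType cs.simple (g • (parabolic cs.simple T : Set W)) = T := by
  ext i
  constructor
  · intro h
    have := h g (self_mem_smul_parabolic _ _ _)
    rw [mem_smul_parabolic, inv_mul_cancel_left] at this
    exact (simple_mem_parabolic_iff cs).1 this
  · intro hi h hh
    rw [mem_smul_parabolic] at hh ⊢
    rw [← mul_assoc]
    exact mul_mem hh (simple_mem_parabolic cs hi)

theorem SphericalCoset.eq_smul_cosetType (C : SphericalCoset cs.simple) {g : W}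
    (hg : g ∈ (C : Set W)) :
    (C : Set W) = g • (parabolic cs.simple (cosetType cs.simple (C : Set W)) : Set W) := by
  obtain ⟨T, hT, hC⟩ := C.exists_eq_of_mem hg
  rw [hC, cosetType_smul]

theorem isSpherical_cosetType (C : SphericalCoset cs.simple) :
    IsSpherical cs.simple (cosetType cs.simple (C : Set W)) := by
  obtain ⟨g, T, hT, hC⟩ := C.exists_eq
  rwa [hC, cosetType_smul]

theorem cosetType_mono {C C' : SphericalCoset cs.simple} (h : C ≤ C') :
    cosetType cs.simple (C : Set W) ⊆ cosetType cs.simple (C' : Set W) := by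
  obtain ⟨g, T, hT, hC⟩ := C.exists_eq
  obtain ⟨g', T', hT', hC'⟩ := C'.exists_eq
  have h : (C : Set W) ⊆ C' := h
  rw [hC, hC'] at h ⊢
  rw [cosetType_smul, cosetType_smul]
  exact ((smul_parabolic_subset_iff cs).1 h).2

theorem le_of_cosetType_subset {C C' : SphericalCoset cs.simple} {g : W} (hg : g ∈ (C : Set W))
    (hg' : g ∈ (C' : Set W)) (h : cosetType cs.simple (C : Set W) ⊆ cosetType cs.simple (C' : Set W)) :
    C ≤ C' := by
  change (C : Set W) ⊆ C'
  rw [C.eq_smul_cosetType cs hg, C'.eq_smul_cosetType cs hg']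
  exact Set.smul_set_mono (parabolic_mono _ h)

end CoxeterCosets

/-! ### Local charts of the Davis complex -/

section Chart

/-- The local model of the Davis complex around the cells of type `T₀`. -/
def modelSpace {B G : Type*} [Group G] (s : B → G) (T₀ : Set B) : Set (B → ℝ) :=
  {v | (∀ i ∉ T₀, 0 ≤ v i) ∧ IsSpherical s (T₀ ∪ Function.support v)}

variable {B W : Type*} [Group W] {M : CoxeterMatrix B} (cs : CoxeterSystem M W)

/-- The cosets that meet the coset `g₀ W_{T₀}`. -/
def nearCosets (g₀ : W) (T₀ : Set B) : Set (SphericalCoset cs.simple) :=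
  {C | ((C : Set W) ∩ g₀ • (parabolic cs.simple T₀ : Set W)).Nonempty}

theorem mem_nearCosets {g₀ : W} {T₀ : Set B} {C : SphericalCoset cs.simple} :
    C ∈ nearCosets cs g₀ T₀ ↔ ∃ u ∈ parabolic cs.simple T₀, g₀ * u ∈ (C : Set W) := by
  constructor
  · rintro ⟨h, h1, h2⟩
    rw [mem_smul_parabolic] at h2
    exact ⟨_, h2, by simpa using h1⟩
  · rintro ⟨u, hu, h⟩
    exact ⟨_, h, by rw [mem_smul_parabolic]; simpa using hu⟩

variable [Finite B]

theorem finite_nearCosets (g₀ : W) {T₀ : Set B} (hT₀ : IsSpherical cs.simple T₀) :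
    (nearCosets cs g₀ T₀).Finite := by
  have : Finite (parabolic cs.simple T₀) := hT₀
  refine Set.Finite.of_finite_image (f := Subtype.val) ?_ Subtype.val_injective.injOn
  refine (Set.finite_range (fun p : parabolic cs.simple T₀ × Set B =>
    (g₀ * (p.1 : W)) • (parabolic cs.simple p.2 : Set W))).subset ?_
  rintro _ ⟨C, hC, rfl⟩
  obtain ⟨u, hu, h⟩ := (mem_nearCosets cs).1 hC
  exact ⟨(⟨u, hu⟩, _), (C.eq_smul_cosetType cs h).symm⟩

open Classical in
/-- An element `u` of `W_{T₀}` such that `g₀ u` lies in the given coset. -/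
noncomputable def nearRep (g₀ : W) (T₀ : Set B) (C : SphericalCoset cs.simple) : W :=
  if h : ∃ u ∈ parabolic cs.simple T₀, g₀ * u ∈ (C : Set W) then h.choose else 1

open Classical in
/-- The image of a `0`-simplex under the chart around the cell `g₀ W_{T₀}`. -/
noncomputable def chartVec (g₀ : W) (T₀ : Set B) (C : SphericalCoset cs.simple) : B → ℝ :=
  -- A coset `g₀ u W_T` with `u` in `W_{T₀}` goes to `u` applied to the indicator of the complement
  -- of `T` on the coordinates in `T₀`, and to the indicator of `T` elsewhere. The cell `g₀ W_{T₀}`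
  -- itself goes to the origin.
  fun i => if i ∈ T₀ then
    dualRep cs (nearRep cs g₀ T₀ C) (Set.indicator (cosetType cs.simple (C : Set W))ᶜ 1) i
  else Set.indicator (cosetType cs.simple (C : Set W)) 1 i

variable (g₀ : W) {T₀ : Set B} (hT₀ : IsSpherical cs.simple T₀)

/-- The chart around the cell `g₀ W_{T₀}`, affine on simplices. -/
noncomputable def chartMap (x : SphericalCoset cs.simple → ℝ) : B → ℝ :=
  fun i => ∑ C ∈ (finite_nearCosets cs g₀ hT₀).toFinset, x C * chartVec cs g₀ T₀ C i

/-- The sum of the weights of the cosets whose type contains a given generator. -/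
noncomputable def typeWeight (x : SphericalCoset cs.simple → ℝ) : B → ℝ :=
  fun i => ∑ C ∈ (finite_nearCosets cs g₀ hT₀).toFinset,
    x C * Set.indicator (cosetType cs.simple (C : Set W)) 1 i

theorem continuous_chartMap : Continuous (chartMap cs g₀ hT₀) := by
  unfold chartMap
  fun_prop

/-- The union of the closed simplices whose vertices are cosets meeting `g₀ W_{T₀}`. -/
def nearStar (T₀ : Set B) : Set (SphericalCoset cs.simple → ℝ) :=
  {x ∈ davisComplex cs.simple | ∀ C, x C ≠ 0 → C ∈ nearCosets cs g₀ T₀}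

/-- Only finitely many cosets occur, and being supported on a chain is closed: products of
incomparable coordinates vanish. Compactness later turns the injective chart into an embedding. -/
theorem isCompact_nearStar (hT₀ : IsSpherical cs.simple T₀) : IsCompact (nearStar cs g₀ T₀) := by
  classical
  set F := (finite_nearCosets cs g₀ hT₀).toFinset with hF
  have hmF : ∀ C, C ∈ F ↔ C ∈ nearCosets cs g₀ T₀ := fun C => Set.Finite.mem_toFinset _
  have hK : IsCompact (Set.pi Set.univ (fun C : SphericalCoset cs.simple =>
      if C ∈ F then Set.Icc (0 : ℝ) 1 else {0})) := by
    apply isCompact_univ_pi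
    intro C
    split_ifs
    · exact isCompact_Icc
    · exact isCompact_singleton
  have hcl : IsClosed ({x : SphericalCoset cs.simple → ℝ | ∑ C ∈ F, x C = 1} ∩
      ⋂ (C) (C') (_ : ¬ (C ≤ C' ∨ C' ≤ C)), {x | x C * x C' = 0}) := by
    refine IsClosed.inter (isClosed_eq (by fun_prop) (by fun_prop)) ?_
    refine isClosed_iInter fun C => isClosed_iInter fun C' => isClosed_iInter fun _ => ?_
    exact isClosed_eq (by fun_prop) (by fun_prop)
  convert hK.inter_right hcl using 1
  ext x
  constructor
  · rintro ⟨hx, hn⟩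
    have hsum : ∑ C ∈ F, x C = 1 := realization_sum hx fun C hC => (hmF C).2 (hn C hC)
    refine ⟨?_, hsum, ?_⟩
    · intro C _
      dsimp only
      split_ifs with h
      · refine ⟨hx.1 C, ?_⟩
        rw [← hsum]
        exact Finset.single_le_sum (fun C _ => hx.1 C) h
      · by_contra h'
        exact h ((hmF C).2 (hn C h'))
    · simp only [Set.mem_iInter]
      intro C C' hCC'
      by_contra h
      exact hCC' (realization_chain hx (left_ne_zero_of_mul h) (right_ne_zero_of_mul h))
  · rintro ⟨h1, h2, h3⟩
    have h4 : ∀ C, x C ≠ 0 → C ∈ F := by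
      intro C hC
      by_contra h
      have := h1 C (Set.mem_univ C)
      simp only [h, if_false] at this
      exact hC this
    refine ⟨mem_realization_orderComplex_of ?_ F h4 h2 ?_, fun C hC => (hmF C).1 (h4 C hC)⟩
    · intro C
      have := h1 C (Set.mem_univ C)
      dsimp only at this
      split_ifs at this with h
      · exact this.1
      · exact (show x C = 0 from this).ge
    · intro C C' hC hC'
      by_contra h
      simp only [Set.mem_iInter] at h3
      exact mul_ne_zero hC hC' (h3 C C' h)

-- The smallest coset of the carrier meets `g₀ W_{T₀}`, and any element of it lies in all the
-- others.
omit [Finite B] in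
theorem exists_nearRep {x : SphericalCoset cs.simple → ℝ} (hx : x ∈ nearStar cs g₀ T₀) :
    ∃ u ∈ parabolic cs.simple T₀, ∀ C, x C ≠ 0 → g₀ * u ∈ (C : Set W) := by
  obtain ⟨C, hC, hmin⟩ := exists_minimal_coset hx.1
  obtain ⟨u, hu, h⟩ := (mem_nearCosets cs).1 (hx.2 C hC)
  exact ⟨u, hu, fun C' hC' => hmin C' hC' h⟩

-- Two representatives differ by an element of the special subgroup of the type, which fixes the
-- indicator of the complement of the type; so the choice does not matter.
omit [Finite B] in
theorem dualRep_nearRep {C : SphericalCoset cs.simple} {u : W} (hu : u ∈ parabolic cs.simple T₀)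
    (h : g₀ * u ∈ (C : Set W)) :
    dualRep cs (nearRep cs g₀ T₀ C) (Set.indicator (cosetType cs.simple (C : Set W))ᶜ 1) =
      dualRep cs u (Set.indicator (cosetType cs.simple (C : Set W))ᶜ 1) := by
  have hex : ∃ u ∈ parabolic cs.simple T₀, g₀ * u ∈ (C : Set W) := ⟨u, hu, h⟩
  rw [nearRep, dif_pos hex]
  set u' := hex.choose
  have h2 : g₀ * u' ∈ (C : Set W) := hex.choose_spec.2
  rw [C.eq_smul_cosetType cs h, mem_smul_parabolic] at h2
  have h3 : u⁻¹ * u' ∈ parabolic cs.simple (cosetType cs.simple (C : Set W)) := by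
    simpa [mul_assoc] using h2
  conv_lhs => rw [show u' = u * (u⁻¹ * u') by group]
  rw [dualRep_mul, dualRep_eq_self cs h3]
  intro i hi
  simp [hi]

/-- On one chamber a single `u` represents all cosets of the carrier, so the chart depends on `x`
through the type weights alone. -/
theorem chartMap_eq {x : SphericalCoset cs.simple → ℝ} (hx : x ∈ nearStar cs g₀ T₀) {u : W}
    (hu : u ∈ parabolic cs.simple T₀) (h : ∀ C, x C ≠ 0 → g₀ * u ∈ (C : Set W)) (i : B) :
    (i ∈ T₀ → chartMap cs g₀ hT₀ x i = dualRep cs u (1 - typeWeight cs g₀ hT₀ x) i) ∧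
    (i ∉ T₀ → chartMap cs g₀ hT₀ x i = typeWeight cs g₀ hT₀ x i) := by
  constructor
  · intro hi
    have hsum : ∑ C ∈ (finite_nearCosets cs g₀ hT₀).toFinset, x C = 1 :=
      realization_sum hx.1 fun C hC => (Set.Finite.mem_toFinset _).2 (hx.2 C hC)
    have e : (1 - typeWeight cs g₀ hT₀ x) = ∑ C ∈ (finite_nearCosets cs g₀ hT₀).toFinset,
        x C • Set.indicator (cosetType cs.simple (C : Set W))ᶜ (1 : B → ℝ) := by
      funext j
      rw [Pi.sub_apply, Pi.one_apply, ← hsum, typeWeight, ← Finset.sum_sub_distrib,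
        Finset.sum_apply]
      apply Finset.sum_congr rfl
      intro C _
      by_cases hj : j ∈ cosetType cs.simple (C : Set W) <;> simp [hj]
    rw [e, map_sum, Finset.sum_apply, chartMap]
    apply Finset.sum_congr rfl
    intro C _
    rw [map_smul, Pi.smul_apply, smul_eq_mul]
    by_cases hC : x C = 0
    · simp [hC]
    · rw [chartVec, if_pos hi, dualRep_nearRep cs g₀ hu (h C hC)]
  · intro hi
    simp only [chartMap, chartVec, if_neg hi, typeWeight]

theorem typeWeight_nonneg {x : SphericalCoset cs.simple → ℝ} (hx : x ∈ nearStar cs g₀ T₀) (i : B) :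
    0 ≤ typeWeight cs g₀ hT₀ x i :=
  Finset.sum_nonneg fun C _ => mul_nonneg (hx.1.1 C) (Set.indicator_nonneg (by simp) _)

theorem typeWeight_pos {x : SphericalCoset cs.simple → ℝ} (hx : x ∈ nearStar cs g₀ T₀) {i : B}
    {C : SphericalCoset cs.simple} (hC : x C ≠ 0) (hi : i ∈ cosetType cs.simple (C : Set W)) :
    0 < typeWeight cs g₀ hT₀ x i := by
  refine Finset.sum_pos' (fun C _ => mul_nonneg (hx.1.1 C) (Set.indicator_nonneg (by simp) _))
    ⟨C, (Set.Finite.mem_toFinset _).2 (hx.2 C hC), ?_⟩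
  simpa [hi] using (hx.1.1 C).lt_of_ne' hC

theorem exists_of_typeWeight_ne_zero {x : SphericalCoset cs.simple → ℝ} {i : B}
    (h : typeWeight cs g₀ hT₀ x i ≠ 0) :
    ∃ C, x C ≠ 0 ∧ i ∈ cosetType cs.simple (C : Set W) := by
  obtain ⟨C, -, hC⟩ := Finset.exists_ne_zero_of_sum_ne_zero h
  refine ⟨C, left_ne_zero_of_mul hC, ?_⟩
  by_contra hi
  simp [hi] at hC

theorem one_sub_typeWeight {x : SphericalCoset cs.simple → ℝ} (hx : x ∈ nearStar cs g₀ T₀)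
    (i : B) : 1 - typeWeight cs g₀ hT₀ x i = ∑ C ∈ (finite_nearCosets cs g₀ hT₀).toFinset,
      x C * Set.indicator (cosetType cs.simple (C : Set W))ᶜ (1 : B → ℝ) i := by
  have hsum : ∑ C ∈ (finite_nearCosets cs g₀ hT₀).toFinset, x C = 1 :=
    realization_sum hx.1 fun C hC => (Set.Finite.mem_toFinset _).2 (hx.2 C hC)
  rw [← hsum, typeWeight, ← Finset.sum_sub_distrib]
  apply Finset.sum_congr rfl
  intro C _
  by_cases hj : i ∈ cosetType cs.simple (C : Set W) <;> simp [hj]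

theorem typeWeight_le_one {x : SphericalCoset cs.simple → ℝ} (hx : x ∈ nearStar cs g₀ T₀)
    (i : B) : typeWeight cs g₀ hT₀ x i ≤ 1 := by
  rw [← sub_nonneg, one_sub_typeWeight cs g₀ hT₀ hx]
  exact Finset.sum_nonneg fun C _ => mul_nonneg (hx.1.1 C) (Set.indicator_nonneg (by simp) _)

theorem typeWeight_lt_one {x : SphericalCoset cs.simple → ℝ} (hx : x ∈ nearStar cs g₀ T₀) {i : B}
    {C : SphericalCoset cs.simple} (hC : x C ≠ 0) (hi : i ∉ cosetType cs.simple (C : Set W)) :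
    typeWeight cs g₀ hT₀ x i < 1 := by
  rw [← sub_pos, one_sub_typeWeight cs g₀ hT₀ hx]
  refine Finset.sum_pos' (fun C _ => mul_nonneg (hx.1.1 C) (Set.indicator_nonneg (by simp) _))
    ⟨C, (Set.Finite.mem_toFinset _).2 (hx.2 C hC), ?_⟩
  simpa [hi] using (hx.1.1 C).lt_of_ne' hC

theorem exists_of_typeWeight_ne_one {x : SphericalCoset cs.simple → ℝ}
    (hx : x ∈ nearStar cs g₀ T₀) {i : B} (h : typeWeight cs g₀ hT₀ x i ≠ 1) :
    ∃ C, x C ≠ 0 ∧ i ∉ cosetType cs.simple (C : Set W) := by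
  have h' := (sub_ne_zero.2 h.symm)
  rw [one_sub_typeWeight cs g₀ hT₀ hx] at h'
  obtain ⟨C, -, hC⟩ := Finset.exists_ne_zero_of_sum_ne_zero h'
  refine ⟨C, left_ne_zero_of_mul hC, ?_⟩
  intro hi
  simp [hi] at hC

/-- Cosets through a common element are distinguished by their types, so `weight_eq_levelWeight`
recovers `x` from its type weights and the chamber. -/
theorem nearStar_weight_eq {x : SphericalCoset cs.simple → ℝ} (hx : x ∈ nearStar cs g₀ T₀)
    {u : W} (h : ∀ C, x C ≠ 0 → g₀ * u ∈ (C : Set W)) :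
    (∀ C, x C ≠ 0 →
      x C = levelWeight (typeWeight cs g₀ hT₀ x) (cosetType cs.simple (C : Set W))) ∧
    ∀ T, levelWeight (typeWeight cs g₀ hT₀ x) T ≠ 0 →
      ∃ C, x C ≠ 0 ∧ cosetType cs.simple (C : Set W) = T := by
  classical
  set F := (finite_nearCosets cs g₀ hT₀).toFinset with hF
  have hσ : ∀ C, C ∈ ({C ∈ F | x C ≠ 0} : Finset _) ↔ x C ≠ 0 := by
    intro C
    rw [Finset.mem_filter, and_iff_right_iff_imp]
    exact fun hC => (Set.Finite.mem_toFinset _).2 (hx.2 C hC)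
  have key := weight_eq_levelWeight {C ∈ F | x C ≠ 0}
    (fun C => cosetType cs.simple (C : Set W)) x
    (fun C hC => (hx.1.1 C).lt_of_ne' ((hσ C).1 hC))
    (realization_sum hx.1 fun C hC => (hσ C).2 hC)
    (fun C hC C' hC' => (realization_chain hx.1 ((hσ C).1 hC) ((hσ C').1 hC')).imp
      (cosetType_mono cs) (cosetType_mono cs))
    (fun C hC C' hC' he => le_antisymm
      (le_of_cosetType_subset cs (h C ((hσ C).1 hC)) (h C' ((hσ C').1 hC')) he.subset)
      (le_of_cosetType_subset cs (h C' ((hσ C').1 hC')) (h C ((hσ C).1 hC)) he.superset))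
    (typeWeight cs g₀ hT₀ x) (fun i => by
      rw [typeWeight, Finset.sum_filter]
      apply Finset.sum_congr rfl
      intro C _
      split_ifs with hC
      · rfl
      · rw [not_not.1 hC, zero_mul])
  refine ⟨fun C hC => key.1 C ((hσ C).2 hC), fun T hT => ?_⟩
  obtain ⟨C, hC, h⟩ := key.2 T hT
  exact ⟨C, (hσ C).1 hC, h⟩

/-- Strictness of the fundamental domain gives equal type weights; the stabilizer statement then
gives a common chamber, where the type weights determine the point. -/
theorem injOn_chartMap : Set.InjOn (chartMap cs g₀ hT₀) (nearStar cs g₀ T₀) := by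
  intro x hx y hy hxy
  obtain ⟨u, hu, hux⟩ := exists_nearRep cs g₀ hx
  obtain ⟨u', hu', huy⟩ := exists_nearRep cs g₀ hy
  set f := typeWeight cs g₀ hT₀ x with hf
  set f' := typeWeight cs g₀ hT₀ y with hf'
  have h1 : ∀ i ∈ T₀, dualRep cs u (1 - f) i = dualRep cs u' (1 - f') i := by
    intro i hi
    rw [← (chartMap_eq cs g₀ hT₀ hx hu hux i).1 hi, hxy,
      (chartMap_eq cs g₀ hT₀ hy hu' huy i).1 hi]
  have h2 : ∀ i ∈ T₀, dualRep cs (u'⁻¹ * u) (1 - f) i = (1 - f') i := by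
    intro i hi
    rw [dualRep_mul, dualRep_congr cs (inv_mem hu') h1 i hi, dualRep_inv_apply_eq cs rfl]
  obtain ⟨h3, h4⟩ := eq_and_mem_of_dualRep_eq cs (mul_mem (inv_mem hu') hu)
    (fun i _ => sub_nonneg.2 (typeWeight_le_one cs g₀ hT₀ hx i))
    (fun i _ => sub_nonneg.2 (typeWeight_le_one cs g₀ hT₀ hy i)) h2
  have hff : f = f' := by
    funext i
    by_cases hi : i ∈ T₀
    · have : 1 - f i = 1 - f' i := h3 i hi
      linarith
    · rw [hf, hf', ← (chartMap_eq cs g₀ hT₀ hx hu hux i).2 hi, hxy,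
        (chartMap_eq cs g₀ hT₀ hy hu' huy i).2 hi]
  -- `u'⁻¹ u` is a product of generators of type weight `1`, and these belong to the type of every
  -- coset in the carrier of `y`.
  have huy' : ∀ C, y C ≠ 0 → g₀ * u ∈ (C : Set W) := by
    intro C hC
    rw [C.eq_smul_cosetType cs (huy C hC), mem_smul_parabolic]
    have : (g₀ * u')⁻¹ * (g₀ * u) = u'⁻¹ * u := by group
    rw [this]
    refine parabolic_mono _ ?_ h4
    rintro i ⟨-, hi⟩
    by_contra hiC
    have h5 := typeWeight_lt_one cs g₀ hT₀ hy hC hiC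
    have hi : 1 - f i = 0 := hi
    rw [← hf', ← hff] at h5
    linarith
  have aux : ∀ x ∈ nearStar cs g₀ T₀, ∀ y ∈ nearStar cs g₀ T₀,
      (∀ C, x C ≠ 0 → g₀ * u ∈ (C : Set W)) → (∀ C, y C ≠ 0 → g₀ * u ∈ (C : Set W)) →
      typeWeight cs g₀ hT₀ x = typeWeight cs g₀ hT₀ y → ∀ C, x C ≠ 0 → x C = y C := by
    intro x hx y hy hux huy hf C hC
    obtain ⟨hx1, -⟩ := nearStar_weight_eq cs g₀ hT₀ hx hux
    obtain ⟨hy1, hy2⟩ := nearStar_weight_eq cs g₀ hT₀ hy huy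
    have h1 := hx1 C hC
    rw [hf] at h1
    obtain ⟨C', hC', he⟩ := hy2 (cosetType cs.simple (C : Set W)) (by rwa [← h1])
    have hCC' : C' = C := le_antisymm
      (le_of_cosetType_subset cs (huy C' hC') (hux C hC) he.subset)
      (le_of_cosetType_subset cs (hux C hC) (huy C' hC') he.superset)
    rw [hCC'] at hC'
    rw [h1, ← hy1 C hC']
  funext C
  by_cases hC : x C = 0
  · by_contra h
    have hyC : y C ≠ 0 := fun h' => h (by rw [hC, h'])
    exact h (aux y hy x hx huy' hux hff.symm C hyC).symm
  · exact aux x hx y hy hux huy' hff C hC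

open Classical in
/-- The point of the Davis complex with prescribed chamber `w K` and type weights. -/
noncomputable def pointOfWeight (w : W) (f : B → ℝ) : SphericalCoset cs.simple → ℝ :=
  fun C => if w ∈ (C : Set W) then levelWeight f (cosetType cs.simple (C : Set W)) else 0

/-- Cosets through `g₀ u` correspond to spherical types, and superlevel sets at positive levels lie
in `{f > 0}`, hence are spherical; no weight is lost. -/
theorem sum_pointOfWeight {f : B → ℝ} (hf : IsSpherical cs.simple {i | 0 < f i}) {u : W}
    (hu : u ∈ parabolic cs.simple T₀) [Fintype (Set B)] (p : Set B → ℝ) :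
    ∑ C ∈ (finite_nearCosets cs g₀ hT₀).toFinset,
      pointOfWeight cs (g₀ * u) f C * p (cosetType cs.simple (C : Set W)) =
      ∑ T, levelWeight f T * p T := by
  refine Finset.sum_bij_ne_zero (fun C _ _ => cosetType cs.simple (C : Set W)) ?_ ?_ ?_ ?_
  · exact fun _ _ _ => Finset.mem_univ _
  · intro C _ hC C' _ hC' he
    have h1 : g₀ * u ∈ (C : Set W) := by
      by_contra h; simp [pointOfWeight, h] at hC
    have h2 : g₀ * u ∈ (C' : Set W) := by
      by_contra h; simp [pointOfWeight, h] at hC'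
    exact le_antisymm (le_of_cosetType_subset cs h1 h2 he.subset)
      (le_of_cosetType_subset cs h2 h1 he.superset)
  · intro T _ hT
    have hT' : IsSpherical cs.simple T := by
      obtain ⟨c, hc, -, rfl⟩ := exists_level_of_levelWeight_ne_zero (left_ne_zero_of_mul hT)
      exact hf.mono fun i hi => hc.trans_le hi
    have hmem : g₀ * u ∈ ((cosetOf cs.simple hT' (g₀ * u) : SphericalCoset cs.simple) : Set W) :=
      self_mem_smul_parabolic _ _ _
    have htp : cosetType cs.simple
        ((cosetOf cs.simple hT' (g₀ * u) : SphericalCoset cs.simple) : Set W) = T :=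
      cosetType_smul cs _ _
    refine ⟨cosetOf cs.simple hT' (g₀ * u), ?_, ?_, htp⟩
    · rw [Set.Finite.mem_toFinset, mem_nearCosets]
      exact ⟨u, hu, hmem⟩
    · rwa [pointOfWeight, if_pos hmem, htp]
  · intro C _ hC
    have h1 : g₀ * u ∈ (C : Set W) := by
      by_contra h; simp [pointOfWeight, h] at hC
    rw [pointOfWeight, if_pos h1]

theorem pointOfWeight_mem (hT₀ : IsSpherical cs.simple T₀) {f : B → ℝ} (hf : IsSpherical cs.simple {i | 0 < f i}) {u : W}
    (hu : u ∈ parabolic cs.simple T₀) :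
    pointOfWeight cs (g₀ * u) f ∈ nearStar cs g₀ T₀ := by
  have := Fintype.ofFinite (Set B)
  have h1 : ∀ C, pointOfWeight cs (g₀ * u) f C ≠ 0 → g₀ * u ∈ (C : Set W) ∧
      levelWeight f (cosetType cs.simple (C : Set W)) ≠ 0 := by
    intro C hC
    unfold pointOfWeight at hC
    split_ifs at hC with h
    · exact ⟨h, hC⟩
    · exact absurd rfl hC
  have h2 : ∀ C, pointOfWeight cs (g₀ * u) f C ≠ 0 → C ∈ nearCosets cs g₀ T₀ := fun C hC =>
    (mem_nearCosets cs).2 ⟨u, hu, (h1 C hC).1⟩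
  refine ⟨mem_realization_orderComplex_of ?_ (finite_nearCosets cs g₀ hT₀).toFinset
    (fun C hC => (Set.Finite.mem_toFinset _).2 (h2 C hC)) ?_ ?_, h2⟩
  · intro C
    unfold pointOfWeight
    split_ifs
    · exact levelWeight_nonneg _ _
    · exact le_rfl
  · have := sum_pointOfWeight cs g₀ hT₀ hf hu (fun _ => 1)
    simpa [sum_levelWeight] using this
  · intro C C' hC hC'
    obtain ⟨hC1, hC2⟩ := h1 C hC
    obtain ⟨hC1', hC2'⟩ := h1 C' hC'
    exact (levelWeight_chain hC2 hC2').imp (le_of_cosetType_subset cs hC1 hC1')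
      (le_of_cosetType_subset cs hC1' hC1)

theorem typeWeight_pointOfWeight {f : B → ℝ} (hf : IsSpherical cs.simple {i | 0 < f i}) {u : W}
    (hu : u ∈ parabolic cs.simple T₀) (h0 : ∀ i, 0 ≤ f i) (h1 : ∀ i, f i ≤ 1) :
    typeWeight cs g₀ hT₀ (pointOfWeight cs (g₀ * u) f) = f := by
  classical
  have := Fintype.ofFinite (Set B)
  funext i
  have := sum_pointOfWeight cs g₀ hT₀ hf hu (fun T => Set.indicator T 1 i)
  rw [typeWeight, this, ← sum_levelWeight_mem f i (h0 i) (h1 i), Finset.sum_filter]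
  apply Finset.sum_congr rfl
  intro T _
  by_cases hi : i ∈ T <;> simp [hi]

/-- The open neighbourhood of the relative interior of a cell, as a subset of the Davis complex. -/
def openStar (T₀ : Set B) : Set (davisComplex cs.simple) :=
  {x | (∃ C : SphericalCoset cs.simple, x.1 C ≠ 0 ∧
      (C : Set W) ⊆ g₀ • (parabolic cs.simple T₀ : Set W)) ∧
    ∃ C : SphericalCoset cs.simple, x.1 C ≠ 0 ∧
      g₀ • (parabolic cs.simple T₀ : Set W) ⊆ (C : Set W)}

omit [Finite B] in
theorem isOpen_openStar : IsOpen (openStar cs g₀ T₀) := by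
  have h : ∀ p : SphericalCoset cs.simple → Prop,
      IsOpen {x : davisComplex cs.simple | ∃ C, x.1 C ≠ 0 ∧ p C} := by
    intro p
    have : {x : davisComplex cs.simple | ∃ C, x.1 C ≠ 0 ∧ p C} =
        ⋃ (C) (_ : p C), {x | x.1 C ≠ 0} := by
      ext x
      simp [and_comm]
    rw [this]
    refine isOpen_iUnion fun C => isOpen_iUnion fun _ => ?_
    exact isOpen_ne_fun ((continuous_apply C).comp continuous_subtype_val) continuous_const
  exact (h _).inter (h _)

/-- The open set of the model space onto which the chart maps the open star. -/
def chartTarget (T₀ : Set B) : Set (B → ℝ) :=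
  {v | (∀ i ∉ T₀, v i < 1) ∧ ∀ u ∈ parabolic cs.simple T₀,
    (∀ i ∈ T₀, 0 ≤ dualRep cs u⁻¹ v i) → ∀ i ∈ T₀, dualRep cs u⁻¹ v i < 1}

/-- Each `u` contributes an implication from a closed condition to an open one, which is open, and
`W_{T₀}` is finite. -/
theorem isOpen_chartTarget (hT₀ : IsSpherical cs.simple T₀) : IsOpen (chartTarget cs T₀) := by
  have hc : ∀ (g : W) (i : B), Continuous fun v : B → ℝ => dualRep cs g v i := fun g i =>
    (continuous_apply i).comp
      (LinearMap.continuous_of_finiteDimensional (dualRep cs g : (B → ℝ) →ₗ[ℝ] (B → ℝ)))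
  have h1 : IsOpen {v : B → ℝ | ∀ i ∉ T₀, v i < 1} := by
    have : {v : B → ℝ | ∀ i ∉ T₀, v i < 1} = ⋂ i ∈ T₀ᶜ, {v | v i < 1} := by
      ext v; simp
    rw [this]
    exact (Set.toFinite _).isOpen_biInter fun i _ => isOpen_lt (by fun_prop) (by fun_prop)
  have h2 : ∀ u, IsOpen {v : B → ℝ |
      (∀ i ∈ T₀, 0 ≤ dualRep cs u⁻¹ v i) → ∀ i ∈ T₀, dualRep cs u⁻¹ v i < 1} := by
    intro u
    have : {v : B → ℝ |
        (∀ i ∈ T₀, 0 ≤ dualRep cs u⁻¹ v i) → ∀ i ∈ T₀, dualRep cs u⁻¹ v i < 1} =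
        (⋂ i ∈ T₀, {v | 0 ≤ dualRep cs u⁻¹ v i})ᶜ ∪ ⋂ i ∈ T₀, {v | dualRep cs u⁻¹ v i < 1} := by
      ext v
      simp only [Set.mem_union, Set.mem_compl_iff, Set.mem_iInter]
      exact imp_iff_not_or
    rw [this]
    apply IsOpen.union
    · rw [isOpen_compl_iff]
      exact isClosed_biInter fun i _ => isClosed_le continuous_const (hc _ i)
    · exact (Set.toFinite _).isOpen_biInter fun i _ => isOpen_lt (hc _ i) continuous_const
  have : chartTarget cs T₀ = {v | ∀ i ∉ T₀, v i < 1} ∩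
      ⋂ u ∈ (parabolic cs.simple T₀ : Set W), {v : B → ℝ |
      (∀ i ∈ T₀, 0 ≤ dualRep cs u⁻¹ v i) → ∀ i ∈ T₀, dualRep cs u⁻¹ v i < 1} := by
    ext v
    simp only [chartTarget, Set.mem_inter_iff, Set.mem_iInter]
    rfl
  rw [this]
  exact h1.inter (Set.Finite.isOpen_biInter hT₀ fun u _ => h2 u)

/-- The largest type of the carrier contains `T₀` iff all type weights on `T₀` are positive; the
smallest type lies in `T₀` iff those off `T₀` are below `1`. -/
theorem openStar_iff (x : davisComplex cs.simple) : x ∈ openStar cs g₀ T₀ ↔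
    x.1 ∈ nearStar cs g₀ T₀ ∧ (∀ i ∈ T₀, 0 < typeWeight cs g₀ hT₀ x.1 i) ∧
      ∀ i ∉ T₀, typeWeight cs g₀ hT₀ x.1 i < 1 := by
  constructor
  · rintro ⟨⟨C₁, hC₁, h₁⟩, C₂, hC₂, h₂⟩
    have hn : x.1 ∈ nearStar cs g₀ T₀ := by
      refine ⟨x.2, fun C hC => ?_⟩
      rcases realization_chain x.2 hC hC₁ with h | h
      · obtain ⟨w, hw⟩ := C.nonempty
        exact ⟨w, hw, h₁ (h hw)⟩
      · obtain ⟨w, hw⟩ := C₁.nonempty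
        exact ⟨w, h hw, h₁ hw⟩
    refine ⟨hn, fun i hi => typeWeight_pos cs g₀ hT₀ hn hC₂ ?_,
      fun i hi => typeWeight_lt_one cs g₀ hT₀ hn hC₁ ?_⟩
    · obtain ⟨g, T, hT, hC⟩ := C₂.exists_eq
      rw [hC, smul_parabolic_subset_iff] at h₂
      rw [hC, cosetType_smul]
      exact h₂.2 hi
    · obtain ⟨g, T, hT, hC⟩ := C₁.exists_eq
      rw [hC, smul_parabolic_subset_iff] at h₁
      rw [hC, cosetType_smul]
      exact fun h => hi (h₁.2 h)
  · rintro ⟨hn, h1, h2⟩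
    obtain ⟨u, hu, hx⟩ := exists_nearRep cs g₀ hn
    have hg : g₀ * u ∈ g₀ • (parabolic cs.simple T₀ : Set W) := by
      rw [mem_smul_parabolic]
      simpa using hu
    constructor
    · obtain ⟨C, hC, hmin⟩ := exists_minimal_coset x.2
      refine ⟨C, hC, ?_⟩
      rw [C.eq_smul_cosetType cs (hx C hC), smul_parabolic_subset_iff]
      refine ⟨hg, fun i hi => ?_⟩
      by_contra hiT
      obtain ⟨C', hC', hi'⟩ := exists_of_typeWeight_ne_one cs g₀ hT₀ hn (h2 i hiT).ne
      exact hi' (cosetType_mono cs (hmin C' hC') hi)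
    · obtain ⟨C, hC, hmax⟩ := exists_maximal_coset x.2
      refine ⟨C, hC, ?_⟩
      rw [C.eq_smul_cosetType cs (hx C hC), smul_parabolic_eq _ hg]
      refine Set.smul_set_mono (parabolic_mono _ fun i hi => ?_)
      obtain ⟨C', hC', hi'⟩ := exists_of_typeWeight_ne_zero cs g₀ hT₀ (h1 i hi).ne'
      exact cosetType_mono cs (hmax C' hC') hi'

theorem chartMap_mem {x : davisComplex cs.simple} (hx : x ∈ openStar cs g₀ T₀) :
    chartMap cs g₀ hT₀ x.1 ∈ modelSpace cs.simple T₀ ∩ chartTarget cs T₀ := by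
  obtain ⟨hn, h1, h2⟩ := (openStar_iff cs g₀ hT₀ x).1 hx
  obtain ⟨u, hu, hux⟩ := exists_nearRep cs g₀ hn
  have he := chartMap_eq cs g₀ hT₀ hn hu hux
  refine ⟨⟨fun i hi => ?_, ?_⟩, fun i hi => ?_, fun u' hu' hpos i hi => ?_⟩
  · rw [(he i).2 hi]
    exact typeWeight_nonneg cs g₀ hT₀ hn i
  · obtain ⟨C, hC, hmax⟩ := exists_maximal_coset x.2
    refine (isSpherical_cosetType cs C).mono fun i hi => ?_
    have hne : typeWeight cs g₀ hT₀ x.1 i ≠ 0 := by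
      by_cases hiT : i ∈ T₀
      · exact (h1 i hiT).ne'
      · rw [← (he i).2 hiT]
        exact hi.resolve_left hiT
    obtain ⟨C', hC', hi'⟩ := exists_of_typeWeight_ne_zero cs g₀ hT₀ hne
    exact cosetType_mono cs (hmax C' hC') hi'
  · rw [(he i).2 hi]
    exact h2 i hi
  · have e : ∀ i ∈ T₀, dualRep cs u'⁻¹ (chartMap cs g₀ hT₀ x.1) i =
        dualRep cs (u'⁻¹ * u) (1 - typeWeight cs g₀ hT₀ x.1) i := by
      intro j hj
      rw [dualRep_mul]
      exact dualRep_congr cs (inv_mem hu') (fun k hk => (he k).1 hk) j hj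
    have := (eq_and_mem_of_dualRep_eq cs (mul_mem (inv_mem hu') hu)
      (fun i _ => sub_nonneg.2 (typeWeight_le_one cs g₀ hT₀ hn i)) hpos
      (fun j hj => (e j hj).symm)).1 i hi
    rw [← this]
    linarith [h1 i hi]

theorem exists_chartMap_eq {v : B → ℝ} (hv : v ∈ modelSpace cs.simple T₀)
    (hv' : v ∈ chartTarget cs T₀) : ∃ x ∈ openStar cs g₀ T₀, chartMap cs g₀ hT₀ x.1 = v := by
  classical
  obtain ⟨u, hu, hpos⟩ := exists_dualRep_inv_nonneg cs hT₀ v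
  have hlt := hv'.2 u hu hpos
  -- With `u⁻¹ v` in the chamber of `W_{T₀}`, the formula of `chartMap_eq` is solved for the type
  -- weights.
  obtain ⟨f, hfT, hfo⟩ : ∃ f : B → ℝ, (∀ i ∈ T₀, f i = 1 - dualRep cs u⁻¹ v i) ∧
      ∀ i ∉ T₀, f i = v i :=
    ⟨fun i => if i ∈ T₀ then 1 - dualRep cs u⁻¹ v i else v i, fun i hi => if_pos hi,
      fun i hi => if_neg hi⟩
  have h0 : ∀ i, 0 ≤ f i := by
    intro i
    by_cases hi : i ∈ T₀
    · linarith [hfT i hi, hlt i hi]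
    · rw [hfo i hi]
      exact hv.1 i hi
  have h1 : ∀ i, f i ≤ 1 := by
    intro i
    by_cases hi : i ∈ T₀
    · linarith [hfT i hi, hpos i hi]
    · rw [hfo i hi]
      exact (hv'.1 i hi).le
  have hsph : IsSpherical cs.simple {i | 0 < f i} := by
    refine hv.2.mono fun i hi => ?_
    by_cases hiT : i ∈ T₀
    · exact Or.inl hiT
    · have hi : 0 < f i := hi
      rw [hfo i hiT] at hi
      exact Or.inr hi.ne'
  have hmem := pointOfWeight_mem cs g₀ hT₀ hsph hu
  have htw := typeWeight_pointOfWeight cs g₀ hT₀ hsph hu h0 h1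
  have hux : ∀ C, pointOfWeight cs (g₀ * u) f C ≠ 0 → g₀ * u ∈ (C : Set W) := by
    intro C hC
    by_contra h
    exact hC (if_neg h)
  generalize pointOfWeight cs (g₀ * u) f = x at hmem htw hux
  refine ⟨⟨x, hmem.1⟩, ?_, ?_⟩
  · refine (openStar_iff cs g₀ hT₀ ⟨x, hmem.1⟩).2 ⟨hmem, fun i hi => ?_, fun i hi => ?_⟩
    · rw [htw, hfT i hi]
      linarith [hlt i hi]
    · rw [htw, hfo i hi]
      exact hv'.1 i hi
  · funext i
    have he := chartMap_eq cs g₀ hT₀ hmem hu hux i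
    rw [htw] at he
    by_cases hi : i ∈ T₀
    · have h2 : dualRep cs u (1 - f) i = dualRep cs u (dualRep cs u⁻¹ v) i := by
        refine dualRep_congr cs hu (fun j hj => ?_) i hi
        rw [Pi.sub_apply, hfT j hj, Pi.one_apply, sub_sub_cancel]
      rw [← dualRep_mul, mul_inv_cancel, map_one] at h2
      exact (he.1 hi).trans h2
    · exact (he.2 hi).trans (hfo i hi)

/-- The Davis complex is locally homeomorphic to the model spaces. -/
theorem exists_isOpenEmbedding_openStar (hT₀ : IsSpherical cs.simple T₀) :
    ∃ ψ : openStar cs g₀ T₀ → modelSpace cs.simple T₀, Topology.IsOpenEmbedding ψ := by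
  refine ⟨fun x => ⟨chartMap cs g₀ hT₀ x.1.1, (chartMap_mem cs g₀ hT₀ x.2).1⟩, ?_⟩
  have hcomp : CompactSpace (nearStar cs g₀ T₀) :=
    isCompact_iff_compactSpace.1 (isCompact_nearStar cs g₀ hT₀)
  -- A continuous injection from a compact space to a Hausdorff space is a closed embedding.
  have hemb : Topology.IsEmbedding (fun x : nearStar cs g₀ T₀ => chartMap cs g₀ hT₀ x.1) :=
    (Continuous.isClosedEmbedding ((continuous_chartMap cs g₀ hT₀).comp continuous_subtype_val)
      fun x y h => Subtype.ext (injOn_chartMap cs g₀ hT₀ x.2 y.2 h)).isEmbedding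
  have hn : ∀ x : openStar cs g₀ T₀, x.1.1 ∈ nearStar cs g₀ T₀ := fun x =>
    ((openStar_iff cs g₀ hT₀ x.1).1 x.2).1
  have hincl : Topology.IsEmbedding
      (fun x : openStar cs g₀ T₀ => (⟨x.1.1, hn x⟩ : nearStar cs g₀ T₀)) := by
    refine Topology.IsEmbedding.of_comp (by fun_prop) continuous_subtype_val ?_
    exact (Topology.IsEmbedding.subtypeVal (p := (· ∈ davisComplex cs.simple))).comp
      (Topology.IsEmbedding.subtypeVal (p := (· ∈ openStar cs g₀ T₀)))
  refine ⟨Topology.IsEmbedding.of_comp ?_ continuous_subtype_val (hemb.comp hincl), ?_⟩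
  · exact Continuous.subtype_mk ((continuous_chartMap cs g₀ hT₀).comp
      (continuous_subtype_val.comp continuous_subtype_val)) _
  · have : Set.range (fun x : openStar cs g₀ T₀ => (⟨chartMap cs g₀ hT₀ x.1.1,
        (chartMap_mem cs g₀ hT₀ x.2).1⟩ : modelSpace cs.simple T₀)) =
        Subtype.val ⁻¹' chartTarget cs T₀ := by
      ext v
      constructor
      · rintro ⟨x, rfl⟩
        exact (chartMap_mem cs g₀ hT₀ x.2).2
      · intro hv
        obtain ⟨x, hx, he⟩ := exists_chartMap_eq cs g₀ hT₀ v.2 hv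
        exact ⟨⟨x, hx⟩, Subtype.ext he⟩
    rw [this]
    exact (isOpen_chartTarget cs hT₀).preimage continuous_subtype_val

end Chart

/-! ### Locally Euclidean spaces -/

section Euclidean

variable {X Y : Type*} [TopologicalSpace X] [TopologicalSpace Y] {m : ℕ}

/-- The point `x` has an open neighbourhood homeomorphic to an open set of `ℝᵐ`. -/
def IsEuclideanAt (m : ℕ) (x : X) : Prop :=
  ∃ φ : OpenPartialHomeomorph X (EuclideanSpace ℝ (Fin m)), x ∈ φ.source

theorem isEuclideanAt_iff_of_isOpenEmbedding {f : X → Y} (hf : Topology.IsOpenEmbedding f) (x : X) :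
    IsEuclideanAt m (f x) ↔ IsEuclideanAt m x := by
  have : Nonempty X := ⟨x⟩
  constructor
  · rintro ⟨φ, hφ⟩
    exact ⟨(hf.toOpenPartialHomeomorph f).trans φ, by simpa using hφ⟩
  · rintro ⟨φ, hφ⟩
    refine ⟨(hf.toOpenPartialHomeomorph f).symm.trans φ, ?_⟩
    rw [OpenPartialHomeomorph.trans_source]
    refine ⟨by simp, ?_⟩
    have := (hf.toOpenPartialHomeomorph f).left_inv (x := x) (by simp)
    simp only [Topology.IsOpenEmbedding.toOpenPartialHomeomorph_apply] at this
    rw [Set.mem_preimage, this]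
    exact hφ

theorem isEuclideanAt_of_chartedSpace [ChartedSpace (EuclideanSpace ℝ (Fin m)) X] (x : X) :
    IsEuclideanAt m x :=
  ⟨chartAt _ x, mem_chart_source _ x⟩

theorem isTopManifold_of_isEuclideanAt [T2Space X] [SecondCountableTopology X]
    (h : ∀ x : X, IsEuclideanAt m x) : IsTopManifold m X := by
  choose φ hφ using h
  exact ⟨inferInstance, inferInstance, ⟨{
    atlas := Set.range φ
    chartAt := φ
    mem_chart_source := hφ
    chart_mem_atlas := fun x => ⟨x, rfl⟩ }⟩⟩

end Euclidean

/-- A point lies in the open star of every coset of its carrier: that coset serves as both the lower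
and the upper bound. -/
theorem isEuclideanAt_davisComplex {B W : Type*} [Finite B] [Group W] {M : CoxeterMatrix B}
    (cs : CoxeterSystem M W) {m : ℕ}
    (h : ∀ T₀, IsSpherical cs.simple T₀ → ∀ v : modelSpace cs.simple T₀, IsEuclideanAt m v)
    (x : davisComplex cs.simple) : IsEuclideanAt m x := by
  obtain ⟨C, hC, -⟩ := exists_minimal_coset x.2
  obtain ⟨g, T, hT, hCg⟩ := C.exists_eq
  have hx : x ∈ openStar cs g T := ⟨⟨C, hC, hCg.subset⟩, C, hC, hCg.superset⟩
  obtain ⟨ψ, hψ⟩ := exists_isOpenEmbedding_openStar cs g hT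
  have h1 := (isEuclideanAt_iff_of_isOpenEmbedding hψ ⟨x, hx⟩).1 (h T hT _)
  exact (isEuclideanAt_iff_of_isOpenEmbedding
    (isOpen_openStar cs g).isOpenEmbedding_subtypeVal ⟨x, hx⟩).2 h1

/-! ### Special subgroups of even Coxeter groups are Coxeter groups -/

section Restrict

variable {B W : Type*} [Group W] {M : CoxeterMatrix B} (cs : CoxeterSystem M W)

/-- The Coxeter matrix of a special subgroup. -/
def restrictMatrix (M : CoxeterMatrix B) (V : Set B) : CoxeterMatrix V where
  M := fun i j => M i j
  isSymm := by
    ext i j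
    exact M.symmetric j i
  diagonal := fun i => M.diagonal i
  off_diagonal := fun i j h => M.off_diagonal i j fun e => h (Subtype.ext e)

/-- The generators of a special subgroup. -/
def subGenerator (V : Set B) (i : V) : parabolic cs.simple V :=
  ⟨cs.simple i, Subgroup.subset_closure (Set.mem_image_of_mem _ i.2)⟩

theorem isLiftable_subGenerator (V : Set B) :
    (restrictMatrix M V).IsLiftable (subGenerator cs V) := fun i j =>
  Subtype.ext (cs.simple_mul_simple_pow i j)

theorem map_parabolic_subGenerator (V : Set B) (T : Set V) :
    (parabolic (subGenerator cs V) T).map (parabolic cs.simple V).subtype =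
      parabolic cs.simple (Subtype.val '' T) := by
  have h := MonoidHom.map_closure (parabolic cs.simple V).subtype (subGenerator cs V '' T)
  rw [Set.image_image] at h
  refine h.trans ?_
  change _ = Subgroup.closure (cs.simple '' (Subtype.val '' T))
  rw [Set.image_image]
  rfl

theorem mem_parabolic_subGenerator {V : Set B} {T : Set V} {w : parabolic cs.simple V} :
    w ∈ parabolic (subGenerator cs V) T ↔ (w : W) ∈ parabolic cs.simple (Subtype.val '' T) := by
  rw [← map_parabolic_subGenerator, Subgroup.mem_map]
  constructor
  · exact fun h => ⟨w, h, rfl⟩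
  · rintro ⟨w', h, e⟩
    rwa [← Subtype.ext (show (w' : W) = w from e)]

theorem isSpherical_subGenerator {V : Set B} {T : Set V} :
    IsSpherical (subGenerator cs V) T ↔ IsSpherical cs.simple (Subtype.val '' T) := by
  unfold IsSpherical
  rw [← map_parabolic_subGenerator, Subgroup.coe_map]
  exact (Set.finite_image_iff Subtype.val_injective.injOn).symm

theorem parabolic_subGenerator_univ (V : Set B) :
    parabolic (subGenerator cs V) Set.univ = ⊤ := by
  rw [eq_top_iff]
  intro w _
  rw [mem_parabolic_subGenerator]
  simp

-- When one of two generators is killed, the relation becomes an even power of an involution.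
open Classical in
theorem isLiftable_restrict (hM : IsEvenMatrix M) (V : Set B) : M.IsLiftable
    (fun i => if h : i ∈ V then (restrictMatrix M V).simple ⟨i, h⟩ else 1) := by
  intro i j
  have hsq : ∀ k : V, (restrictMatrix M V).simple k * (restrictMatrix M V).simple k = 1 := fun k =>
    (restrictMatrix M V).toCoxeterSystem.simple_mul_simple_self k
  by_cases hij : i = j
  · subst hij
    dsimp only
    split_ifs
    · rw [hsq, one_pow]
    · rw [one_mul, one_pow]
  obtain ⟨k, hk⟩ := hM i j hij
  by_cases hi : i ∈ V <;> by_cases hj : j ∈ V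
  · simp only [hi, hj, dif_pos]
    exact (restrictMatrix M V).toCoxeterSystem.simple_mul_simple_pow ⟨i, hi⟩ ⟨j, hj⟩
  · simp only [hi, hj, dif_pos, dif_neg, not_false_eq_true, mul_one]
    rw [hk, ← two_mul, pow_mul, pow_two, hsq, one_pow]
  · simp only [hi, hj, dif_pos, dif_neg, not_false_eq_true, one_mul]
    rw [hk, ← two_mul, pow_mul, pow_two, hsq, one_pow]
  · simp only [hi, hj, dif_neg, not_false_eq_true, one_mul, one_pow]

/-- A special subgroup of an even Coxeter group is a Coxeter group. -/
theorem exists_coxeterSystem_subGenerator (hM : IsEvenMatrix M) (V : Set B) :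
    ∃ cs' : CoxeterSystem (restrictMatrix M V) (parabolic cs.simple V),
      cs'.simple = subGenerator cs V := by
  classical
  let c := (restrictMatrix M V).toCoxeterSystem
  let ψ : (restrictMatrix M V).Group →* parabolic cs.simple V :=
    c.lift ⟨subGenerator cs V, isLiftable_subGenerator cs V⟩
  have hψ : ∀ i, ψ (c.simple i) = subGenerator cs V i := fun i =>
    c.lift_apply_simple (isLiftable_subGenerator cs V) i
  let φ : W →* (restrictMatrix M V).Group := cs.lift ⟨_, isLiftable_restrict hM V⟩
  have hφ : ∀ i : V, φ (cs.simple i) = c.simple i := by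
    intro i
    have := cs.lift_apply_simple (isLiftable_restrict hM V) (i : B)
    rw [dif_pos i.2] at this
    exact this
  -- The retraction `φ` is a left inverse of the canonical map from the abstract Coxeter group,
  -- which is therefore injective.
  have hinv : (φ.comp (parabolic cs.simple V).subtype).comp ψ = MonoidHom.id _ := by
    apply c.ext_simple
    intro i
    change φ (ψ (c.simple i) : W) = c.simple i
    rw [hψ]
    exact hφ i
  have hinj : Function.Injective ψ := by
    intro x y hxy
    have h1 := DFunLike.congr_fun hinv x
    have h2 := DFunLike.congr_fun hinv y
    simp only [MonoidHom.comp_apply, MonoidHom.id_apply] at h1 h2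
    rw [← h1, ← h2, hxy]
  have hsurj : Function.Surjective ψ := by
    rw [← MonoidHom.range_eq_top, eq_top_iff, ← parabolic_subGenerator_univ]
    refine (Subgroup.closure_le _).2 ?_
    rintro _ ⟨i, -, rfl⟩
    exact ⟨c.simple i, hψ i⟩
  exact ⟨c.map (MulEquiv.ofBijective ψ ⟨hinj, hsurj⟩), funext hψ⟩

end Restrict

/-! ### Spherical pairs -/

section Pairs

/-- Since `a` inverts `a * b`, the group is `Z ∪ Z a` with `Z` the cyclic group of `a * b`. -/
theorem finite_closure_pair {G : Type*} [Group G] {a b : G} (ha : a * a = 1) (hb : b * b = 1)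
    {m : ℕ} (hm : m ≠ 0) (hab : (a * b) ^ m = 1) :
    (Subgroup.closure {a, b} : Set G).Finite := by
  have hfin : (Subgroup.zpowers (a * b) : Set G).Finite :=
    (isOfFinOrder_iff_pow_eq_one.2 ⟨m, Nat.pos_of_ne_zero hm, hab⟩).finite_zpowers
  set Z := Subgroup.zpowers (a * b) with hZ
  have hai : a⁻¹ = a := inv_eq_of_mul_eq_one_right ha
  have hbi : b⁻¹ = b := inv_eq_of_mul_eq_one_right hb
  have hconj : ∀ z ∈ Z, a * z * a ∈ Z := by
    rintro _ ⟨k, rfl⟩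
    refine ⟨-k, ?_⟩
    have h1 : a * (a * b) ^ k * a⁻¹ = (a * (a * b) * a⁻¹) ^ k := conj_zpow.symm
    have h2 : a * (a * b) * a⁻¹ = (a * b)⁻¹ := by
      rw [mul_inv_rev, hai, hbi, ← mul_assoc, ha, one_mul]
    rw [h2, hai, inv_zpow'] at h1
    exact h1.symm
  have hsub : (Subgroup.closure {a, b} : Set G) ⊆ (Z : Set G) ∪ (fun z => z * a) '' (Z : Set G) := by
    have hA : ∀ y, y ∈ (Z : Set G) ∪ (fun z => z * a) '' (Z : Set G) →
        a * y ∈ (Z : Set G) ∪ (fun z => z * a) '' (Z : Set G) := by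
      rintro y (hy | ⟨z, hz, rfl⟩)
      · refine Or.inr ⟨a * y * a, hconj y hy, ?_⟩
        simp [mul_assoc, ha]
      · exact Or.inl (by simpa [mul_assoc] using hconj z hz)
    have hAB : ∀ y, y ∈ (Z : Set G) ∪ (fun z => z * a) '' (Z : Set G) →
        (a * b) * y ∈ (Z : Set G) ∪ (fun z => z * a) '' (Z : Set G) := by
      have hab' : a * b ∈ Z := Subgroup.mem_zpowers _
      rintro y (hy | ⟨z, hz, rfl⟩)
      · exact Or.inl (mul_mem hab' hy)
      · exact Or.inr ⟨a * b * z, mul_mem hab' hz, by simp [mul_assoc]⟩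
    have hB : ∀ y, y ∈ (Z : Set G) ∪ (fun z => z * a) '' (Z : Set G) →
        b * y ∈ (Z : Set G) ∪ (fun z => z * a) '' (Z : Set G) := by
      intro y hy
      have : b * y = a * ((a * b) * y) := by
        rw [← mul_assoc, ← mul_assoc, ha, one_mul]
      rw [this]
      exact hA _ (hAB y hy)
    intro w hw
    replace hw : w ∈ Subgroup.closure {a, b} := hw
    induction hw using Subgroup.closure_induction_left with
    | one => exact Or.inl (one_mem Z)
    | mul_left x hx y _ h =>
      obtain rfl | rfl := hx
      · exact hA y h
      · exact hB y h
    | inv_mul_cancel x hx y _ h =>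
      obtain rfl | rfl := hx
      · rw [hai]; exact hA y h
      · rw [hbi]; exact hB y h
  exact (hfin.union (hfin.image _)).subset hsub

variable {B W : Type*} [Group W] {M : CoxeterMatrix B} (cs : CoxeterSystem M W)

theorem isSpherical_pair {i j : B} (h : M i j ≠ 0) : IsSpherical cs.simple {i, j} := by
  rw [IsSpherical, parabolic, Set.image_pair]
  exact finite_closure_pair (cs.simple_mul_simple_self i) (cs.simple_mul_simple_self j) h
    (cs.simple_mul_simple_pow i j)

theorem isSpherical_singleton (i : B) : IsSpherical cs.simple {i} := by
  have := isSpherical_pair cs (i := i) (j := i) (by simp)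
  rwa [Set.pair_eq_singleton] at this

theorem isSpherical_empty : IsSpherical cs.simple ∅ := by
  simp [IsSpherical, parabolic]

/-- By evenness, killing all other generators defines a map to the infinite dihedral group
`DihedralGroup 0` when the label is infinite; the product of the two generators then has infinite
order. -/
theorem ne_zero_of_isSpherical_pair (hM : IsEvenMatrix M) {i j : B}
    (h : IsSpherical cs.simple {i, j}) : M i j ≠ 0 := by
  classical
  intro h0
  have hij : i ≠ j := by
    rintro rfl
    simp at h0
  let f : B → DihedralGroup 0 := fun k =>
    if k = i then DihedralGroup.sr 0 else if k = j then DihedralGroup.sr 1 else 1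
  have hsq : ∀ k, f k * f k = 1 := by
    intro k
    simp only [f]
    split_ifs <;> simp
  have hf : M.IsLiftable f := by
    intro k l
    by_cases hkl : k = l
    · subst hkl
      rw [hsq, one_pow]
    obtain ⟨p, hp⟩ := hM k l hkl
    by_cases hk : k = i ∨ k = j
    · by_cases hl : l = i ∨ l = j
      · have : M k l = 0 := by
          rcases hk with rfl | rfl <;> rcases hl with rfl | rfl
          · exact absurd rfl hkl
          · exact h0
          · rw [M.symmetric]; exact h0
          · exact absurd rfl hkl
        rw [this, pow_zero]
      · rw [not_or] at hl
        have : f l = 1 := by simp [f, hl.1, hl.2]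
        rw [this, mul_one, hp, ← two_mul, pow_mul, pow_two, hsq, one_pow]
    · rw [not_or] at hk
      have : f k = 1 := by simp [f, hk.1, hk.2]
      rw [this, one_mul, hp, ← two_mul, pow_mul, pow_two, hsq, one_pow]
  let φ := cs.lift ⟨f, hf⟩
  have hi : φ (cs.simple i) = DihedralGroup.sr 0 := by
    rw [cs.lift_apply_simple hf]; simp [f]
  have hj : φ (cs.simple j) = DihedralGroup.sr 1 := by
    rw [cs.lift_apply_simple hf]; simp [f, hij.symm]
  have hmem : cs.simple i * cs.simple j ∈ parabolic cs.simple {i, j} :=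
    mul_mem (simple_mem_parabolic cs (by simp)) (simple_mem_parabolic cs (by simp))
  have : Finite (parabolic cs.simple {i, j}) := h
  obtain ⟨n, hn, hpow⟩ := isOfFinOrder_iff_pow_eq_one.1
    (isOfFinOrder_of_finite (⟨_, hmem⟩ : parabolic cs.simple {i, j}))
  have h1 : (cs.simple i * cs.simple j) ^ n = 1 := congrArg Subtype.val hpow
  have h2 := congrArg φ h1
  rw [map_pow, map_mul, hi, hj, map_one, DihedralGroup.sr_mul_sr, DihedralGroup.r_pow,
    DihedralGroup.one_def] at h2
  have h3 := DihedralGroup.r.inj h2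
  simp only [sub_zero, one_mul] at h3
  have h4 : (n : ℤ) = 0 := h3
  omega

variable {t : B}

theorem subset_starSet_of_isSpherical (hM : IsEvenMatrix M) {T : Set B}
    (h : IsSpherical cs.simple T) (ht : t ∈ T) : T ⊆ starSet M t := fun _ hi =>
  ne_zero_of_isSpherical_pair cs hM (h.mono (Set.insert_subset hi (Set.singleton_subset_iff.2 ht)))

/-- In a flag nerve, the link of `t` is the nerve of `(W_{U-t}, U-t)`. -/
theorem isSpherical_insert_of_isFlag [Finite B] (hF : IsFlag (nerve cs.simple)) {T : Set B}
    (hT : IsSpherical cs.simple T) (hTU : T ⊆ starSet M t) : IsSpherical cs.simple (insert t T) := by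
  classical
  have hfin : (insert t T).Finite := Set.toFinite _
  have := hF hfin.toFinset ⟨t, by simp⟩ (by
    intro i hi j hj
    refine ⟨⟨i, by simp⟩, ?_⟩
    rw [Finset.coe_pair]
    rw [Set.Finite.mem_toFinset] at hi hj
    rcases hi with rfl | hi <;> rcases hj with rfl | hj
    · rw [Set.pair_eq_singleton]; exact isSpherical_singleton cs _
    · rw [Set.pair_comm]; exact isSpherical_pair cs (hTU hj)
    · exact isSpherical_pair cs (hTU hi)
    · exact hT.mono (Set.insert_subset hi (Set.singleton_subset_iff.2 hj)))
  simpa using this.2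

end Pairs

/-! ### The open star of a vertex of the nerve -/

section Nerve

variable {B G : Type*} [Group G] (s : B → G)

theorem mem_realization_nerve_iff [Fintype B] {x : B → ℝ} : x ∈ realization (nerve s) ↔
    (∀ b, 0 ≤ x b) ∧ ∑ b, x b = 1 ∧ IsSpherical s (Function.support x) := by
  classical
  constructor
  · rintro ⟨h0, σ, hσ, hs, h1⟩
    refine ⟨h0, ?_, ?_⟩
    · rw [← h1]
      symm
      apply Finset.sum_subset (Finset.subset_univ _)
      intro b _ hb
      by_contra h
      have : b ∈ Function.support x := h
      rw [hs] at this
      exact hb this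
    · rw [hs]
      exact hσ.2
  · rintro ⟨h0, h1, h2⟩
    have hs : ((Finset.univ.filter fun b => x b ≠ 0 : Finset B) : Set B) = Function.support x := by
      ext b; simp
    refine ⟨h0, Finset.univ.filter fun b => x b ≠ 0, ⟨?_, by rw [hs]; exact h2⟩, hs.symm, ?_⟩
    · rw [Finset.nonempty_iff_ne_empty]
      intro h
      have h3 := Finset.sum_filter_ne_zero (s := Finset.univ) (f := x)
      rw [h, h1] at h3
      simp at h3
    · rw [Finset.sum_filter_ne_zero, h1]

end Nerve

/-! ### Homogeneous coordinates: model spaces as open subsets of the nerve. -/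

section Star

open Classical in
/-- The exponential function on the coordinates in `T₀` and the identity on the others. -/
noncomputable def mixedExp {V : Type*} (T₀ : Set V) (i : V) (r : ℝ) : ℝ :=
  -- Coordinates in `T₀` range over all reals and must become positive; the others are already
  -- nonnegative and may vanish.
  if i ∈ T₀ then Real.exp r else r

open Classical in
/-- The inverse of `mixedExp` on positive arguments. -/
noncomputable def mixedLog {V : Type*} (T₀ : Set V) (i : V) (r : ℝ) : ℝ :=
  if i ∈ T₀ then Real.log r else r

variable {B G H : Type*} [Group G] [Group H] (s : B → G) {V : Set B} (s' : V → H) (t : B)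

open Classical in
/-- Homogeneous coordinates on the star of `t` in the nerve. -/
noncomputable def starCoord (T₀ : Set V) (v : V → ℝ) : B → ℝ := fun b =>
  if b = t then 1 else if h : b ∈ V then mixedExp T₀ ⟨b, h⟩ (v ⟨b, h⟩) else 0

variable {t} (T₀ : Set V)

theorem starCoord_self (v : V → ℝ) : starCoord t T₀ v t = 1 := if_pos rfl

theorem starCoord_coe (htV : t ∉ V) (v : V → ℝ) (i : V) :
    starCoord t T₀ v i = mixedExp T₀ i (v i) := by
  have h : (i : B) ≠ t := fun e => htV (e ▸ i.2)
  simp [starCoord, h]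

theorem starCoord_of_notMem {b : B} (hb : b ≠ t) (hb' : b ∉ V) (v : V → ℝ) :
    starCoord t T₀ v b = 0 := by
  simp [starCoord, hb, hb']

theorem continuous_starCoord (b : B) : Continuous fun v => starCoord t T₀ v b := by
  unfold starCoord mixedExp
  split_ifs <;> fun_prop

theorem starCoord_nonneg {v : V → ℝ} (hv : v ∈ modelSpace s' T₀) (b : B) :
    0 ≤ starCoord t T₀ v b := by
  unfold starCoord mixedExp
  split_ifs with _ _ h
  · norm_num
  · positivity
  · exact hv.1 _ h
  · exact le_rfl

theorem support_starCoord (htV : t ∉ V) (v : V → ℝ) :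
    Function.support (starCoord t T₀ v) =
      insert t (Subtype.val '' (T₀ ∪ Function.support v)) := by
  ext b
  rw [Function.mem_support]
  by_cases hb : b = t
  · subst hb
    simp [starCoord_self]
  by_cases hV : b ∈ V
  · lift b to V using hV
    rw [starCoord_coe T₀ htV, mixedExp]
    split_ifs with h
    · simp [h, Real.exp_ne_zero]
    · simp [h, hb]
  · simp [starCoord_of_notMem T₀ hb hV, hb, hV]

theorem sum_starCoord_pos [Fintype B] {v : V → ℝ} (hv : v ∈ modelSpace s' T₀) :
    0 < ∑ b, starCoord t T₀ v b :=
  Finset.sum_pos' (fun b _ => starCoord_nonneg s' T₀ hv b)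
    ⟨t, Finset.mem_univ _, by rw [starCoord_self]; norm_num⟩

/-- The open subset of the nerve onto which a model space is mapped. -/
def openStarNerve : Set (realization (nerve s)) :=
  {y | 0 < y.1 t ∧ ∀ i ∈ T₀, 0 < y.1 (i : B)}

theorem isOpen_openStarNerve [Finite B] : IsOpen (openStarNerve s (t := t) T₀) := by
  have hc : ∀ b, Continuous fun y : realization (nerve s) => y.1 b := fun b =>
    (continuous_apply b).comp continuous_subtype_val
  have : openStarNerve s (t := t) T₀ =
      {y | 0 < y.1 t} ∩ ⋂ i ∈ T₀, {y | 0 < y.1 (i : B)} := by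
    ext y
    simp [openStarNerve]
  rw [this]
  exact (isOpen_lt continuous_const (hc t)).inter
    ((Set.toFinite _).isOpen_biInter fun i _ => isOpen_lt continuous_const (hc i))

variable {s s'}

/-- If the spherical sets of `s'` form the link of `t`, then the model spaces of `s'` are open
subsets of the nerve of `s`. -/
noncomputable def modelSpaceHomeomorph [Fintype B] (htV : t ∉ V)
    (hlink : ∀ T, IsSpherical s' T ↔ IsSpherical s (insert t (Subtype.val '' T)))
    (hsub : ∀ T, IsSpherical s T → t ∈ T → T ⊆ insert t V) :
    modelSpace s' T₀ ≃ₜ openStarNerve s (t := t) T₀ where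
  toFun v := ⟨⟨fun b => starCoord t T₀ v.1 b / ∑ c, starCoord t T₀ v.1 c, by
    have hD := sum_starCoord_pos (t := t) s' T₀ v.2
    rw [mem_realization_nerve_iff]
    refine ⟨fun b => div_nonneg (starCoord_nonneg s' T₀ v.2 b) hD.le, ?_, ?_⟩
    · rw [← Finset.sum_div, div_self hD.ne']
    · have : (Function.support fun b => starCoord t T₀ v.1 b / ∑ c, starCoord t T₀ v.1 c) =
          Function.support (starCoord t T₀ v.1) := by
        ext b
        simp [hD.ne']
      rw [this, support_starCoord T₀ htV, ← hlink]
      exact v.2.2⟩, by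
    have hD := sum_starCoord_pos (t := t) s' T₀ v.2
    refine ⟨?_, fun i hi => ?_⟩
    · exact div_pos (by rw [starCoord_self]; norm_num) hD
    · refine div_pos ?_ hD
      rw [starCoord_coe T₀ htV, mixedExp, if_pos hi]
      exact Real.exp_pos _⟩
  invFun y := ⟨fun i => mixedLog T₀ i (y.1.1 i / y.1.1 t), by
    obtain ⟨h0, -, h2⟩ := (mem_realization_nerve_iff s).1 y.1.2
    refine ⟨fun i hi => ?_, ?_⟩
    · change 0 ≤ mixedLog T₀ i _
      rw [mixedLog, if_neg hi]
      exact div_nonneg (h0 _) (h0 _)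
    · rw [hlink]
      refine h2.mono (Set.insert_subset y.2.1.ne' ?_)
      rintro _ ⟨i, hi, rfl⟩
      by_cases hiT : i ∈ T₀
      · exact (y.2.2 i hiT).ne'
      · have := hi.resolve_left hiT
        rw [Function.mem_support, mixedLog, if_neg hiT] at this
        exact fun h => this (by rw [h, zero_div])⟩
  left_inv v := by
    have hD := sum_starCoord_pos (t := t) s' T₀ v.2
    apply Subtype.ext
    funext i
    dsimp only
    rw [div_div_div_cancel_right₀ hD.ne', starCoord_self, div_one, starCoord_coe T₀ htV,
      mixedLog, mixedExp]
    split_ifs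
    · exact Real.log_exp _
    · rfl
  right_inv y := by
    obtain ⟨h0, h1, h2⟩ := (mem_realization_nerve_iff s).1 y.1.2
    have ht : 0 < y.1.1 t := y.2.1
    have key : ∀ b, starCoord t T₀ (fun i => mixedLog T₀ i (y.1.1 i / y.1.1 t)) b =
        y.1.1 b / y.1.1 t := by
      intro b
      by_cases hb : b = t
      · rw [hb, starCoord_self, div_self ht.ne']
      by_cases hV : b ∈ V
      · lift b to V using hV
        rw [starCoord_coe T₀ htV, mixedExp, mixedLog]
        split_ifs with hbT
        · exact Real.exp_log (div_pos (y.2.2 b hbT) ht)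
        · rfl
      · rw [starCoord_of_notMem T₀ hb hV]
        -- The support of `y` is spherical and contains `t`, so it lies in `V ∪ {t}`.
        have : y.1.1 b = 0 := by
          by_contra h
          exact (hsub _ h2 ht.ne' (show b ∈ Function.support y.1.1 from h)).elim hb hV
        rw [this, zero_div]
    apply Subtype.ext
    apply Subtype.ext
    funext b
    dsimp only
    simp_rw [key]
    rw [← Finset.sum_div, h1, div_div_div_cancel_right₀ ht.ne', div_one]
  continuous_toFun := by
    refine Continuous.subtype_mk (Continuous.subtype_mk (continuous_pi fun b => ?_) _) _
    have hc : ∀ b, Continuous fun v : modelSpace s' T₀ => starCoord t T₀ v.1 b := fun b =>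
      (continuous_starCoord T₀ b).comp continuous_subtype_val
    exact (hc b).div (continuous_finsetSum _ fun c _ => hc c)
      fun v => (sum_starCoord_pos (t := t) s' T₀ v.2).ne'
  continuous_invFun := by
    refine Continuous.subtype_mk (continuous_pi fun i => ?_) _
    have hc : ∀ b, Continuous fun y : openStarNerve s (t := t) T₀ => y.1.1 b := fun b =>
      (continuous_apply b).comp (continuous_subtype_val.comp continuous_subtype_val)
    have hq : Continuous fun y : openStarNerve s (t := t) T₀ => y.1.1 (i : B) / y.1.1 t :=
      (hc i).div (hc t) fun y => y.2.1.ne'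
    unfold mixedLog
    split_ifs with hi
    · exact hq.log fun y => (div_pos (y.2.2 i hi) y.2.1).ne'
    · exact hq

end Star

/-- If the nerve is a flag triangulation of a sphere, then the Davis complex of
`(W_{U-t}, U-t)` is locally Euclidean. -/
theorem isEuclideanAt_davisComplex_link {B W : Type*} [Finite B] [Group W] {M : CoxeterMatrix B}
    (cs : CoxeterSystem M W) (hM : IsEvenMatrix M) (t : B) (hF : IsFlag (nerve cs.simple)) {n : ℕ}
    (hS : Nonempty (realization (nerve cs.simple) ≃ₜ
      Metric.sphere (0 : EuclideanSpace ℝ (Fin n)) 1))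
    (x : davisComplex (linkGenerator cs t)) : IsEuclideanAt (n - 1) x := by
  have := Fintype.ofFinite B
  obtain ⟨h⟩ := hS
  obtain ⟨cs', hcs'⟩ := exists_coxeterSystem_subGenerator cs hM (starSet M t \ {t})
  change cs'.simple = linkGenerator cs t at hcs'
  revert x
  rw [← hcs']
  intro x
  refine isEuclideanAt_davisComplex cs' (fun T₀ hT₀ v => ?_) x
  have htV : t ∉ starSet M t \ {t} := by simp
  have hlink : ∀ T, IsSpherical cs'.simple T ↔
      IsSpherical cs.simple (insert t (Subtype.val '' T)) := by
    intro T
    rw [hcs']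
    refine (isSpherical_subGenerator cs).trans ⟨fun hT => ?_, fun hT => ?_⟩
    · refine isSpherical_insert_of_isFlag cs hF hT ?_
      rintro _ ⟨i, -, rfl⟩
      exact i.2.1
    · exact hT.mono (Set.subset_insert _ _)
  have hsub : ∀ T, IsSpherical cs.simple T → t ∈ T → T ⊆ insert t (starSet M t \ {t}) := by
    intro T hT ht i hi
    by_cases hit : i = t
    · exact Or.inl hit
    · exact Or.inr ⟨subset_starSet_of_isSpherical cs hM hT ht hi, hit⟩
  let e := modelSpaceHomeomorph T₀ htV hlink hsub
  -- The property is carried along open embeddings: model space, open star in the nerve, nerve,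
  -- sphere.
  have h1 := isEuclideanAt_iff_of_isOpenEmbedding (m := n - 1) e.isOpenEmbedding v
  rw [← h1, ← isEuclideanAt_iff_of_isOpenEmbedding
    (isOpen_openStarNerve cs.simple T₀).isOpenEmbedding_subtypeVal,
    ← isEuclideanAt_iff_of_isOpenEmbedding h.isOpenEmbedding]
  cases n with
  | zero =>
    -- For `n = 0` the unit sphere is empty, but the nerve has a point.
    exfalso
    have h2 := (h (e v).1).2
    rw [mem_sphere_zero_iff_norm, Subsingleton.elim (h (e v).1).1 0, norm_zero] at h2
    exact zero_ne_one h2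
  | succ m =>
    have : Fact (Module.finrank ℝ (EuclideanSpace ℝ (Fin (m + 1))) = m + 1) := ⟨by simp⟩
    rw [Nat.add_sub_cancel]
    exact isEuclideanAt_of_chartedSpace _

/-! ### Subcomplexes of realizations -/

section Supported

variable {P : Type*} [PartialOrder P]

/-- The full subcomplex on the elements that satisfy `p`. -/
def supportedIn (p : P → Prop) : Set (P → ℝ) :=
  {x ∈ realization (orderComplex P) | ∀ C, x C ≠ 0 → p C}

open Classical in
/-- The vertex of the realization given by an element of the poset. -/
noncomputable def pointOf (C : P) : P → ℝ := Pi.single C 1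

omit [PartialOrder P] in
theorem pointOf_ne_zero {C D : P} : pointOf C D ≠ 0 ↔ D = C := by
  unfold pointOf
  by_cases h : D = C
  · subst h; simp
  · simp [h]

theorem pointOf_mem_realization (C : P) : pointOf C ∈ realization (orderComplex P) := by
  classical
  refine mem_realization_orderComplex_of (fun D => ?_) {C} (fun D hD => ?_) ?_ ?_
  · by_cases h : D = C
    · subst h; simp [pointOf]
    · simp [pointOf, h]
  · rw [pointOf_ne_zero] at hD
    simp [hD]
  · simp [pointOf]
  · intro D D' hD hD'
    rw [pointOf_ne_zero] at hD hD'
    rw [hD, hD']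
    exact Or.inl le_rfl

theorem pointOf_mem_supportedIn {p : P → Prop} {C : P} (h : p C) : pointOf C ∈ supportedIn p :=
  ⟨pointOf_mem_realization C, fun D hD => by rw [pointOf_ne_zero] at hD; rwa [hD]⟩

/-- A point can be joined by a segment to a vertex comparable to the vertices of its carrier. -/
theorem joinedIn_pointOf {p : P → Prop} {x : P → ℝ} (hx : x ∈ supportedIn p) {D : P} (hD : p D)
    (hcomp : ∀ C, x C ≠ 0 → C ≤ D ∨ D ≤ C) : JoinedIn (supportedIn p) x (pointOf D) := by
  classical
  have hsupp : ∀ (r : ℝ) (C : P), ((1 - r) • x + r • pointOf D) C ≠ 0 → x C ≠ 0 ∨ C = D := by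
    intro r C h
    by_contra! hc
    apply h
    have : pointOf D C = 0 := by
      by_contra h'
      exact hc.2 (pointOf_ne_zero.1 h')
    simp [hc.1, this]
  refine JoinedIn.ofLine (f := fun r : ℝ => (1 - r) • x + r • pointOf D)
    (Continuous.continuousOn (by fun_prop)) (by simp) (by simp) ?_
  rintro _ ⟨r, ⟨hr0, hr1⟩, rfl⟩
  obtain ⟨h0, σ, -, hs, h1⟩ := hx.1
  have hσ : ∀ C, x C ≠ 0 → C ∈ insert D σ := fun C hC => by
    have : C ∈ Function.support x := hC
    rw [hs] at this
    exact Finset.mem_insert_of_mem this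
  have hp := pointOf_mem_realization D
  refine ⟨mem_realization_orderComplex_of (fun C => ?_) (insert D σ) (fun C hC => ?_) ?_ ?_,
    fun C hC => ?_⟩
  · have := h0 C
    have := hp.1 C
    have : 0 ≤ 1 - r := by linarith
    simp only [Pi.add_apply, Pi.smul_apply, smul_eq_mul]
    positivity
  · rcases hsupp r C hC with h | h
    · exact hσ C h
    · rw [h]; exact Finset.mem_insert_self _ _
  · simp only [Pi.add_apply, Pi.smul_apply, smul_eq_mul, Finset.sum_add_distrib, ← Finset.mul_sum]
    rw [realization_sum hx.1 hσ, realization_sum hp]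
    · ring
    · intro C hC
      rw [pointOf_ne_zero.1 hC]
      exact Finset.mem_insert_self _ _
  · intro C C' hC hC'
    rcases hsupp r C hC with h | rfl <;> rcases hsupp r C' hC' with h' | rfl
    · exact realization_chain hx.1 h h'
    · exact hcomp C h
    · exact (hcomp C' h').symm
    · exact Or.inl le_rfl
  · rcases hsupp r C hC with h | rfl
    · exact hx.2 C h
    · exact hD

theorem comp_mem_realization_iff {P' : Type*} [PartialOrder P'] (φ : P' ↪o P) {y : P → ℝ}
    (hy : ∀ C, y C ≠ 0 → C ∈ Set.range φ) :
    y ∘ φ ∈ realization (orderComplex P') ↔ y ∈ realization (orderComplex P) := by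
  classical
  constructor
  · rintro ⟨h0, σ, ⟨-, hσ⟩, hs, h1⟩
    have hm : ∀ C, y (φ C) ≠ 0 → C ∈ σ := fun C hC => by
      have : C ∈ Function.support (y ∘ φ) := hC
      rwa [hs] at this
    refine mem_realization_orderComplex_of (fun C => ?_) (σ.map φ.toEmbedding) (fun C hC => ?_) ?_ ?_
    · by_cases hC : y C = 0
      · rw [hC]
      · obtain ⟨C', rfl⟩ := hy C hC
        exact h0 C'
    · obtain ⟨C', rfl⟩ := hy C hC
      exact Finset.mem_map_of_mem _ (hm C' hC)
    · rw [Finset.sum_map]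
      exact h1
    · intro C D hC hD
      obtain ⟨C', rfl⟩ := hy C hC
      obtain ⟨D', rfl⟩ := hy D hD
      simp only [OrderEmbedding.le_iff_le]
      exact hσ.total (hm C' hC) (hm D' hD)
  · intro hy'
    obtain ⟨h0, σ, -, hs, h1⟩ := id hy'
    have hm : ∀ C, y C ≠ 0 → C ∈ σ := fun C hC => by
      have : C ∈ Function.support y := hC
      rwa [hs] at this
    refine mem_realization_orderComplex_of (fun C => h0 _) (σ.preimage φ φ.injective.injOn)
      (fun C hC => ?_) ?_ ?_
    · rw [Finset.mem_preimage]
      exact hm _ hC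
    · rw [← h1]
      refine Finset.sum_preimage φ σ φ.injective.injOn y fun C _ hC => ?_
      by_contra h
      exact hC (hy C h)
    · intro C D hC hD
      have := realization_chain hy' hC hD
      simpa only [OrderEmbedding.le_iff_le] using this

end Supported

/-! ### One-letter ruins -/

section Ruin

variable {B W : Type*} [Group W] {M : CoxeterMatrix B} (cs : CoxeterSystem M W) (t : B)

theorem cosetType_subset_of_subset {C : SphericalCoset cs.simple} {g : W} {T : Set B}
    (h : (C : Set W) ⊆ g • (parabolic cs.simple T : Set W)) :
    cosetType cs.simple (C : Set W) ⊆ T := by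
  obtain ⟨w, hw⟩ := C.nonempty
  rw [C.eq_smul_cosetType cs hw, smul_parabolic_subset_iff] at h
  exact h.2

theorem subset_smul_parabolic {C : SphericalCoset cs.simple} {g : W} {T : Set B}
    (hg : g ∈ (C : Set W)) (h : cosetType cs.simple (C : Set W) ⊆ T) :
    (C : Set W) ⊆ g • (parabolic cs.simple T : Set W) := by
  rw [C.eq_smul_cosetType cs hg]
  exact Set.smul_set_mono (parabolic_mono _ h)

/-- The cosets in the one-letter ruin. -/
def IsRuinCoset (C : SphericalCoset cs.simple) : Prop :=
  IsSpherical cs.simple (insert t (cosetType cs.simple (C : Set W)))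

/-- The cosets in the boundary of the one-letter ruin. -/
def IsBoundaryCoset (C : SphericalCoset cs.simple) : Prop :=
  IsRuinCoset cs t C ∧ t ∉ cosetType cs.simple (C : Set W)

/-- Adding `t` to the type of the largest coset of the carrier gives one closed cell of the ruin
containing the point. -/
theorem ruin_eq : ruin cs.simple Set.univ {t} = supportedIn (IsRuinCoset cs t) := by
  ext x
  constructor
  · rintro ⟨g, T, hT, -, ht, hx⟩
    refine ⟨hx.1, fun C hC => hT.mono (Set.insert_subset (ht rfl) ?_)⟩
    exact cosetType_subset_of_subset cs (hx.2 C hC)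
  · rintro ⟨hx, h⟩
    obtain ⟨C, hC, hmax⟩ := exists_maximal_coset hx
    obtain ⟨w, hw⟩ := C.nonempty
    refine ⟨w, _, h C hC, Set.subset_univ _, by simp, hx, fun D hD => ?_⟩
    exact Set.Subset.trans (hmax D hD)
      (subset_smul_parabolic cs hw (Set.subset_insert _ _))

theorem ruinBoundary_eq :
    ruinBoundary cs.simple Set.univ {t} = supportedIn (IsBoundaryCoset cs t) := by
  ext x
  constructor
  · rintro ⟨g, T, hT, -, ht, hsub, hx⟩
    -- Testing the inclusion on the centre of the cell shows that its type together with `t` is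
    -- spherical.
    have h1 : pointOf (cosetOf cs.simple hT g) ∈ ruin cs.simple Set.univ {t} := by
      refine hsub ⟨pointOf_mem_realization _, fun C hC => ?_⟩
      rw [pointOf_ne_zero] at hC
      rw [hC]
      rfl
    rw [ruin_eq] at h1
    have h2 := h1.2 _ (pointOf_ne_zero.2 rfl)
    have h3 : cosetType cs.simple ((cosetOf cs.simple hT g : SphericalCoset cs.simple) : Set W) = T :=
      cosetType_smul cs g T
    rw [IsRuinCoset, h3] at h2
    refine ⟨hx.1, fun C hC => ?_⟩
    have h4 := cosetType_subset_of_subset cs (hx.2 C hC)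
    exact ⟨h2.mono (Set.insert_subset_insert h4), fun h => ht (Set.singleton_subset_iff.2 (h4 h))⟩
  · rintro ⟨hx, h⟩
    obtain ⟨C, hC, hmax⟩ := exists_maximal_coset hx
    obtain ⟨w, hw⟩ := C.nonempty
    refine ⟨w, cosetType cs.simple (C : Set W), isSpherical_cosetType cs C, Set.subset_univ _,
      fun h' => (h C hC).2 (h' rfl), ?_, hx, fun D hD => ?_⟩
    · rw [ruin_eq]
      rintro y ⟨hy, hy'⟩
      refine ⟨hy, fun D hD => (h C hC).1.mono (Set.insert_subset_insert ?_)⟩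
      exact cosetType_subset_of_subset cs (hy' D hD)
    · exact Set.Subset.trans (hmax D hD) (subset_smul_parabolic cs hw subset_rfl)

theorem coe_cosetOf_empty (g : W) :
    ((cosetOf cs.simple (isSpherical_empty cs) g : SphericalCoset cs.simple) : Set W) = {g} := by
  simp [cosetOf, parabolic]

theorem vertex_eq (g : W) :
    vertex cs.simple g = pointOf (cosetOf cs.simple (isSpherical_empty cs) g) := by
  classical
  funext C
  have : (C : Set W) = {g} ↔ C = cosetOf cs.simple (isSpherical_empty cs) g := by
    rw [← coe_cosetOf_empty cs g, Subtype.ext_iff]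
  by_cases h : C = cosetOf cs.simple (isSpherical_empty cs) g
  · have h1 : vertex cs.simple g C = 1 :=
      Set.indicator_of_mem (s := {C : SphericalCoset cs.simple | (C : Set W) = {g}}) (this.2 h) _
    rw [h1, h]
    simp [pointOf]
  · have h1 : vertex cs.simple g C = 0 :=
      Set.indicator_of_notMem (s := {C : SphericalCoset cs.simple | (C : Set W) = {g}})
        (fun h' => h (this.1 h')) _
    rw [h1]
    simp [pointOf, h]

theorem isBoundaryCoset_cosetOf_empty (g : W) :
    IsBoundaryCoset cs t (cosetOf cs.simple (isSpherical_empty cs) g) := by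
  have h3 : cosetType cs.simple
      ((cosetOf cs.simple (isSpherical_empty cs) g : SphericalCoset cs.simple) : Set W) = ∅ :=
    cosetType_smul cs g ∅
  rw [IsBoundaryCoset, IsRuinCoset, h3]
  exact ⟨by simpa using isSpherical_singleton cs t, by simp⟩

theorem vertex_mem_ruinBoundary (g : W) :
    vertex cs.simple g ∈ ruinBoundary cs.simple Set.univ {t} := by
  rw [vertex_eq, ruinBoundary_eq]
  exact pointOf_mem_supportedIn (isBoundaryCoset_cosetOf_empty cs t g)

theorem ruinBoundary_subset_ruin :
    ruinBoundary cs.simple Set.univ {t} ⊆ ruin cs.simple Set.univ {t} := by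
  rw [ruin_eq, ruinBoundary_eq]
  exact fun x hx => ⟨hx.1, fun C hC => (hx.2 C hC).1⟩

/-- Joining a point to a vertex of its carrier's cosets. -/
theorem joinedIn_vertex {p : SphericalCoset cs.simple → Prop} {x : SphericalCoset cs.simple → ℝ}
    (hx : x ∈ supportedIn p) {g : W} (hg : ∀ C, x C ≠ 0 → g ∈ (C : Set W))
    (hp : p (cosetOf cs.simple (isSpherical_empty cs) g)) :
    JoinedIn (supportedIn p) x (vertex cs.simple g) := by
  rw [vertex_eq]
  refine joinedIn_pointOf hx hp fun C hC => Or.inr ?_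
  change ((cosetOf cs.simple (isSpherical_empty cs) g : SphericalCoset cs.simple) : Set W) ⊆ C
  rw [coe_cosetOf_empty]
  exact Set.singleton_subset_iff.2 (hg C hC)

/-- The two vertices of an edge are joined by this edge. -/
theorem joinedIn_edge {p : SphericalCoset cs.simple → Prop} (g : W) (i : B)
    (hp : p (cosetOf cs.simple (isSpherical_singleton cs i) g))
    (hp' : ∀ h, p (cosetOf cs.simple (isSpherical_empty cs) h)) :
    JoinedIn (supportedIn p) (vertex cs.simple g) (vertex cs.simple (g * cs.simple i)) := by
  have h1 : ∀ h ∈ g • (parabolic cs.simple {i} : Set W), JoinedIn (supportedIn p)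
      (pointOf (cosetOf cs.simple (isSpherical_singleton cs i) g)) (vertex cs.simple h) := by
    intro h hh
    refine joinedIn_vertex cs (pointOf_mem_supportedIn hp) (fun C hC => ?_) (hp' h)
    rw [pointOf_ne_zero.1 hC]
    exact hh
  refine (h1 g (self_mem_smul_parabolic _ _ _)).symm.trans (h1 _ ?_)
  rw [mem_smul_parabolic, inv_mul_cancel_left]
  exact simple_mem_parabolic cs rfl

/-- If all cosets of a subcomplex lie in cosets of a subgroup `H`, then so do its path
components. -/
theorem subset_smul_of_joinedIn {p : SphericalCoset cs.simple → Prop} (H : Subgroup W)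
    (hp : ∀ C, p C → ∃ g : W, (C : Set W) ⊆ g • (H : Set W))
    {x y : SphericalCoset cs.simple → ℝ} (hxy : JoinedIn (supportedIn p) x y) {g : W}
    {C : SphericalCoset cs.simple} (hC : x C ≠ 0) (hCg : (C : Set W) ⊆ g • (H : Set W))
    {D : SphericalCoset cs.simple} (hD : y D ≠ 0) : (D : Set W) ⊆ g • (H : Set W) := by
  have hup : ∀ C D : SphericalCoset cs.simple, p D → C ≤ D → (C : Set W) ⊆ g • (H : Set W) →
      (D : Set W) ⊆ g • (H : Set W) := by
    intro C D hD hCD hC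
    obtain ⟨h, hh⟩ := hp D hD
    obtain ⟨w, hw⟩ := C.nonempty
    have h1 := hC hw
    have h2 := hh (hCD hw)
    rw [Set.mem_smul_set_iff_inv_smul_mem] at h1 h2
    intro k hk
    have h3 := hh hk
    rw [Set.mem_smul_set_iff_inv_smul_mem] at h3 ⊢
    have := H.mul_mem (H.mul_mem h1 (H.inv_mem h2)) h3
    simpa [mul_assoc] using this
  have hall : ∀ z ∈ supportedIn p, ∀ C D, z C ≠ 0 → z D ≠ 0 → (C : Set W) ⊆ g • (H : Set W) →
      (D : Set W) ⊆ g • (H : Set W) := by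
    intro z hz C D hC hD hCg
    rcases realization_chain hz.1 hC hD with h | h
    · exact hup C D (hz.2 D hD) h hCg
    · exact (show (D : Set W) ⊆ C from h).trans hCg
  obtain ⟨γ, hγ⟩ := hxy
  have hopen : ∀ q : SphericalCoset cs.simple → Prop,
      IsOpen {r : unitInterval | ∃ C, γ r C ≠ 0 ∧ q C} := by
    intro q
    have : {r : unitInterval | ∃ C, γ r C ≠ 0 ∧ q C} = ⋃ (C) (_ : q C), {r | γ r C ≠ 0} := by
      ext r
      simp [and_comm]
    rw [this]
    refine isOpen_iUnion fun C => isOpen_iUnion fun _ => ?_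
    exact isOpen_ne_fun ((continuous_apply C).comp γ.continuous) continuous_const
  -- Nonvanishing of a coordinate is open, and all cosets of one carrier lie in the same coset of
  -- `H`; so the times at which the carrier lies in `g H` form a clopen subset of the interval.
  have hclopen : IsClopen {r : unitInterval | ∃ C, γ r C ≠ 0 ∧ (C : Set W) ⊆ g • (H : Set W)} := by
    refine ⟨?_, hopen _⟩
    rw [← isOpen_compl_iff]
    convert hopen (fun C => ¬ (C : Set W) ⊆ g • (H : Set W)) using 1
    ext r
    constructor
    · intro hr
      obtain ⟨C, hC, -⟩ := exists_minimal_coset (hγ r).1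
      exact ⟨C, hC, fun h => hr ⟨C, hC, h⟩⟩
    · rintro ⟨C, hC, h⟩ ⟨D, hD, h'⟩
      exact h (hall _ (hγ r) D C hD hC h')
  have huniv := hclopen.eq_univ ⟨0, C, by rwa [γ.source], hCg⟩
  obtain ⟨E, hE, hEg⟩ : (1 : unitInterval) ∈
      {r : unitInterval | ∃ C, γ r C ≠ 0 ∧ (C : Set W) ⊆ g • (H : Set W)} := by
    rw [huniv]; trivial
  rw [γ.target] at hE
  have hy : y ∈ supportedIn p := by
    have := hγ 1
    rwa [γ.target] at this
  exact hall y hy E D hE hD hEg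

theorem cosetType_subset_starSet (hM : IsEvenMatrix M) {C : SphericalCoset cs.simple}
    (h : IsRuinCoset cs t C) : cosetType cs.simple (C : Set W) ⊆ starSet M t :=
  (Set.subset_insert _ _).trans (subset_starSet_of_isSpherical cs hM h (Set.mem_insert _ _))

theorem joinedIn_vertex_mem {p : SphericalCoset cs.simple → Prop} {V : Set B}
    (hp : ∀ C, p C → cosetType cs.simple (C : Set W) ⊆ V) {g h : W}
    (hj : JoinedIn (supportedIn p) (vertex cs.simple g) (vertex cs.simple h)) :
    g⁻¹ * h ∈ parabolic cs.simple V := by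
  rw [vertex_eq, vertex_eq] at hj
  have := subset_smul_of_joinedIn cs (parabolic cs.simple V) (fun C hC => by
    obtain ⟨w, hw⟩ := C.nonempty
    exact ⟨w, subset_smul_parabolic cs hw (hp C hC)⟩) hj (g := g) (pointOf_ne_zero.2 rfl) (by
      rw [coe_cosetOf_empty]
      exact Set.singleton_subset_iff.2 (self_mem_smul_parabolic _ _ _)) (pointOf_ne_zero.2 rfl)
  rw [coe_cosetOf_empty, Set.singleton_subset_iff, mem_smul_parabolic] at this
  exact this

theorem mem_of_vertex_mem_omega (hM : IsEvenMatrix M) {w : W}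
    (h : vertex cs.simple w ∈ omega cs t) : w ∈ parabolic cs.simple (starSet M t) := by
  have h : JoinedIn (ruin cs.simple Set.univ {t}) (vertex cs.simple 1) (vertex cs.simple w) := h
  rw [ruin_eq] at h
  simpa using joinedIn_vertex_mem cs (fun C => cosetType_subset_starSet cs t hM) h

/-- A path in the boundary of the ruin that starts in `Ω` never leaves the path component `Ω`. -/
theorem joinedIn_omegaBoundary {x y : SphericalCoset cs.simple → ℝ} (hx : x ∈ omega cs t)
    (h : JoinedIn (ruinBoundary cs.simple Set.univ {t}) x y) :
    JoinedIn (omegaBoundary cs t) x y := by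
  obtain ⟨γ, hγ⟩ := h
  refine ⟨γ, fun r => ⟨?_, hγ r⟩⟩
  have hx' : JoinedIn (ruin cs.simple Set.univ {t}) (vertex cs.simple 1) x := hx
  refine hx'.trans ?_
  have h1 : JoinedIn (Set.range γ) x (γ r) := by
    have : PathConnectedSpace unitInterval := isPathConnected_iff_pathConnectedSpace.1
      ((convex_Icc (0 : ℝ) 1).isPathConnected ⟨0, by simp⟩)
    have := (isPathConnected_range γ.continuous).joinedIn x ⟨0, γ.source⟩ (γ r) ⟨r, rfl⟩
    exact this
  exact h1.mono (Set.range_subset_iff.2 fun r => ruinBoundary_subset_ruin cs t (hγ r))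

theorem isBoundaryCoset_cosetOf_singleton {i : B} (hi : i ∈ starSet M t \ {t}) (g : W) :
    IsBoundaryCoset cs t (cosetOf cs.simple (isSpherical_singleton cs i) g) := by
  have h3 : cosetType cs.simple
      ((cosetOf cs.simple (isSpherical_singleton cs i) g : SphericalCoset cs.simple) : Set W) = {i} :=
    cosetType_smul cs g {i}
  rw [IsBoundaryCoset, IsRuinCoset, h3]
  refine ⟨?_, fun h => hi.2 h.symm⟩
  rw [Set.pair_comm]
  exact isSpherical_pair cs hi.1

variable {t}

/-- Edges of type `i ∈ U - t` lie in the boundary. With `inv_mul_mem_of_vertex_mem_component`, the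
vertices of a component form exactly one coset of `W_{U-t}`. -/
theorem vertex_mul_mem_component {Z : Set (SphericalCoset cs.simple → ℝ)}
    (hZ : IsBoundaryComponent cs t Z) {w u : W} (hw : vertex cs.simple w ∈ Z)
    (hu : u ∈ parabolic cs.simple (starSet M t \ {t})) : vertex cs.simple (w * u) ∈ Z := by
  obtain ⟨x, hx, rfl⟩ := hZ
  induction hu using parabolic_induction generalizing w with
  | one => rwa [mul_one]
  | mul i hi u hu ih =>
    rw [← mul_assoc]
    apply ih
    have hw' : JoinedIn (omegaBoundary cs t) x (vertex cs.simple w) := hw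
    refine hw'.trans (joinedIn_omegaBoundary cs t hw'.target_mem.1 ?_)
    rw [ruinBoundary_eq]
    exact joinedIn_edge cs w i (isBoundaryCoset_cosetOf_singleton cs t hi w)
      (isBoundaryCoset_cosetOf_empty cs t)

theorem inv_mul_mem_of_vertex_mem_component (hM : IsEvenMatrix M)
    {Z : Set (SphericalCoset cs.simple → ℝ)} (hZ : IsBoundaryComponent cs t Z) {w w' : W}
    (hw : vertex cs.simple w ∈ Z) (hw' : vertex cs.simple w' ∈ Z) :
    w⁻¹ * w' ∈ parabolic cs.simple (starSet M t \ {t}) := by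
  obtain ⟨x, hx, rfl⟩ := hZ
  have h1 : JoinedIn (omegaBoundary cs t) x (vertex cs.simple w) := hw
  have h2 : JoinedIn (omegaBoundary cs t) x (vertex cs.simple w') := hw'
  have h3 := (h1.symm.trans h2).mono Set.inter_subset_right
  rw [ruinBoundary_eq] at h3
  refine joinedIn_vertex_mem cs (fun C hC i hi => ?_) h3
  refine ⟨cosetType_subset_starSet cs t hM hC.1 hi, ?_⟩
  rintro rfl
  exact hC.2 hi

theorem IsBoundaryComponent.eq {Z Z' : Set (SphericalCoset cs.simple → ℝ)}
    (hZ : IsBoundaryComponent cs t Z) (hZ' : IsBoundaryComponent cs t Z')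
    {y : SphericalCoset cs.simple → ℝ} (hy : y ∈ Z) (hy' : y ∈ Z') : Z = Z' := by
  obtain ⟨x, hx, rfl⟩ := hZ
  obtain ⟨x', hx', rfl⟩ := hZ'
  have h1 : JoinedIn (omegaBoundary cs t) x y := hy
  have h2 : JoinedIn (omegaBoundary cs t) x' y := hy'
  ext z
  constructor
  · exact fun hz => (h2.trans h1.symm).trans hz
  · exact fun hz => (h1.trans h2.symm).trans hz

theorem vertex_mem_omega_of_mem_component {Z : Set (SphericalCoset cs.simple → ℝ)}
    (hZ : IsBoundaryComponent cs t Z) {y : SphericalCoset cs.simple → ℝ} (hy : y ∈ Z) :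
    y ∈ omega cs t := by
  obtain ⟨x, hx, rfl⟩ := hZ
  exact (show JoinedIn _ _ _ from hy).target_mem.1

theorem exists_component_of_vertex_mem_omega {w : W} (h : vertex cs.simple w ∈ omega cs t) :
    ∃ Z, IsBoundaryComponent cs t Z ∧ vertex cs.simple w ∈ Z := by
  have h1 : vertex cs.simple w ∈ omegaBoundary cs t := ⟨h, vertex_mem_ruinBoundary cs t w⟩
  exact ⟨_, ⟨_, h1, rfl⟩, mem_pathComponentIn_self h1⟩

theorem vertex_mul_simple_mem_omega {w : W} (h : vertex cs.simple w ∈ omega cs t) :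
    vertex cs.simple (w * cs.simple t) ∈ omega cs t := by
  have h : JoinedIn (ruin cs.simple Set.univ {t}) (vertex cs.simple 1) (vertex cs.simple w) := h
  refine h.trans ?_
  rw [ruin_eq]
  refine joinedIn_edge cs w t ?_ fun g => (isBoundaryCoset_cosetOf_empty cs t g).1
  have h3 : cosetType cs.simple
      ((cosetOf cs.simple (isSpherical_singleton cs t) w : SphericalCoset cs.simple) : Set W) = {t} :=
    cosetType_smul cs w {t}
  rw [IsRuinCoset, h3, Set.pair_eq_singleton]
  exact isSpherical_singleton cs t

end Ruin

/-! ### Boundary collars and their inner boundaries -/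

section Collar

variable {B W : Type*} [Group W] {M : CoxeterMatrix B} (cs : CoxeterSystem M W)

theorem leftMul_leftMul_inv (g : W) (C : SphericalCoset cs.simple) :
    leftMul cs.simple g (leftMul cs.simple g⁻¹ C) = C :=
  Subtype.ext (smul_inv_smul g (C : Set W))

/-- Left multiplication is an order embedding. -/
def leftMulEmbedding (g : W) : SphericalCoset cs.simple ↪o SphericalCoset cs.simple where
  toFun := leftMul cs.simple g
  inj' C D h := Subtype.ext (smul_left_cancel g (congrArg Subtype.val h))
  map_rel_iff' {C D} := by
    change g • (C : Set W) ⊆ g • (D : Set W) ↔ (C : Set W) ⊆ D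
    exact Set.smul_set_subset_smul_set_iff

variable {t : B}

/-- Lying in the path component is automatic: a point whose carrier contains the identity is joined
to the vertex `e` by a segment. -/
theorem chamberU_eq : chamberU cs t =
    {x ∈ supportedIn (IsRuinCoset cs t) | ∀ C, x C ≠ 0 → (1 : W) ∈ (C : Set W)} := by
  ext x
  constructor
  · rintro ⟨⟨-, hK⟩, hx⟩
    have h1 : x ∈ ruin cs.simple Set.univ {t} := pathComponentIn_subset hx
    rw [ruin_eq] at h1
    refine ⟨h1, fun C hC => ?_⟩
    obtain ⟨T, hT, h⟩ := hK C hC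
    rw [h]
    exact one_mem _
  · rintro ⟨hx, h⟩
    refine ⟨⟨hx.1, fun C hC => ?_⟩, ?_⟩
    · refine ⟨_, isSpherical_cosetType cs C, ?_⟩
      have := C.eq_smul_cosetType cs (h C hC)
      rwa [one_smul] at this
    · change JoinedIn _ _ _
      rw [ruin_eq]
      exact (joinedIn_vertex cs hx h (isBoundaryCoset_cosetOf_empty cs t 1).1).symm

theorem cosetType_leftMul (g : W) (C : SphericalCoset cs.simple) :
    cosetType cs.simple (leftMul cs.simple g C : Set W) = cosetType cs.simple (C : Set W) := by
  obtain ⟨h, T, hT, hC⟩ := C.exists_eq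
  have : (leftMul cs.simple g C : Set W) = (g * h) • (parabolic cs.simple T : Set W) := by
    change g • (C : Set W) = _
    rw [hC, smul_smul]
  rw [this, hC, cosetType_smul, cosetType_smul]

theorem mem_translate_chamberU {w : W} {x : SphericalCoset cs.simple → ℝ} :
    x ∈ translate cs.simple w (chamberU cs t) ↔
      x ∈ realization (orderComplex (SphericalCoset cs.simple)) ∧
      ∀ C, x C ≠ 0 → w ∈ (C : Set W) ∧ IsRuinCoset cs t C := by
  have h0 : (fun C => x (leftMul cs.simple w C)) ∈
      realization (orderComplex (SphericalCoset cs.simple)) ↔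
      x ∈ realization (orderComplex (SphericalCoset cs.simple)) :=
    comp_mem_realization_iff (leftMulEmbedding cs w)
      fun C _ => ⟨leftMul cs.simple w⁻¹ C, leftMul_leftMul_inv cs w C⟩
  have hmem : ∀ C : SphericalCoset cs.simple, (1 : W) ∈ (C : Set W) ↔
      w ∈ (leftMul cs.simple w C : Set W) := by
    intro C
    change _ ↔ w ∈ w • (C : Set W)
    rw [Set.mem_smul_set_iff_inv_smul_mem, smul_eq_mul, inv_mul_cancel]
  change (fun C => x (leftMul cs.simple w C)) ∈ chamberU cs t ↔ _
  rw [chamberU_eq]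
  constructor
  · rintro ⟨⟨h1, h2⟩, h3⟩
    refine ⟨h0.1 h1, fun C hC => ?_⟩
    rw [← leftMul_leftMul_inv cs w C] at hC ⊢
    refine ⟨(hmem _).1 (h3 _ hC), ?_⟩
    have := h2 _ hC
    rwa [IsRuinCoset, ← cosetType_leftMul cs w] at this
  · rintro ⟨h1, h2⟩
    refine ⟨⟨h0.2 h1, fun C hC => ?_⟩, fun C hC => (hmem C).2 (h2 _ hC).1⟩
    have := (h2 _ hC).2
    rwa [IsRuinCoset, cosetType_leftMul cs w] at this

theorem mem_boundaryCollar {Z : Set (SphericalCoset cs.simple → ℝ)}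
    {x : SphericalCoset cs.simple → ℝ} : x ∈ boundaryCollar cs t Z ↔
      x ∈ realization (orderComplex (SphericalCoset cs.simple)) ∧
      ∃ w, vertex cs.simple w ∈ Z ∧ ∀ C, x C ≠ 0 → w ∈ (C : Set W) ∧ IsRuinCoset cs t C := by
  constructor
  · rintro ⟨w, hw, h⟩
    rw [mem_translate_chamberU] at h
    exact ⟨h.1, w, hw, h.2⟩
  · rintro ⟨hx, w, hw, h⟩
    exact ⟨w, hw, (mem_translate_chamberU cs).2 ⟨hx, h⟩⟩

theorem isRuinCoset_of_mem {C : SphericalCoset cs.simple}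
    (h : t ∈ cosetType cs.simple (C : Set W)) : IsRuinCoset cs t C := by
  rw [IsRuinCoset, Set.insert_eq_of_mem h]
  exact isSpherical_cosetType cs C

theorem mem_innerBoundary {Z : Set (SphericalCoset cs.simple → ℝ)}
    {x : SphericalCoset cs.simple → ℝ} : x ∈ innerBoundary cs t Z ↔
      x ∈ realization (orderComplex (SphericalCoset cs.simple)) ∧
      ∃ w, vertex cs.simple w ∈ Z ∧
        ∀ C, x C ≠ 0 → w ∈ (C : Set W) ∧ t ∈ cosetType cs.simple (C : Set W) := by
  constructor
  · rintro ⟨h1, h2⟩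
    obtain ⟨hx, w, hw, h⟩ := (mem_boundaryCollar cs).1 h1
    refine ⟨hx, w, hw, fun C hC => ⟨(h C hC).1, ?_⟩⟩
    obtain ⟨g, T, hT, ht, hCg⟩ := h2 C hC
    rwa [hCg, cosetType_smul]
  · rintro ⟨hx, w, hw, h⟩
    refine ⟨(mem_boundaryCollar cs).2 ⟨hx, w, hw, fun C hC =>
      ⟨(h C hC).1, isRuinCoset_of_mem cs (h C hC).2⟩⟩, fun C hC => ?_⟩
    exact ⟨w, _, isSpherical_cosetType cs C, (h C hC).2, C.eq_smul_cosetType cs (h C hC).1⟩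

end Collar

/-! ### Colors -/

section ColorLemmas

variable {B W : Type*} [Group W] {M : CoxeterMatrix B} (cs : CoxeterSystem M W)
  (hM : IsEvenMatrix M)

theorem retractHom_mem {V V' T T' : Set B} (h : ∀ i ∈ V', i ∈ T → i ∈ T')
    {u : parabolic cs.simple V} (hu : (u : W) ∈ parabolic cs.simple V') :
    (retractHom cs hM V T u : W) ∈ parabolic cs.simple T' := by
  have key : ∀ u ∈ parabolic cs.simple V',
      (cs.lift ⟨retractGen cs T, isLiftable_retractGen cs hM T⟩ u : W) ∈ parabolic cs.simple T' := by
    intro u hu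
    induction hu using parabolic_induction with
    | one => rw [map_one]; exact one_mem _
    | mul i hi u _ ih =>
      rw [map_mul, Subgroup.coe_mul]
      refine mul_mem ?_ ih
      rw [cs.lift_apply_simple (isLiftable_retractGen cs hM T), retractGen]
      split_ifs with hiT
      · exact simple_mem_parabolic cs (h i hi hiT)
      · exact one_mem _
  exact key u hu

theorem retractHom_eq_self {V T : Set B} {u : parabolic cs.simple V}
    (hu : (u : W) ∈ parabolic cs.simple T) : (retractHom cs hM V T u : W) = u := by
  have key : ∀ u ∈ parabolic cs.simple T,
      (cs.lift ⟨retractGen cs T, isLiftable_retractGen cs hM T⟩ u : W) = u := by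
    intro u hu
    induction hu using parabolic_induction with
    | one => rw [map_one]; rfl
    | mul i hi u _ ih =>
      rw [map_mul, Subgroup.coe_mul, ih, cs.lift_apply_simple (isLiftable_retractGen cs hM T),
        retractGen, dif_pos hi]
  exact key u hu

variable {t : B}

theorem color_eq_iff {w w' : parabolic cs.simple (starSet M t)} :
    color cs t hM w = color cs t hM w' ↔ ∀ T, IsSpherical cs.simple T → t ∈ T →
      (retractHom cs hM (starSet M t) T (w⁻¹ * w') : W) ∈ parabolic cs.simple (T \ {t}) := by
  have h : ∀ T : {T : Set B // IsSpherical cs.simple T ∧ t ∈ T},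
      color cs t hM w T = color cs t hM w' T ↔
      (retractHom cs hM (starSet M t) T (w⁻¹ * w') : W) ∈
        parabolic cs.simple ((T : Set B) \ {t}) := by
    intro T
    unfold color
    rw [MulAction.Quotient.smul_mk, MulAction.Quotient.smul_mk, smul_eq_mul, smul_eq_mul, mul_one,
      mul_one, QuotientGroup.eq, Subgroup.mem_subgroupOf, map_mul, map_inv]
  rw [funext_iff]
  constructor
  · exact fun H T hT ht => (h ⟨T, hT, ht⟩).1 (H ⟨T, hT, ht⟩)
  · exact fun H T => (h T).2 (H T T.2.1 T.2.2)

/-- Each retraction to `W_T` sends `W_{U-t}` into `W_{T-t}`, so the color is constant on components.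
-/
theorem color_eq_of_mem {w w' : parabolic cs.simple (starSet M t)}
    (h : ((w⁻¹ * w' : parabolic cs.simple (starSet M t)) : W) ∈
      parabolic cs.simple (starSet M t \ {t})) : color cs t hM w = color cs t hM w' := by
  rw [color_eq_iff]
  intro T _ _
  refine retractHom_mem cs hM (V' := starSet M t \ {t}) (T' := T \ {t}) ?_ h
  exact fun i hi hiT => ⟨hiT, hi.2⟩

/-- The retraction to `W_T` is the identity on `W_T`, so the `T`-component of the color separates
the cosets of `W_{T-t}` in `W_T`. -/
theorem mem_of_color_eq {w w' : parabolic cs.simple (starSet M t)}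
    (h : color cs t hM w = color cs t hM w') {T : Set B} (hT : IsSpherical cs.simple T)
    (ht : t ∈ T) (hww' : ((w⁻¹ * w' : parabolic cs.simple (starSet M t)) : W) ∈
      parabolic cs.simple T) : (w : W)⁻¹ * w' ∈ parabolic cs.simple (T \ {t}) := by
  have := (color_eq_iff cs hM).1 h T hT ht
  rwa [retractHom_eq_self cs hM hww'] at this

/-- The component at `T = {t}` is taken modulo the trivial group, so the color determines the
parity. -/
theorem retractHom_singleton_eq {w w' : parabolic cs.simple (starSet M t)}
    (h : color cs t hM w = color cs t hM w') :
    (retractHom cs hM (starSet M t) {t} w : W) = retractHom cs hM (starSet M t) {t} w' := by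
  have := (color_eq_iff cs hM).1 h {t} (isSpherical_singleton cs t) rfl
  rw [Set.sdiff_self, map_mul, map_inv] at this
  simp only [parabolic, Set.image_empty, Subgroup.closure_empty, Subgroup.mem_bot] at this
  have h2 : (retractHom cs hM (starSet M t) {t} w)⁻¹ * retractHom cs hM (starSet M t) {t} w' = 1 :=
    Subtype.ext this
  rw [inv_mul_eq_one] at h2
  rw [h2]

theorem simple_ne_one (i : B) : cs.simple i ≠ 1 := by
  intro h
  have := cs.length_simple i
  rw [h, cs.length_one] at this
  exact zero_ne_one this

theorem not_isOddColor_of_isEvenColor {a : Color cs t} (h : IsEvenColor cs t hM a) :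
    ¬ IsOddColor cs t hM a := by
  rintro ⟨w', hw', h2⟩
  obtain ⟨w, hw, h1⟩ := h
  have := retractHom_singleton_eq cs hM (hw.trans hw'.symm)
  rw [h1, h2] at this
  exact simple_ne_one cs t this.symm

theorem color_of_mem_component {a : Color cs t} {Z : Set (SphericalCoset cs.simple → ℝ)}
    (hZ : Z ∈ ComponentOfColor cs t hM a) {w : W} (hw : vertex cs.simple w ∈ Z) :
    ∃ h : w ∈ parabolic cs.simple (starSet M t), color cs t hM ⟨w, h⟩ = a := by
  obtain ⟨hZ, w', hw', h⟩ := hZ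
  refine ⟨mem_of_vertex_mem_omega cs t hM (vertex_mem_omega_of_mem_component cs hZ hw), ?_⟩
  rw [← h]
  apply color_eq_of_mem
  exact inv_mul_mem_of_vertex_mem_component cs hM hZ hw hw'

/-- A coset of the carrier whose type misses `t` would contain both vertices, which would then
differ by an element of `W_{U-t}` and have one color. -/
theorem mem_innerBoundary_of_mem_collars {a a' : Color cs t} (haa' : a ≠ a')
    {Z Z' : Set (SphericalCoset cs.simple → ℝ)} (hZ : Z ∈ ComponentOfColor cs t hM a)
    (hZ' : Z' ∈ ComponentOfColor cs t hM a') {x : SphericalCoset cs.simple → ℝ}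
    (hx : x ∈ boundaryCollar cs t Z) (hx' : x ∈ boundaryCollar cs t Z') :
    x ∈ innerBoundary cs t Z := by
  obtain ⟨hx, w, hw, h⟩ := (mem_boundaryCollar cs).1 hx
  obtain ⟨-, w', hw', h'⟩ := (mem_boundaryCollar cs).1 hx'
  refine (mem_innerBoundary cs).2 ⟨hx, w, hw, fun C hC => ⟨(h C hC).1, ?_⟩⟩
  by_contra ht
  apply haa'
  obtain ⟨hU, rfl⟩ := color_of_mem_component cs hM hZ hw
  obtain ⟨hU', rfl⟩ := color_of_mem_component cs hM hZ' hw'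
  apply color_eq_of_mem
  have h1 := (h' C hC).1
  rw [C.eq_smul_cosetType cs (h C hC).1, mem_smul_parabolic] at h1
  refine parabolic_mono _ (T' := starSet M t \ {t}) (fun i hi => ⟨?_, ?_⟩) h1
  · exact cosetType_subset_starSet cs t hM (h C hC).2 hi
  · rintro rfl
    exact ht hi

/-- The two vertices differ by an element of `W_T` with `T` the type of `C`; equality of colors
improves this to `W_{T-t} ⊆ W_{U-t}`. -/
theorem component_eq_of_mem_coset {a : Color cs t} {Z Z' : Set (SphericalCoset cs.simple → ℝ)}
    (hZ : Z ∈ ComponentOfColor cs t hM a) (hZ' : Z' ∈ ComponentOfColor cs t hM a) {w w' : W}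
    (hw : vertex cs.simple w ∈ Z) (hw' : vertex cs.simple w' ∈ Z') {C : SphericalCoset cs.simple}
    (hC : w ∈ (C : Set W)) (hC' : w' ∈ (C : Set W)) (ht : t ∈ cosetType cs.simple (C : Set W)) :
    Z = Z' := by
  obtain ⟨hU, e⟩ := color_of_mem_component cs hM hZ hw
  obtain ⟨hU', e'⟩ := color_of_mem_component cs hM hZ' hw'
  rw [C.eq_smul_cosetType cs hC, mem_smul_parabolic] at hC'
  have h2 := mem_of_color_eq cs hM (e.trans e'.symm) (isSpherical_cosetType cs C) ht hC'
  have h3 := parabolic_mono cs.simple (Set.sdiff_subset_sdiff_left (t := {t})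
    (cosetType_subset_starSet cs t hM (isRuinCoset_of_mem cs ht))) h2
  have h4 := vertex_mul_mem_component cs hZ.1 hw h3
  rw [mul_inv_cancel_left] at h4
  exact hZ.1.eq cs hZ'.1 h4 hw'

theorem innerBoundary_pairwiseDisjoint (a : Color cs t) :
    (ComponentOfColor cs t hM a).PairwiseDisjoint (innerBoundary cs t) := by
  intro Z hZ Z' hZ' hne
  refine Set.disjoint_left.2 fun x hx hx' => hne ?_
  obtain ⟨hx, w, hw, h⟩ := (mem_innerBoundary cs).1 hx
  obtain ⟨-, w', hw', h'⟩ := (mem_innerBoundary cs).1 hx'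
  obtain ⟨C, hC, -⟩ := exists_minimal_coset hx
  exact component_eq_of_mem_coset cs hM hZ hZ' hw hw' (h C hC).1 (h' C hC).1 (h C hC).2

/-- An odd collar meets the union of the even collars and of other odd collars exactly in its inner
boundary. -/
theorem collar_inter_evenCollarsUnion {o : Color cs t} (ho : IsOddColor cs t hM o)
    {O : Set (Color cs t)} (hoO : o ∉ O) :
    collar cs t hM o ∩ evenCollarsUnion cs t hM O = collarInnerBoundary cs t hM o := by
  ext x
  simp only [collar, evenCollarsUnion, collarInnerBoundary, Set.mem_inter_iff, Set.mem_union,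
    Set.mem_iUnion, exists_prop]
  constructor
  · rintro ⟨⟨Z, hZ, hx⟩, hx'⟩
    obtain ⟨a, ha, Z', hZ', hx'⟩ : ∃ a, o ≠ a ∧ ∃ Z', Z' ∈ ComponentOfColor cs t hM a ∧
        x ∈ boundaryCollar cs t Z' := by
      rcases hx' with ⟨a, ha, h⟩ | ⟨a, ha, h⟩
      · exact ⟨a, fun e => not_isOddColor_of_isEvenColor cs hM ha (e ▸ ho), h⟩
      · exact ⟨a, fun e => hoO (e ▸ ha), h⟩
    exact ⟨Z, hZ, mem_innerBoundary_of_mem_collars cs hM ha hZ hZ' hx hx'⟩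
  · rintro ⟨Z, hZ, hx⟩
    refine ⟨⟨Z, hZ, hx.1⟩, Or.inl ?_⟩
    obtain ⟨hx, w, hw, h⟩ := (mem_innerBoundary cs).1 hx
    -- Crossing the `t`-edge at `w` stays inside every coset of the carrier and turns the odd parity
    -- into the even one.
    have hom := vertex_mul_simple_mem_omega cs (vertex_mem_omega_of_mem_component cs hZ.1 hw)
    obtain ⟨Z', hZ', hwt⟩ := exists_component_of_vertex_mem_omega cs hom
    have hU' := mem_of_vertex_mem_omega cs t hM hom
    refine ⟨color cs t hM ⟨_, hU'⟩, ⟨_, rfl, ?_⟩, Z', ⟨hZ', ⟨_, hU'⟩, hwt, rfl⟩, ?_⟩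
    · obtain ⟨hU, e⟩ := color_of_mem_component cs hM hZ hw
      obtain ⟨w₀, hw₀, h1⟩ := ho
      have htU : t ∈ starSet M t := by
        change M t t ≠ 0
        simp
      have h2 : (⟨w * cs.simple t, hU'⟩ : parabolic cs.simple (starSet M t)) =
          ⟨w, hU⟩ * ⟨cs.simple t, simple_mem_parabolic cs htU⟩ := rfl
      rw [h2, map_mul, Subgroup.coe_mul, retractHom_singleton_eq cs hM (e.trans hw₀.symm), h1,
        retractHom_eq_self cs hM (simple_mem_parabolic cs (Set.mem_singleton t))]
      exact cs.simple_mul_simple_self t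
    · refine (mem_boundaryCollar cs).2 ⟨hx, _, hwt, fun C hC =>
        ⟨?_, isRuinCoset_of_mem cs (h C hC).2⟩⟩
      exact (h C hC).2 w (h C hC).1

end ColorLemmas

/-! ### Inner boundaries are Davis complexes -/

/-- The full subcomplex on the image of an order embedding. -/
noncomputable def rangeHomeomorph {P P' : Type*} [PartialOrder P] [PartialOrder P']
    (φ : P' ↪o P) :
    supportedIn (· ∈ Set.range φ) ≃ₜ realization (orderComplex P') where
  toFun x := ⟨x.1 ∘ φ, (comp_mem_realization_iff φ x.2.2).2 x.2.1⟩
  invFun y := ⟨Function.extend φ y.1 0, by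
    have h : ∀ C, Function.extend φ y.1 0 C ≠ 0 → C ∈ Set.range φ := by
      intro C hC
      by_contra h
      exact hC (Function.extend_apply' _ _ _ h)
    refine ⟨(comp_mem_realization_iff φ h).1 ?_, h⟩
    rw [Function.extend_comp φ.injective]
    exact y.2⟩
  left_inv x := by
    apply Subtype.ext
    funext C
    dsimp only
    by_cases h : C ∈ Set.range φ
    · obtain ⟨C', rfl⟩ := h
      exact φ.injective.extend_apply _ _ _
    · rw [Function.extend_apply' _ _ _ h]
      by_contra h'
      exact h (x.2.2 C (Ne.symm h'))
  right_inv y := Subtype.ext (Function.extend_comp φ.injective _ _)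
  continuous_toFun := by
    refine Continuous.subtype_mk (continuous_pi fun C => ?_) _
    exact (continuous_apply (φ C)).comp continuous_subtype_val
  continuous_invFun := by
    refine Continuous.subtype_mk (continuous_pi fun C => ?_) _
    by_cases h : C ∈ Set.range φ
    · obtain ⟨C', rfl⟩ := h
      simp only [φ.injective.extend_apply]
      exact (continuous_apply C').comp continuous_subtype_val
    · simp only [Function.extend_apply' _ _ _ h]
      exact continuous_const

section Link

variable {B W : Type*} [Group W] {M : CoxeterMatrix B} (cs : CoxeterSystem M W) {V : Set B}
  {M' : CoxeterMatrix V} (cs' : CoxeterSystem M' (parabolic cs.simple V))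
  (hcs' : cs'.simple = subGenerator cs V) {t : B} (htV : t ∉ V)
  (hlink : ∀ T : Set V, IsSpherical cs'.simple T →
    IsSpherical cs.simple (insert t (Subtype.val '' T)))

theorem le_iff_of_mem {B W : Type*} [Group W] {M : CoxeterMatrix B} (cs : CoxeterSystem M W)
    {C D : SphericalCoset cs.simple} {c d : W}
    (hc : c ∈ (C : Set W)) (hd : d ∈ (D : Set W)) : C ≤ D ↔
      d⁻¹ * c ∈ parabolic cs.simple (cosetType cs.simple (D : Set W)) ∧
        cosetType cs.simple (C : Set W) ⊆ cosetType cs.simple (D : Set W) := by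
  rw [← mem_smul_parabolic, ← smul_parabolic_subset_iff, ← C.eq_smul_cosetType cs hc,
    ← D.eq_smul_cosetType cs hd]
  rfl

/-- The coset `g u W_{T ∪ {t}}` associated with the coset `u W_T` of the link. -/
noncomputable def linkCoset (g : W) (C : SphericalCoset cs'.simple) : SphericalCoset cs.simple :=
  cosetOf cs.simple (hlink _ (isSpherical_cosetType cs' C)) (g * (C.nonempty.some : W))

theorem cosetType_linkCoset (g : W) (C : SphericalCoset cs'.simple) :
    cosetType cs.simple (linkCoset cs cs' hlink g C : Set W) =
      insert t (Subtype.val '' cosetType cs'.simple (C : Set _)) :=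
  cosetType_smul cs _ _

theorem some_mem_linkCoset (g : W) (C : SphericalCoset cs'.simple) :
    g * (C.nonempty.some : W) ∈ (linkCoset cs cs' hlink g C : Set W) :=
  self_mem_smul_parabolic cs.simple _ _

-- The identity `W_{T' ∪ t} ∩ W_V = W_{T'}` makes inclusion of the enlarged cosets equivalent to
-- inclusion of the original ones; in particular the chosen representatives are harmless.
include hcs' htV in
theorem linkCoset_le_iff (g : W) (C D : SphericalCoset cs'.simple) :
    linkCoset cs cs' hlink g C ≤ linkCoset cs cs' hlink g D ↔ C ≤ D := by
  rw [le_iff_of_mem cs (some_mem_linkCoset cs cs' hlink g C) (some_mem_linkCoset cs cs' hlink g D),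
    le_iff_of_mem cs' C.nonempty.some_mem D.nonempty.some_mem, cosetType_linkCoset,
    cosetType_linkCoset]
  generalize C.nonempty.some = c
  generalize D.nonempty.some = d
  generalize cosetType cs'.simple (C : Set _) = T
  generalize cosetType cs'.simple (D : Set _) = T'
  have ht : ∀ T : Set V, t ∉ Subtype.val '' T := by
    rintro T ⟨i, -, h⟩
    exact htV (h ▸ i.2)
  have hV : V ∩ insert t (Subtype.val '' T') = Subtype.val '' T' := by
    ext i
    constructor
    · rintro ⟨hi, rfl | h⟩
      · exact absurd hi htV
      · exact h
    · rintro ⟨i, hi, rfl⟩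
      exact ⟨i.2, Or.inr ⟨i, hi, rfl⟩⟩
  have e1 : (g * (d : W))⁻¹ * (g * c) = ((d⁻¹ * c : parabolic cs.simple V) : W) := by
    rw [Subgroup.coe_mul, Subgroup.coe_inv]
    group
  have e2 : ((d⁻¹ * c : parabolic cs.simple V) : W) ∈
      parabolic cs.simple (insert t (Subtype.val '' T')) ↔ d⁻¹ * c ∈ parabolic cs'.simple T' := by
    rw [hcs', mem_parabolic_subGenerator]
    conv_rhs => rw [← hV, ← parabolic_inf, Subgroup.mem_inf]
    exact (and_iff_right (d⁻¹ * c).2).symm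
  have e3 : insert t (Subtype.val '' T) ⊆ insert t (Subtype.val '' T') ↔ T ⊆ T' := by
    rw [Set.insert_subset_insert_iff (ht T), Set.image_subset_image_iff Subtype.val_injective]
  rw [e1, e2, e3]

/-- The order embedding of the spherical cosets of the link. -/
noncomputable def linkEmbedding (g : W) : SphericalCoset cs'.simple ↪o SphericalCoset cs.simple :=
  OrderEmbedding.ofMapLEIff (linkCoset cs cs' hlink g) (linkCoset_le_iff cs cs' hcs' htV hlink g)

/-- A spherical type containing `t` lies in `V ∪ {t}`, so intersecting it with `V` only removes `t`,
and linking back restores the coset. -/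
theorem mem_range_linkEmbedding (hsub : ∀ T, IsSpherical cs.simple T → t ∈ T → T ⊆ insert t V)
    (g : W) (C : SphericalCoset cs.simple) :
    C ∈ Set.range (linkEmbedding cs cs' hcs' htV hlink g) ↔
      t ∈ cosetType cs.simple (C : Set W) ∧
        ∃ u ∈ parabolic cs.simple V, g * u ∈ (C : Set W) := by
  constructor
  · rintro ⟨D, rfl⟩
    refine ⟨?_, D.nonempty.some, D.nonempty.some.2, some_mem_linkCoset cs cs' hlink g D⟩
    change t ∈ cosetType cs.simple (linkCoset cs cs' hlink g D : Set W)
    rw [cosetType_linkCoset]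
    exact Set.mem_insert _ _
  · rintro ⟨ht, u, hu, huC⟩
    have hC := isSpherical_cosetType cs C
    set T : Set V := Subtype.val ⁻¹' cosetType cs.simple (C : Set W) with hT
    have hTC : insert t (Subtype.val '' T) = cosetType cs.simple (C : Set W) := by
      ext i
      constructor
      · rintro (rfl | ⟨i, hi, rfl⟩)
        · exact ht
        · exact hi
      · intro hi
        rcases hsub _ hC ht hi with rfl | h
        · exact Or.inl rfl
        · exact Or.inr ⟨⟨i, h⟩, hi, rfl⟩
    have hTs : IsSpherical cs'.simple T := by
      rw [hcs', isSpherical_subGenerator]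
      exact hC.mono (Set.image_subset_iff.2 subset_rfl)
    let D : SphericalCoset cs'.simple := cosetOf cs'.simple hTs ⟨u, hu⟩
    have hDT : cosetType cs'.simple (D : Set _) = T := cosetType_smul cs' _ _
    refine ⟨D, ?_⟩
    change linkCoset cs cs' hlink g D = C
    have h1 := some_mem_linkCoset cs cs' hlink g D
    have h2 : cosetType cs.simple (linkCoset cs cs' hlink g D : Set W) =
        cosetType cs.simple (C : Set W) := by
      rw [cosetType_linkCoset, hDT, hTC]
    have h3 : g * (D.nonempty.some : W) ∈ (C : Set W) := by
      have h4 : D.nonempty.some ∈ (D : Set _) := D.nonempty.some_mem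
      have h6 : ∀ w : parabolic cs.simple V, w ∈ parabolic cs'.simple T →
          (w : W) ∈ parabolic cs.simple (Subtype.val '' T) := by
        intro w hw
        rwa [hcs', mem_parabolic_subGenerator] at hw
      have h5 := h6 _ ((mem_smul_parabolic cs'.simple).1 h4)
      rw [C.eq_smul_cosetType cs huC, mem_smul_parabolic]
      refine parabolic_mono _ (Set.image_subset_iff.2 (subset_refl T)) ?_
      convert h5 using 1
      rw [Subgroup.coe_mul, Subgroup.coe_inv]
      group
    exact le_antisymm (le_of_cosetType_subset cs h1 h3 h2.subset)
      (le_of_cosetType_subset cs h3 h1 h2.superset)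

end Link

/-! ### Disjoint unions and manifolds. -/

section Final

variable {B W : Type*} [Finite B] [Group W] {M : CoxeterMatrix B} (cs : CoxeterSystem M W)
  (hM : IsEvenMatrix M) {t : B}

/-- Needed for second countability of subspaces of the product of real lines over the cosets. -/
theorem countable_sphericalCoset : Countable (SphericalCoset cs.simple) := by
  have : Countable W := cs.wordProd_surjective.countable
  have hinj : Function.Injective (fun C : SphericalCoset cs.simple =>
      (C.nonempty.some, cosetType cs.simple (C : Set W))) := by
    intro C D h
    have h1 : C.nonempty.some = D.nonempty.some := congrArg Prod.fst h
    have h2 : cosetType cs.simple (C : Set W) = cosetType cs.simple (D : Set W) :=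
      congrArg Prod.snd h
    have h3 := C.nonempty.some_mem
    rw [h1] at h3
    exact le_antisymm (le_of_cosetType_subset cs h3 D.nonempty.some_mem h2.subset)
      (le_of_cosetType_subset cs D.nonempty.some_mem h3 h2.superset)
  exact hinj.countable

/-- In the flag case, the inner boundary of a boundary collar is a copy of the Davis complex of
`(W_{U-t}, U-t)`. -/
theorem nonempty_innerBoundary_homeomorph (hF : IsFlag (nerve cs.simple)) {a : Color cs t}
    {Z : Set (SphericalCoset cs.simple → ℝ)} (hZ : Z ∈ ComponentOfColor cs t hM a) :
    Nonempty (innerBoundary cs t Z ≃ₜ davisComplex (linkGenerator cs t)) := by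
  obtain ⟨cs', hcs'⟩ := exists_coxeterSystem_subGenerator cs hM (starSet M t \ {t})
  have hcs'' : cs'.simple = linkGenerator cs t := hcs'
  rw [← hcs'']
  have htV : t ∉ starSet M t \ {t} := by simp
  have hlink : ∀ T, IsSpherical cs'.simple T →
      IsSpherical cs.simple (insert t (Subtype.val '' T)) := by
    intro T hT
    rw [hcs', isSpherical_subGenerator] at hT
    refine isSpherical_insert_of_isFlag cs hF hT ?_
    rintro _ ⟨i, -, rfl⟩
    exact i.2.1
  have hsub : ∀ T, IsSpherical cs.simple T → t ∈ T → T ⊆ insert t (starSet M t \ {t}) := by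
    intro T hT ht i hi
    by_cases hit : i = t
    · exact Or.inl hit
    · exact Or.inr ⟨subset_starSet_of_isSpherical cs hM hT ht hi, hit⟩
  obtain ⟨hZc, w₀, hw₀, -⟩ := hZ
  have hrange := mem_range_linkEmbedding cs cs' hcs' htV hlink hsub (w₀ : W)
  -- The vertices of `Z` are `w₀ W_{U-t}`. Cosets in the range each meet this set, and a common
  -- element comes from the smallest coset of the carrier.
  have heq : innerBoundary cs t Z =
      supportedIn (· ∈ Set.range (linkEmbedding cs cs' hcs' htV hlink (w₀ : W))) := by
    ext x
    rw [mem_innerBoundary]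
    constructor
    · rintro ⟨hx, w, hw, h⟩
      refine ⟨hx, fun C hC => (hrange C).2 ⟨(h C hC).2, (w₀ : W)⁻¹ * w,
        inv_mul_mem_of_vertex_mem_component cs hM hZc hw₀ hw, ?_⟩⟩
      rw [mul_inv_cancel_left]
      exact (h C hC).1
    · rintro ⟨hx, h⟩
      refine ⟨hx, ?_⟩
      obtain ⟨C, hC, hmin⟩ := exists_minimal_coset hx
      obtain ⟨-, u, hu, huC⟩ := (hrange C).1 (h C hC)
      exact ⟨w₀ * u, vertex_mul_mem_component cs hZc hw₀ hu, fun D hD =>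
        ⟨hmin D hD huC, ((hrange D).1 (h D hD)).1⟩⟩
  rw [heq]
  exact ⟨rangeHomeomorph _⟩

-- A coset whose type contains `t` meets the vertices of at most one component of the given color,
-- so one nonzero coordinate already detects the piece.
omit [Finite B] in
theorem isOpen_innerBoundary {a : Color cs t} {Z : Set (SphericalCoset cs.simple → ℝ)}
    (hZ : Z ∈ ComponentOfColor cs t hM a) :
    IsOpen {x : collarInnerBoundary cs t hM a | x.1 ∈ innerBoundary cs t Z} := by
  have : {x : collarInnerBoundary cs t hM a | x.1 ∈ innerBoundary cs t Z} =
      ⋃ (C : SphericalCoset cs.simple) (_ : ∃ w, vertex cs.simple w ∈ Z ∧ w ∈ (C : Set W)),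
        {x | x.1 C ≠ 0} := by
    ext x
    simp only [Set.mem_iUnion, exists_prop]
    constructor
    · intro hx
      obtain ⟨hx, w, hw, h⟩ := (mem_innerBoundary cs).1 hx
      obtain ⟨C, hC, -⟩ := exists_minimal_coset hx
      exact ⟨C, ⟨w, hw, (h C hC).1⟩, hC⟩
    · rintro ⟨C, ⟨w, hw, hwC⟩, hC⟩
      obtain ⟨Z', hZ', hx⟩ := Set.mem_iUnion₂.1 x.2
      obtain ⟨-, w', hw', h⟩ := (mem_innerBoundary cs).1 hx
      have := component_eq_of_mem_coset cs hM hZ hZ' hw hw' hwC (h C hC).1 (h C hC).2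
      rw [this]
      exact hx
  rw [this]
  refine isOpen_iUnion fun C => isOpen_iUnion fun _ => ?_
  exact isOpen_ne_fun ((continuous_apply C).comp continuous_subtype_val) continuous_const

/-- In the flag case, the inner boundary of a collar is a topological disjoint union of copies of
the Davis complex of `(W_{U-t}, U-t)`. -/
theorem exists_collarInnerBoundary_homeomorph (hF : IsFlag (nerve cs.simple)) (a : Color cs t) :
    ∃ h : collarInnerBoundary cs t hM a ≃ₜ
        (Σ _ : ComponentOfColor cs t hM a, davisComplex (linkGenerator cs t)),
      ∀ (x : collarInnerBoundary cs t hM a) (Z : ComponentOfColor cs t hM a),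
        x.1 ∈ innerBoundary cs t Z.1 ↔ (h x).1 = Z := by
  have e : ∀ Z : ComponentOfColor cs t hM a,
      innerBoundary cs t Z.1 ≃ₜ davisComplex (linkGenerator cs t) := fun Z =>
    (nonempty_innerBoundary_homeomorph cs hM hF Z.2).some
  have hsub : ∀ Z : ComponentOfColor cs t hM a,
      innerBoundary cs t Z.1 ⊆ collarInnerBoundary cs t hM a := fun Z =>
    Set.subset_iUnion₂_of_subset Z.1 Z.2 subset_rfl
  let f : (Σ _ : ComponentOfColor cs t hM a, davisComplex (linkGenerator cs t)) →
      collarInnerBoundary cs t hM a := fun p => Set.inclusion (hsub p.1) ((e p.1).symm p.2)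
  have hfmem : ∀ p, (f p).1 ∈ innerBoundary cs t p.1.1 := fun p => ((e p.1).symm p.2).2
  have huniq : ∀ (Z Z' : ComponentOfColor cs t hM a) (x : SphericalCoset cs.simple → ℝ),
      x ∈ innerBoundary cs t Z.1 → x ∈ innerBoundary cs t Z'.1 → Z = Z' := by
    intro Z Z' x hx hx'
    by_contra hne
    exact Set.disjoint_left.1 (innerBoundary_pairwiseDisjoint cs hM a Z.2 Z'.2
      fun h => hne (Subtype.ext h)) hx hx'
  have hinj : Function.Injective f := by
    rintro ⟨Z, y⟩ ⟨Z', y'⟩ h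
    have h1 := hfmem ⟨Z, y⟩
    rw [h] at h1
    obtain rfl := huniq _ _ _ h1 (hfmem ⟨Z', y'⟩)
    have h2 : y = y' := (e Z).symm.injective (Set.inclusion_injective (hsub Z) h)
    rw [h2]
  have hsurj : Function.Surjective f := by
    intro x
    obtain ⟨Z, hZ, hx⟩ := Set.mem_iUnion₂.1 x.2
    refine ⟨⟨⟨Z, hZ⟩, e ⟨Z, hZ⟩ ⟨x.1, hx⟩⟩, ?_⟩
    apply Subtype.ext
    change ((e ⟨Z, hZ⟩).symm (e ⟨Z, hZ⟩ ⟨x.1, hx⟩)).1 = x.1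
    rw [Homeomorph.symm_apply_apply]
  have hcont : Continuous f := continuous_sigma fun Z =>
    (continuous_inclusion (hsub Z)).comp (e Z).symm.continuous
  have hopen : IsOpenMap f := by
    refine isOpenMap_sigma.2 fun Z => ?_
    have h1 : Topology.IsOpenEmbedding (Set.inclusion (hsub Z)) := by
      refine ⟨Topology.IsEmbedding.inclusion (hsub Z), ?_⟩
      rw [Set.range_inclusion]
      exact isOpen_innerBoundary cs hM Z.2
    exact (h1.comp (e Z).symm.isOpenEmbedding).isOpenMap
  let F := (Equiv.ofBijective f ⟨hinj, hsurj⟩).toHomeomorphOfContinuousOpen hcont hopen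
  refine ⟨F.symm, fun x Z => ?_⟩
  obtain ⟨p, rfl⟩ := F.surjective x
  rw [Homeomorph.symm_apply_apply]
  constructor
  · exact fun h => huniq _ _ _ (hfmem p) h
  · rintro rfl
    exact hfmem p

theorem isTopManifold_innerBoundary (hF : IsFlag (nerve cs.simple)) {n : ℕ}
    (hS : Nonempty (realization (nerve cs.simple) ≃ₜ
      Metric.sphere (0 : EuclideanSpace ℝ (Fin n)) 1)) {a : Color cs t}
    {Z : Set (SphericalCoset cs.simple → ℝ)} (hZ : Z ∈ ComponentOfColor cs t hM a) :
    IsTopManifold (n - 1) (innerBoundary cs t Z) := by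
  have := countable_sphericalCoset cs
  obtain ⟨e⟩ := nonempty_innerBoundary_homeomorph cs hM hF hZ
  exact isTopManifold_of_isEuclideanAt fun x =>
    (isEuclideanAt_iff_of_isOpenEmbedding e.isOpenEmbedding x).1
      (isEuclideanAt_davisComplex_link cs hM t hF hS (e x))

theorem isTopManifold_collarInnerBoundary (hF : IsFlag (nerve cs.simple)) {n : ℕ}
    (hS : Nonempty (realization (nerve cs.simple) ≃ₜ
      Metric.sphere (0 : EuclideanSpace ℝ (Fin n)) 1)) (a : Color cs t) :
    IsTopManifold (n - 1) (collarInnerBoundary cs t hM a) := by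
  have := countable_sphericalCoset cs
  obtain ⟨e, -⟩ := exists_collarInnerBoundary_homeomorph cs hM hF a
  refine isTopManifold_of_isEuclideanAt fun x =>
    (isEuclideanAt_iff_of_isOpenEmbedding e.isOpenEmbedding x).1 ?_
  generalize e x = p
  obtain ⟨Z, y⟩ := p
  exact (isEuclideanAt_iff_of_isOpenEmbedding (Topology.IsOpenEmbedding.sigmaMk
    (σ := fun _ : ComponentOfColor cs t hM a => davisComplex (linkGenerator cs t)) (i := Z)) y).2
    (isEuclideanAt_davisComplex_link cs hM t hF hS y)

end Final

end DavisRuin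

theorem mainTheorem8 {B W : Type*} [Finite B] [Group W] {M : CoxeterMatrix B}
    (cs : CoxeterSystem M W) (hM : DavisRuin.IsEvenMatrix M) (t : B)
    (o : DavisRuin.Color cs t) (ho : DavisRuin.IsOddColor cs t hM o)
    (O : Set (DavisRuin.Color cs t)) (hO : ∀ a ∈ O, DavisRuin.IsOddColor cs t hM a)
    (hoO : o ∉ O) :
    -- the intersection is the inner boundary, a disjoint union over the boundary collars
    (DavisRuin.collar cs t hM o ∩ DavisRuin.evenCollarsUnion cs t hM O
        = DavisRuin.collarInnerBoundary cs t hM o ∧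
      (DavisRuin.ComponentOfColor cs t hM o).PairwiseDisjoint (DavisRuin.innerBoundary cs t)) ∧
    -- if the nerve is flag, it is a topological disjoint union of copies of the Davis complex of
    -- `(W_{U-t}, U-t)`, one copy for each boundary collar
    (DavisRuin.IsFlag (DavisRuin.nerve cs.simple) →
      ∃ h : ↥(DavisRuin.collar cs t hM o ∩ DavisRuin.evenCollarsUnion cs t hM O) ≃ₜ
          (Σ _ : ↥(DavisRuin.ComponentOfColor cs t hM o),
            ↥(DavisRuin.davisComplex (DavisRuin.linkGenerator cs t))),
        ∀ (x : ↥(DavisRuin.collar cs t hM o ∩ DavisRuin.evenCollarsUnion cs t hM O))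
          (Z : ↥(DavisRuin.ComponentOfColor cs t hM o)),
          x.1 ∈ DavisRuin.innerBoundary cs t Z.1 ↔ (h x).1 = Z) ∧
    -- if moreover the nerve triangulates the sphere of dimension `n - 1` (then `n ≥ 1`, since `t`
    -- is a vertex of the nerve), the intersection and its pieces are `(n - 1)`-manifolds
    (∀ n : ℕ, DavisRuin.IsFlag (DavisRuin.nerve cs.simple) →
      Nonempty (↥(DavisRuin.realization (DavisRuin.nerve cs.simple)) ≃ₜ
        ↥(Metric.sphere (0 : EuclideanSpace ℝ (Fin n)) 1)) →
      DavisRuin.IsTopManifold (n - 1)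
        ↥(DavisRuin.collar cs t hM o ∩ DavisRuin.evenCollarsUnion cs t hM O) ∧
      ∀ Z ∈ DavisRuin.ComponentOfColor cs t hM o,
        DavisRuin.IsTopManifold (n - 1) ↥(DavisRuin.innerBoundary cs t Z)) := by
  rw [DavisRuin.collar_inter_evenCollarsUnion cs hM ho hoO]
  exact ⟨⟨rfl, DavisRuin.innerBoundary_pairwiseDisjoint cs hM o⟩,
    fun hF => DavisRuin.exists_collarInnerBoundary_homeomorph cs hM hF o,
    fun n hF hS => ⟨DavisRuin.isTopManifold_collarInnerBoundary cs hM hF hS o,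
      fun _ hZ => DavisRuin.isTopManifold_innerBoundary cs hM hF hS hZ⟩⟩
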